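/- Let $A=\begin{pmatrix}2&-1\\-1&2\end{pmatrix}$ be the Cartan matrix of $\mathfrak{sl}_3$, with Cartan subalgebra $\mathfrak h=\mathrm{span}\{H_1,H_2\}$, simple roots $\alpha_1,\alpha_2$, highest root $\alpha_3=\alpha_1+\alpha_2$, Weyl vector $\rho=\alpha_3$, root and weight lattices $Q\subseteq P$, and bilinear form on $\mathfrak h^*$ normalised by $\langle\alpha_i,\alpha_j\rangle=A_{i,j}$. Write $\mathrm i^z=e^{\pi \mathrm i z/2}$. Let $L$ be a lattice with $Q\subseteq L\subseteq P$, and let $\mathcal U$ be the unrolled restricted quantum group of $\mathfrak{sl}_3$ at $q=\mathrm i$, that is, the complex algebra with generators $X_{\pm j}$, $H_j$ ($j=1,2$) and $K_\gamma$ ($\gamma\in L$) and relations $$K_0=1,\quad K_{\gamma}K_{\delta}=K_{\gamma+\delta},\quad K_\gamma X_{\pm j}K_{-\gamma}=\mathrm i^{\pm\langle\gamma,\alpha_j\rangle}X_{\pm j},\quad [X_j,X_{-j'}]=\delta_{j,j'}\frac{K_{\alpha_j}-K_{-\alpha_j}}{2\mathrm i},$$ $$X_{\pm j}^2=0,\quad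 (X_{\pm1}X_{\pm2})^2=(X_{\pm2}X_{\pm1})^2,\quad [H_j,X_{\pm j'}]=\pm A_{j,j'}X_{\pm j'},\quad [H_j,H_{j'}]=[H_j,K_\gamma]=0,$$ acting on tensor products through the coproduct $\Delta(K_\gamma)=K_\gamma\otimes K_\gamma$, $\Delta(X_j)=X_j\otimes K_{\alpha_j}+1\otimes X_j$, $\Delta(X_{-j})=X_{-j}\otimes1+K_{-\alpha_j}\otimes X_{-j}$, $\Delta(H_j)=H_j\otimes 1+1\otimes H_j$. Let $\mathscr C$ be the category of finite-dimensional weight $\mathcal U$-modules: those that are the direct sum of their simultaneous $H_1,H_2$-eigenspaces $V(\lambda)$, $\lambda\in\mathfrak h^*$, with each $K_\gamma$ acting on $V(\lambda)$ as $\mathrm i^{\langle\gamma,\lambda\rangle}$. For $\lambda\in\mathfrak h^*$ let $L_\lambda$ be the irreducible quotient of the Verma module of highest weight $\lambda$ and let $P_\lambda$ be the projective cover of $L_\lambda$ in $\mathscr C$; superscripts $L^{(d)}_\lambda$, $P^{(d)}_\lambda$ indicate (and assert) that the dimension is $d$. Put $\lambda_k=\langle\lambda+\rho,\alpha_k\rangle$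 for $k=1,2,3$, and call $\lambda$ typical if $\lambda_1,\lambda_2,\lambda_3\notin2\mathbb Z+1$. **Proposition.** Let $\{i,j\}=\{1,2\}$, let $\lambda\in\mathfrak h^*$ satisfy $\lambda_i\in2\mathbb Z+1$ and $\lambda_j,\lambda_3\notin\mathbb Z$, and let $\mu\in\mathfrak h^*$ be typical. Then exactly one of the following eight conditions holds, the projective covers that occur exist, and $L^{(4)}_\lambda\otimes L^{(8)}_\mu$ is isomorphic to 1. if $\mu_i,\lambda_j+\mu_j\in2\mathbb Z$ and $\lambda_3+\mu_3\in2\mathbb Z+1$: $P^{(24)}_{\lambda+\mu-\alpha_3}\oplus P^{(8)}_{\lambda+\mu-\alpha_j-\alpha_3}$; 2. if $\mu_i,\lambda_3+\mu_3\in2\mathbb Z$ and $\lambda_j+\mu_j\in2\mathbb Z+1$: $P^{(8)}_{\lambda+\mu}\oplus P^{(24)}_{\lambda+\mu-\alpha_j-\alpha_3}$; 3. if $\mu_i\in2\mathbb Z$ and $\lambda_j+\mu_j,\lambda_3+\mu_3\notin\mathbb Z$: $P^{(8)}_{\lambda+\mu}\oplus P^{(16)}_{\lambda+\mu-\alpha_3}\oplus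 P^{(8)}_{\lambda+\mu-\alpha_j-\alpha_3}$; 4. if $\lambda_j+\mu_j\in2\mathbb Z$ and $\mu_i,\lambda_3+\mu_3\notin\mathbb Z$: $P^{(16)}_{\lambda+\mu-\alpha_j}\oplus P^{(8)}_{\lambda+\mu-\alpha_3}\oplus P^{(8)}_{\lambda+\mu-\alpha_j-\alpha_3}$; 5. if $\lambda_j+\mu_j\in2\mathbb Z+1$ and $\mu_i,\lambda_3+\mu_3\notin\mathbb Z$: $P^{(8)}_{\lambda+\mu}\oplus P^{(8)}_{\lambda+\mu-\alpha_j}\oplus P^{(16)}_{\lambda+\mu-\alpha_j-\alpha_3}$; 6. if $\lambda_3+\mu_3\in2\mathbb Z$ and $\mu_i,\lambda_j+\mu_j\notin\mathbb Z$: $P^{(8)}_{\lambda+\mu}\oplus P^{(8)}_{\lambda+\mu-\alpha_3}\oplus P^{(16)}_{\lambda+\mu-\alpha_j-\alpha_3}$; 7. if $\lambda_3+\mu_3\in2\mathbb Z+1$ and $\mu_i,\lambda_j+\mu_j\notin\mathbb Z$: $P^{(8)}_{\lambda+\mu-\alpha_j}\oplus P^{(16)}_{\lambda+\mu-\alpha_3}\oplus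 P^{(8)}_{\lambda+\mu-\alpha_j-\alpha_3}$; 8. if $\mu_i,\lambda_j+\mu_j,\lambda_3+\mu_3\notin\mathbb Z$: $P^{(8)}_{\lambda+\mu}\oplus P^{(8)}_{\lambda+\mu-\alpha_j}\oplus P^{(8)}_{\lambda+\mu-\alpha_3}\oplus P^{(8)}_{\lambda+\mu-\alpha_j-\alpha_3}$. -/

import Mathlib

open scoped TensorProduct

noncomputable section

namespace UnrolledSl3

/-! ### Weights of `sl₃` -/

/-- The dual `𝔥*` of the Cartan subalgebra `𝔥 = span {H₁, H₂}` of `sl₃`. A weight `lam` is given by its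
values `(lam H₁, lam H₂)` on the simple coroots, which are numbered here by `Fin 2`. -/
abbrev Weight : Type := Fin 2 → ℂ

/-- The Cartan matrix of `sl₃`. -/
def cartan : Matrix (Fin 2) (Fin 2) ℤ := !![2, -1; -1, 2]

/-- The simple roots: `α j` takes the value `A i j` on the coroot `H i`. -/
def α (j : Fin 2) : Weight := fun i => (cartan i j : ℂ)

/-- The highest root `α₃ = α₁ + α₂`. -/
def α₃ : Weight := α 0 + α 1

/-- The bilinear form on `𝔥*`, normalised by `⟨αᵢ, αⱼ⟩ = A i j` (see `form_α_α`). Its matrix in the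
basis of fundamental weights is the inverse of the Cartan matrix. -/
def form (x y : Weight) : ℂ :=
  (2 * x 0 * y 0 + x 0 * y 1 + x 1 * y 0 + 2 * x 1 * y 1) / 3

theorem form_α (x : Weight) (j : Fin 2) : form x (α j) = x j := by
  fin_cases j <;> simp [form, α, cartan] <;> ring

theorem form_α_α (i j : Fin 2) : form (α i) (α j) = (cartan i j : ℂ) := by
  rw [form_α]
  fin_cases i <;> fin_cases j <;> simp [α, cartan]

/-- The Weyl vector of `sl₃`, the half-sum of the positive roots. -/
def ρ : Weight := (2⁻¹ : ℂ) • (α 0 + α 1 + α₃)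

/-- The index `⟨lam + ρ, β⟩` of the weight `lam` along the root `β`; the numbers `lam₁, lam₂, lam₃`
are `idx lam (α 0)`, `idx lam (α 1)`, `idx lam α₃`. -/
def idx (lam β : Weight) : ℂ := form (lam + ρ) β

/-- `z ∈ ℤ`. -/
def IsInt (z : ℂ) : Prop := ∃ n : ℤ, z = n

/-- `z ∈ 2ℤ`. -/
def IsEvenInt (z : ℂ) : Prop := ∃ n : ℤ, z = 2 * n

/-- `z ∈ 2ℤ + 1`. -/
def IsOddInt (z : ℂ) : Prop := ∃ n : ℤ, z = 2 * n + 1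

/-- A weight is typical if none of its three indices is an odd integer. -/
def IsTypical (lam : Weight) : Prop :=
  (∀ j : Fin 2, ¬ IsOddInt (idx lam (α j))) ∧ ¬ IsOddInt (idx lam α₃)

/-- The root lattice `Q`. -/
def rootLattice : AddSubgroup Weight := AddSubgroup.closure (Set.range α)

/-- The weight lattice `P`: the weights with integral values on the coroots. -/
def weightLattice : AddSubgroup Weight where
  carrier := {x | ∀ j, IsInt (x j)}
  zero_mem' := fun _ => ⟨0, by simp⟩
  add_mem' := by
    intro x y hx hy j
    obtain ⟨m, hm⟩ := hx j
    obtain ⟨n, hn⟩ := hy j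
    exact ⟨m + n, by simp [hm, hn]⟩
  neg_mem' := by
    intro x hx j
    obtain ⟨m, hm⟩ := hx j
    exact ⟨-m, by simp [hm]⟩

/-- A lattice `L` with `Q ⊆ L ⊆ P`. -/
structure MidLattice where
  lat : AddSubgroup Weight
  root_le : rootLattice ≤ lat
  le_weight : lat ≤ weightLattice

/-- The simple root `α j` as an element of the lattice. -/
def MidLattice.root (L : MidLattice) (j : Fin 2) : L.lat :=
  ⟨α j, L.root_le (AddSubgroup.subset_closure ⟨j, rfl⟩)⟩

/-- `𝐢 ^ z = exp (π 𝐢 z / 2)`. -/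
def iPow (z : ℂ) : ℂ := Complex.exp (Real.pi * Complex.I / 2 * z)

/-! ### The unrolled restricted quantum group -/

/-- The generators: `E j` is `X_j`, `F j` is `X_{-j}`. -/
inductive Gen (L : MidLattice) : Type
  | E (j : Fin 2)
  | F (j : Fin 2)
  | H (j : Fin 2)
  | K (γ : L.lat)

/-- A generator as an element of the free algebra. -/
abbrev gen {L : MidLattice} (g : Gen L) : FreeAlgebra ℂ (Gen L) := FreeAlgebra.ι ℂ g

/-- The defining relations. -/
inductive Rel (L : MidLattice) : FreeAlgebra ℂ (Gen L) → FreeAlgebra ℂ (Gen L) → Prop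
  | K_zero : Rel L (gen (.K 0)) 1
  | K_add (γ δ : L.lat) : Rel L (gen (.K γ) * gen (.K δ)) (gen (.K (γ + δ)))
  | K_E (γ : L.lat) (j : Fin 2) :
      Rel L (gen (.K γ) * gen (.E j) * gen (.K (-γ))) (iPow (form γ (α j)) • gen (.E j))
  | K_F (γ : L.lat) (j : Fin 2) :
      Rel L (gen (.K γ) * gen (.F j) * gen (.K (-γ))) (iPow (-form γ (α j)) • gen (.F j))
  | E_F (j j' : Fin 2) :
      Rel L (gen (.E j) * gen (.F j') - gen (.F j') * gen (.E j))
        (if j = j' then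
          (2 * Complex.I)⁻¹ • (gen (.K (L.root j)) - gen (.K (-L.root j))) else 0)
  | E_sq (j : Fin 2) : Rel L (gen (.E j) ^ 2) 0
  | F_sq (j : Fin 2) : Rel L (gen (.F j) ^ 2) 0
  | E_braid : Rel L ((gen (.E 0) * gen (.E 1)) ^ 2) ((gen (.E 1) * gen (.E 0)) ^ 2)
  | F_braid : Rel L ((gen (.F 0) * gen (.F 1)) ^ 2) ((gen (.F 1) * gen (.F 0)) ^ 2)
  | H_E (j j' : Fin 2) :
      Rel L (gen (.H j) * gen (.E j') - gen (.E j') * gen (.H j))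
        ((cartan j j' : ℂ) • gen (.E j'))
  | H_F (j j' : Fin 2) :
      Rel L (gen (.H j) * gen (.F j') - gen (.F j') * gen (.H j))
        (-(cartan j j' : ℂ) • gen (.F j'))
  | H_H (j j' : Fin 2) : Rel L (gen (.H j) * gen (.H j')) (gen (.H j') * gen (.H j))
  | H_K (j : Fin 2) (γ : L.lat) : Rel L (gen (.H j) * gen (.K γ)) (gen (.K γ) * gen (.H j))

/-- The unrolled restricted quantum group of `sl₃` at the fourth root of unity `𝐢`. -/
abbrev U (L : MidLattice) : Type := RingQuot (Rel L)

/-- The generators in the quantum group. -/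
def U.of (L : MidLattice) (g : Gen L) : U L := RingQuot.mkAlgHom ℂ (Rel L) (gen g)

/-- The values of the coproduct on the generators. -/
def comulGen (L : MidLattice) : Gen L → U L ⊗[ℂ] U L
  | .E j => U.of L (.E j) ⊗ₜ U.of L (.K (L.root j)) + 1 ⊗ₜ U.of L (.E j)
  | .F j => U.of L (.F j) ⊗ₜ 1 + U.of L (.K (-L.root j)) ⊗ₜ U.of L (.F j)
  | .H j => 1 ⊗ₜ U.of L (.H j) + U.of L (.H j) ⊗ₜ 1
  | .K γ => U.of L (.K γ) ⊗ₜ U.of L (.K γ)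

/-! The coproduct respects the defining relations. -/


theorem iPow_zero : iPow 0 = 1 := by simp [iPow]

theorem iPow_add (z w : ℂ) : iPow (z + w) = iPow z * iPow w := by
  simp [iPow, mul_add, Complex.exp_add]

theorem iPow_one : iPow 1 = Complex.I := by
  rw [iPow, show (Real.pi * Complex.I / 2 * 1 : ℂ) = Real.pi / 2 * Complex.I by ring,
    Complex.exp_pi_div_two_mul_I]

theorem iPow_two : iPow 2 = -1 := by
  have : (2 : ℂ) = 1 + 1 := by norm_num
  rw [this, iPow_add, iPow_one, Complex.I_mul_I]

theorem iPow_neg_one : iPow (-1) = -Complex.I := by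
  have h : iPow (-1 + 1) = iPow (-1) * iPow 1 := iPow_add _ _
  rw [neg_add_cancel, iPow_zero, iPow_one] at h
  have h2 := congrArg (fun z => -(z * Complex.I)) h
  simp only [mul_assoc, Complex.I_mul_I] at h2
  simpa using h2.symm

theorem form_comm (x y : Weight) : form x y = form y x := by
  simp only [form]
  ring

theorem form_neg_left (x y : Weight) : form (-x) y = -form x y := by
  simp only [form, Pi.neg_apply]
  ring

section Relations

variable {L : MidLattice}

theorem of_rel {x y : FreeAlgebra ℂ (Gen L)} (h : Rel L x y) :
    RingQuot.mkAlgHom ℂ (Rel L) x = RingQuot.mkAlgHom ℂ (Rel L) y :=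
  RingQuot.mkAlgHom_rel ℂ h

theorem K_zero : U.of L (.K (0 : L.lat)) = 1 := by
  simpa [U.of] using of_rel (Rel.K_zero (L := L))

theorem K_mul_K (γ δ : L.lat) : U.of L (.K γ) * U.of L (.K δ) = U.of L (.K (γ + δ)) := by
  simpa [U.of] using of_rel (Rel.K_add γ δ)

theorem K_neg_mul (γ : L.lat) : U.of L (.K (-γ)) * U.of L (.K γ) = 1 := by
  rw [K_mul_K, neg_add_cancel, K_zero]

theorem K_mul_neg (γ : L.lat) : U.of L (.K γ) * U.of L (.K (-γ)) = 1 := by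
  rw [K_mul_K, add_neg_cancel, K_zero]

theorem K_conj_K (γ δ : L.lat) :
    U.of L (.K γ) * U.of L (.K δ) * U.of L (.K (-γ)) = U.of L (.K δ) := by
  rw [K_mul_K, K_mul_K, add_neg_cancel_comm]

theorem K_conj_E (γ : L.lat) (j : Fin 2) :
    U.of L (.K γ) * U.of L (.E j) * U.of L (.K (-γ)) = iPow (form γ (α j)) • U.of L (.E j) := by
  simpa [U.of] using of_rel (Rel.K_E γ j)

theorem K_conj_F (γ : L.lat) (j : Fin 2) :
    U.of L (.K γ) * U.of L (.F j) * U.of L (.K (-γ)) = iPow (-form γ (α j)) • U.of L (.F j) := by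
  simpa [U.of] using of_rel (Rel.K_F γ j)

theorem form_α_root (i j : Fin 2) : form (L.root i : Weight) (α j) = (cartan i j : ℂ) :=
  form_α_α i j

theorem K_mul_E (γ : L.lat) (j : Fin 2) :
    U.of L (.K γ) * U.of L (.E j) = iPow (form γ (α j)) • (U.of L (.E j) * U.of L (.K γ)) := by
  rw [← smul_mul_assoc, ← K_conj_E, mul_assoc _ _ (U.of L (.K γ)), K_neg_mul, mul_one]

theorem K_mul_F (γ : L.lat) (j : Fin 2) :
    U.of L (.K γ) * U.of L (.F j) = iPow (-form γ (α j)) • (U.of L (.F j) * U.of L (.K γ)) := by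
  rw [← smul_mul_assoc, ← K_conj_F, mul_assoc _ _ (U.of L (.K γ)), K_neg_mul, mul_one]

theorem E_F_comm (j j' : Fin 2) :
    U.of L (.E j) * U.of L (.F j') - U.of L (.F j') * U.of L (.E j) =
      if j = j' then
        (2 * Complex.I)⁻¹ • (U.of L (.K (L.root j)) - U.of L (.K (-L.root j))) else (0 : U L) := by
  have h := of_rel (Rel.E_F (L := L) j j')
  split_ifs at h ⊢ with hj
  · simpa only [U.of, map_sub, map_mul, map_smul] using h
  · simpa only [U.of, map_sub, map_mul, map_zero] using h

theorem E_mul_E (j : Fin 2) : U.of L (.E j) * U.of L (.E j) = (0 : U L) := by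
  simpa [U.of, pow_two] using of_rel (Rel.E_sq (L := L) j)

theorem F_mul_F (j : Fin 2) : U.of L (.F j) * U.of L (.F j) = (0 : U L) := by
  simpa [U.of, pow_two] using of_rel (Rel.F_sq (L := L) j)

theorem E_braid : (U.of L (.E 0) * U.of L (.E 1)) ^ 2 = ((U.of L (.E 1) * U.of L (.E 0)) ^ 2 : U L) := by
  simpa [U.of] using of_rel (Rel.E_braid (L := L))

theorem F_braid : (U.of L (.F 0) * U.of L (.F 1)) ^ 2 = ((U.of L (.F 1) * U.of L (.F 0)) ^ 2 : U L) := by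
  simpa [U.of] using of_rel (Rel.F_braid (L := L))

theorem H_E_comm (j j' : Fin 2) :
    U.of L (.H j) * U.of L (.E j') - U.of L (.E j') * U.of L (.H j) =
      ((cartan j j' : ℂ) • U.of L (.E j') : U L) := by
  simpa only [U.of, map_sub, map_mul, map_smul] using of_rel (Rel.H_E (L := L) j j')

theorem H_F_comm (j j' : Fin 2) :
    U.of L (.H j) * U.of L (.F j') - U.of L (.F j') * U.of L (.H j) =
      (-(cartan j j' : ℂ) • U.of L (.F j') : U L) := by
  simpa only [U.of, map_sub, map_mul, map_smul] using of_rel (Rel.H_F (L := L) j j')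

theorem H_mul_H (j j' : Fin 2) :
    U.of L (.H j) * U.of L (.H j') = (U.of L (.H j') * U.of L (.H j) : U L) := by
  simpa only [U.of, map_mul] using of_rel (Rel.H_H (L := L) j j')

theorem H_mul_K (j : Fin 2) (γ : L.lat) :
    U.of L (.H j) * U.of L (.K γ) = U.of L (.K γ) * U.of L (.H j) := by
  simpa only [U.of, map_mul] using of_rel (Rel.H_K (L := L) j γ)

theorem cartan_symm (i j : Fin 2) : cartan i j = cartan j i := by
  fin_cases i <;> fin_cases j <;> simp [cartan]

end Relations

theorem braided_sq {R : Type*} [Ring R] [Algebra ℂ R] {a b : R} (ha : a * a = 0) (hb : b * b = 0)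
    (hab : a * b = (-1 : ℂ) • (b * a)) :
    (a + b) ^ 2 = 0 := by
  rw [pow_two, add_mul, mul_add, mul_add, ha, hb, hab, neg_smul, one_smul]
  abel

theorem braided_braid {R : Type*} [Ring R] [Algebra ℂ R] {a₁ a₂ b₁ b₂ : R} (ha₁ : a₁ * a₁ = 0) (ha₂ : a₂ * a₂ = 0)
    (hb₁ : b₁ * b₁ = 0) (hb₂ : b₂ * b₂ = 0)
    (ha : (a₁ * a₂) ^ 2 = (a₂ * a₁) ^ 2) (hb : (b₁ * b₂) ^ 2 = (b₂ * b₁) ^ 2)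
    (h11 : a₁ * b₁ = (-1 : ℂ) • (b₁ * a₁)) (h22 : a₂ * b₂ = (-1 : ℂ) • (b₂ * a₂))
    (h12 : a₁ * b₂ = (-Complex.I) • (b₂ * a₁)) (h21 : a₂ * b₁ = (-Complex.I) • (b₁ * a₂)) :
    ((a₁ + b₁) * (a₂ + b₂)) ^ 2 = ((a₂ + b₂) * (a₁ + b₁)) ^ 2 := by
  rw [neg_smul, one_smul] at h11 h22
  have h11' (x : R) : a₁ * (b₁ * x) = -(b₁ * (a₁ * x)) := by rw [← mul_assoc, h11]; noncomm_ring
  have h22' (x : R) : a₂ * (b₂ * x) = -(b₂ * (a₂ * x)) := by rw [← mul_assoc, h22]; noncomm_ring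
  have h12' (x : R) : a₁ * (b₂ * x) = (-Complex.I) • (b₂ * (a₁ * x)) := by
    rw [← mul_assoc, h12, smul_mul_assoc, mul_assoc]
  have h21' (x : R) : a₂ * (b₁ * x) = (-Complex.I) • (b₁ * (a₂ * x)) := by
    rw [← mul_assoc, h21, smul_mul_assoc, mul_assoc]
  have k1 (x : R) : a₁ * (a₁ * x) = 0 := by rw [← mul_assoc, ha₁, zero_mul]
  have k2 (x : R) : a₂ * (a₂ * x) = 0 := by rw [← mul_assoc, ha₂, zero_mul]
  have k3 (x : R) : b₁ * (b₁ * x) = 0 := by rw [← mul_assoc, hb₁, zero_mul]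
  have k4 (x : R) : b₂ * (b₂ * x) = 0 := by rw [← mul_assoc, hb₂, zero_mul]
  simp only [pow_two, mul_assoc] at ha hb
  simp only [pow_two, mul_add, add_mul, mul_assoc, h11, h22, h12, h21, h11', h22', h12', h21',
    ha₁, ha₂, k1, k2, k3, k4, mul_neg, mul_smul_comm, smul_mul_assoc, smul_neg,
    smul_smul, neg_neg, mul_zero, smul_zero, neg_zero, add_zero, zero_add, ha, hb, neg_mul,
    Complex.I_mul_I, neg_smul, smul_add, one_smul]
  abel

theorem comul_rel (L : MidLattice) {x y : FreeAlgebra ℂ (Gen L)} (h : Rel L x y) :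
    FreeAlgebra.lift ℂ (comulGen L) x = FreeAlgebra.lift ℂ (comulGen L) y := by
  have hroot (i j : Fin 2) : form (L.root i : Weight) (α j) = (cartan i j : ℂ) := form_α_α i j
  have hneg (γ : L.lat) (j : Fin 2) : form ((-γ : L.lat) : Weight) (α j) = -form γ (α j) := by
    rw [NegMemClass.coe_neg, form_neg_left]
  have hE (i j : Fin 2) : U.of L (.K (L.root i)) * U.of L (.E j)
      = iPow (cartan i j) • (U.of L (.E j) * U.of L (.K (L.root i))) := by
    rw [K_mul_E, hroot]
  have hF (i j : Fin 2) : U.of L (.K (-L.root i)) * U.of L (.F j)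
      = iPow (cartan i j) • (U.of L (.F j) * U.of L (.K (-L.root i))) := by
    rw [K_mul_F, hneg, hroot, neg_neg]
  have tE (i j : Fin 2) : (U.of L (.E i) ⊗ₜ[ℂ] U.of L (.K (L.root i))) * ((1 : U L) ⊗ₜ[ℂ] U.of L (.E j))
      = iPow (cartan i j) • (((1 : U L) ⊗ₜ[ℂ] U.of L (.E j)) * (U.of L (.E i) ⊗ₜ[ℂ] U.of L (.K (L.root i)))) := by
    simp only [Algebra.TensorProduct.tmul_mul_tmul, mul_one, one_mul, hE, TensorProduct.tmul_smul]
  have tF (i j : Fin 2) : (U.of L (.K (-L.root i)) ⊗ₜ[ℂ] U.of L (.F i)) * (U.of L (.F j) ⊗ₜ[ℂ] (1 : U L))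
      = iPow (cartan i j) • ((U.of L (.F j) ⊗ₜ[ℂ] (1 : U L)) * (U.of L (.K (-L.root i)) ⊗ₜ[ℂ] U.of L (.F i))) := by
    simp only [Algebra.TensorProduct.tmul_mul_tmul, mul_one, one_mul, hF, TensorProduct.smul_tmul']
  have aE (j : Fin 2) : (U.of L (.E j) ⊗ₜ[ℂ] U.of L (.K (L.root j)))
      * (U.of L (.E j) ⊗ₜ[ℂ] U.of L (.K (L.root j))) = 0 := by
    rw [Algebra.TensorProduct.tmul_mul_tmul, E_mul_E, TensorProduct.zero_tmul]
  have bE (j : Fin 2) : ((1 : U L) ⊗ₜ[ℂ] (U.of L (.E j) : U L)) * (1 ⊗ₜ[ℂ] U.of L (.E j)) = 0 := by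
    rw [Algebra.TensorProduct.tmul_mul_tmul, E_mul_E, TensorProduct.tmul_zero]
  have aF (j : Fin 2) : (U.of L (.K (-L.root j)) ⊗ₜ[ℂ] U.of L (.F j))
      * (U.of L (.K (-L.root j)) ⊗ₜ[ℂ] U.of L (.F j)) = 0 := by
    rw [Algebra.TensorProduct.tmul_mul_tmul, F_mul_F, TensorProduct.tmul_zero]
  have bF (j : Fin 2) : ((U.of L (.F j) : U L) ⊗ₜ[ℂ] (1 : U L)) * (U.of L (.F j) ⊗ₜ[ℂ] 1) = 0 := by
    rw [Algebra.TensorProduct.tmul_mul_tmul, F_mul_F, TensorProduct.zero_tmul]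
  have c00 : iPow (cartan 0 0) = -1 := by simp [cartan, iPow_two]
  have c11 : iPow (cartan 1 1) = -1 := by simp [cartan, iPow_two]
  have c01 : iPow (cartan 0 1) = -Complex.I := by simp [cartan, iPow_neg_one]
  have c10 : iPow (cartan 1 0) = -Complex.I := by simp [cartan, iPow_neg_one]
  have cjj (j : Fin 2) : iPow (cartan j j) = -1 := by fin_cases j <;> assumption
  have hKK (γ δ : L.lat) : U.of L (.K γ) * U.of L (.K δ) = U.of L (.K δ) * U.of L (.K γ) := by
    rw [K_mul_K, K_mul_K, add_comm]
  cases h with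
  | K_zero => simp [comulGen, K_zero, Algebra.TensorProduct.one_def]
  | K_add γ δ => simp [comulGen, K_mul_K]
  | K_E γ j =>
    simp only [gen, map_mul, map_smul, FreeAlgebra.lift_ι_apply, comulGen, mul_add, add_mul,
      Algebra.TensorProduct.tmul_mul_tmul, mul_one, K_conj_E, K_mul_neg, K_conj_K, smul_add,
      TensorProduct.tmul_smul, TensorProduct.smul_tmul']
  | K_F γ j =>
    simp only [gen, map_mul, map_smul, FreeAlgebra.lift_ι_apply, comulGen, mul_add, add_mul,
      Algebra.TensorProduct.tmul_mul_tmul, mul_one, K_conj_F, K_mul_neg, K_conj_K, smul_add,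
      TensorProduct.tmul_smul, TensorProduct.smul_tmul']
  | E_F j j' =>
    have cross : (U.of L (.E j) * U.of L (.K (-L.root j'))) ⊗ₜ[ℂ] (U.of L (.K (L.root j)) * U.of L (.F j'))
        = (U.of L (.K (-L.root j')) * U.of L (.E j)) ⊗ₜ[ℂ] (U.of L (.F j') * U.of L (.K (L.root j))) := by
      rw [K_mul_F, K_mul_E, hneg, form_α_root, form_α_root, cartan_symm j' j,
        TensorProduct.tmul_smul, TensorProduct.smul_tmul']
    have key : FreeAlgebra.lift ℂ (comulGen L)
          (gen (.E j) * gen (.F j') - gen (.F j') * gen (.E j))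
        = (U.of L (.E j) * U.of L (.F j') - U.of L (.F j') * U.of L (.E j)) ⊗ₜ[ℂ] U.of L (.K (L.root j))
          + U.of L (.K (-L.root j'))
            ⊗ₜ[ℂ] (U.of L (.E j) * U.of L (.F j') - U.of L (.F j') * U.of L (.E j)) := by
      simp only [gen, map_sub, map_mul, FreeAlgebra.lift_ι_apply, comulGen, mul_add, add_mul,
        Algebra.TensorProduct.tmul_mul_tmul, mul_one, one_mul, cross, TensorProduct.sub_tmul,
        TensorProduct.tmul_sub]
      abel
    rw [key, E_F_comm]
    split_ifs with hj
    · subst hj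
      simp only [gen, map_sub, map_smul, FreeAlgebra.lift_ι_apply, comulGen,
        TensorProduct.tmul_smul, ← TensorProduct.smul_tmul', ← smul_add, TensorProduct.sub_tmul,
        TensorProduct.tmul_sub]
      congr 1
      abel
    · simp
  | E_sq j =>
    simp only [gen, map_pow, FreeAlgebra.lift_ι_apply, comulGen, map_zero]
    refine braided_sq (R := U L ⊗[ℂ] U L) (aE j) (bE j) ?_
    rw [tE, cjj]
  | F_sq j =>
    simp only [gen, map_pow, FreeAlgebra.lift_ι_apply, comulGen, map_zero]
    rw [add_comm]
    refine braided_sq (R := U L ⊗[ℂ] U L) (aF j) (bF j) ?_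
    rw [tF, cjj]
  | E_braid =>
    simp only [gen, map_pow, map_mul, FreeAlgebra.lift_ι_apply, comulGen]
    refine braided_braid (R := U L ⊗[ℂ] U L) (aE 0) (aE 1) (bE 0) (bE 1) ?_ ?_ ?_ ?_ ?_ ?_
    · simp only [Algebra.TensorProduct.tmul_mul_tmul, Algebra.TensorProduct.tmul_pow, E_braid]
      rw [hKK]
    · simp only [Algebra.TensorProduct.tmul_mul_tmul, Algebra.TensorProduct.tmul_pow, E_braid]
    · rw [tE, c00]
    · rw [tE, c11]
    · rw [tE, c01]
    · rw [tE, c10]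
  | F_braid =>
    simp only [gen, map_pow, map_mul, FreeAlgebra.lift_ι_apply, comulGen]
    rw [add_comm (U.of L (.F 0) ⊗ₜ[ℂ] 1), add_comm (U.of L (.F 1) ⊗ₜ[ℂ] 1)]
    refine braided_braid (R := U L ⊗[ℂ] U L) (aF 0) (aF 1) (bF 0) (bF 1) ?_ ?_ ?_ ?_ ?_ ?_
    · simp only [Algebra.TensorProduct.tmul_mul_tmul, Algebra.TensorProduct.tmul_pow, F_braid]
      rw [hKK]
    · simp only [Algebra.TensorProduct.tmul_mul_tmul, Algebra.TensorProduct.tmul_pow, F_braid]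
    · rw [tF, c00]
    · rw [tF, c11]
    · rw [tF, c01]
    · rw [tF, c10]
  | H_E j j' =>
    have h1 := H_E_comm (L := L) j j'
    have key : FreeAlgebra.lift ℂ (comulGen L)
          (gen (.H j) * gen (.E j') - gen (.E j') * gen (.H j))
        = (U.of L (.H j) * U.of L (.E j') - U.of L (.E j') * U.of L (.H j)) ⊗ₜ[ℂ] U.of L (.K (L.root j'))
          + 1 ⊗ₜ[ℂ] (U.of L (.H j) * U.of L (.E j') - U.of L (.E j') * U.of L (.H j)) := by
      simp only [gen, map_sub, map_mul, FreeAlgebra.lift_ι_apply, comulGen, mul_add, add_mul,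
        Algebra.TensorProduct.tmul_mul_tmul, mul_one, one_mul, H_mul_K, TensorProduct.sub_tmul,
        TensorProduct.tmul_sub]
      abel
    rw [key, h1]
    simp only [gen, map_smul, FreeAlgebra.lift_ι_apply, comulGen, smul_add,
      TensorProduct.tmul_smul, TensorProduct.smul_tmul']
  | H_F j j' =>
    have h1 := H_F_comm (L := L) j j'
    have key : FreeAlgebra.lift ℂ (comulGen L)
          (gen (.H j) * gen (.F j') - gen (.F j') * gen (.H j))
        = (U.of L (.H j) * U.of L (.F j') - U.of L (.F j') * U.of L (.H j)) ⊗ₜ[ℂ] 1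
          + U.of L (.K (-L.root j'))
            ⊗ₜ[ℂ] (U.of L (.H j) * U.of L (.F j') - U.of L (.F j') * U.of L (.H j)) := by
      simp only [gen, map_sub, map_mul, FreeAlgebra.lift_ι_apply, comulGen, mul_add, add_mul,
        Algebra.TensorProduct.tmul_mul_tmul, mul_one, one_mul, H_mul_K, TensorProduct.sub_tmul,
        TensorProduct.tmul_sub]
      abel
    rw [key, h1]
    simp only [gen, map_smul, FreeAlgebra.lift_ι_apply, comulGen, smul_add,
      TensorProduct.tmul_smul, TensorProduct.smul_tmul']
  | H_H j j' =>
    simp only [gen, map_mul, FreeAlgebra.lift_ι_apply, comulGen, mul_add, add_mul,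
      Algebra.TensorProduct.tmul_mul_tmul, mul_one, one_mul, H_mul_H j j']
    abel
  | H_K j γ =>
    simp only [gen, map_mul, FreeAlgebra.lift_ι_apply, comulGen, mul_add, add_mul,
      Algebra.TensorProduct.tmul_mul_tmul, mul_one, one_mul, H_mul_K]

/-- The coproduct. -/
def comul (L : MidLattice) : U L →ₐ[ℂ] U L ⊗[ℂ] U L :=
  RingQuot.liftAlgHom ℂ ⟨FreeAlgebra.lift ℂ (comulGen L), fun _ _ h => comul_rel L h⟩

theorem comul_of (L : MidLattice) (g : Gen L) : comul L (U.of L g) = comulGen L g := by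
  simp [comul, U.of]

/-! ### Modules -/

section Modules

variable (L : MidLattice)

/-- The weight space `V(lam)`. -/
def weightSpace (V : Type*) [AddCommGroup V] [Module ℂ V] [Module (U L) V]
    [IsScalarTower ℂ (U L) V] (lam : Weight) : Submodule ℂ V where
  carrier := {v | ∀ j : Fin 2, U.of L (.H j) • v = lam j • v}
  zero_mem' := by simp
  add_mem' := by
    intro v w hv hw j
    rw [smul_add, smul_add, hv j, hw j]
  smul_mem' := by
    intro c v hv j
    have h1 : U.of L (.H j) • c • v = c • U.of L (.H j) • v := by
      rw [← algebraMap_smul (U L) c v, ← algebraMap_smul (U L) c (U.of L (.H j) • v),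
        ← mul_smul, ← mul_smul, Algebra.commutes]
    rw [h1, hv j, smul_comm]

/-- An object of the category of finite-dimensional weight modules: a finite-dimensional module
which is the direct sum of its weight spaces, and on whose weight space `V(lam)` every `K γ` acts as
multiplication by `𝐢 ^ ⟨γ, lam⟩`. Its morphisms are the `U L`-linear maps. -/
structure FDWeightModule where
  carrier : Type
  [addCommGroup : AddCommGroup carrier]
  [moduleComplex : Module ℂ carrier]
  [moduleU : Module (U L) carrier]
  [isScalarTower : IsScalarTower ℂ (U L) carrier]
  finiteDimensional : FiniteDimensional ℂ carrier
  isInternal : DirectSum.IsInternal (weightSpace L carrier)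
  K_smul : ∀ (γ : L.lat) (lam : Weight), ∀ v ∈ weightSpace L carrier lam,
    U.of L (.K γ) • v = iPow (form γ lam) • v

attribute [instance] FDWeightModule.addCommGroup FDWeightModule.moduleComplex
  FDWeightModule.moduleU FDWeightModule.isScalarTower

/-- `P` is projective in the category of finite-dimensional weight modules. -/
def FDWeightModule.IsProjective {L : MidLattice} (P : FDWeightModule L) : Prop :=
  ∀ (M N : FDWeightModule L) (p : M.carrier →ₗ[U L] N.carrier) (f : P.carrier →ₗ[U L] N.carrier),
    Function.Surjective p → ∃ g : P.carrier →ₗ[U L] M.carrier, p ∘ₗ g = f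

/-- `P` is a projective cover of `V` in the category of finite-dimensional weight modules: it is
projective, and it has a surjection onto `V` to which no proper submodule of `P` restricts
surjectively. -/
def FDWeightModule.IsProjectiveCover {L : MidLattice} (P : FDWeightModule L)
    (V : Type) [AddCommGroup V] [Module (U L) V] : Prop :=
  P.IsProjective ∧ ∃ p : P.carrier →ₗ[U L] V, Function.Surjective p ∧
    ∀ N : Submodule (U L) P.carrier, N.map p = ⊤ → N = ⊤

/-- The left ideal that annihilates the universal maximal vector of weight `lam`. -/
def vermaIdeal (lam : Weight) : Submodule (U L) (U L) :=
  Submodule.span (U L)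
    (Set.range (fun j : Fin 2 => U.of L (.E j)) ∪
      Set.range (fun j : Fin 2 => U.of L (.H j) - algebraMap ℂ (U L) (lam j)) ∪
      Set.range (fun γ : L.lat => U.of L (.K γ) - algebraMap ℂ (U L) (iPow (form γ lam))))

/-- The Verma module: the universal module generated by a maximal vector of weight `lam`. -/
abbrev Verma (lam : Weight) : Type := U L ⧸ vermaIdeal L lam

/-- The sum of the proper submodules of the Verma module. -/
def vermaMax (lam : Weight) : Submodule (U L) (Verma L lam) :=
  sSup {N | N ≠ ⊤}

/-- The irreducible quotient of the Verma module of highest weight `lam`. -/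
abbrev Irr (lam : Weight) : Type := Verma L lam ⧸ vermaMax L lam

/-- The action of the quantum group on the tensor product of two modules, through the coproduct. -/
def tensorAct (V W : Type*) [AddCommGroup V] [Module ℂ V] [Module (U L) V]
    [IsScalarTower ℂ (U L) V] [AddCommGroup W] [Module ℂ W] [Module (U L) W]
    [IsScalarTower ℂ (U L) W] : U L →ₐ[ℂ] Module.End ℂ (V ⊗[ℂ] W) :=
  Module.endTensorEndAlgHom.comp
    ((Algebra.TensorProduct.map (Algebra.lsmul ℂ ℂ V) (Algebra.lsmul ℂ ℂ W)).comp (comul L))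

/-- The tensor product `V ⊗ W` over `ℂ`, as a module over the quantum group through `tensorAct`. -/
def Tensor (_ : MidLattice) (V W : Type*) [AddCommGroup V] [Module ℂ V] [AddCommGroup W]
    [Module ℂ W] : Type _ :=
  V ⊗[ℂ] W

section

variable (V W : Type*) [AddCommGroup V] [Module ℂ V] [Module (U L) V]
    [IsScalarTower ℂ (U L) V] [AddCommGroup W] [Module ℂ W] [Module (U L) W]
    [IsScalarTower ℂ (U L) W]

instance : AddCommGroup (Tensor L V W) := inferInstanceAs (AddCommGroup (V ⊗[ℂ] W))

instance : Module ℂ (Tensor L V W) := inferInstanceAs (Module ℂ (V ⊗[ℂ] W))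

instance : Module (U L) (Tensor L V W) :=
  letI : Module (Module.End ℂ (V ⊗[ℂ] W)) (Tensor L V W) :=
    inferInstanceAs (Module (Module.End ℂ (V ⊗[ℂ] W)) (V ⊗[ℂ] W))
  Module.compHom (Tensor L V W) (tensorAct L V W).toRingHom

theorem tensor_smul_def (u : U L) (x : Tensor L V W) :
    u • x = (tensorAct L V W u : V ⊗[ℂ] W →ₗ[ℂ] V ⊗[ℂ] W) x := rfl

instance : IsScalarTower ℂ (U L) (Tensor L V W) where
  smul_assoc c u x := by
    rw [tensor_smul_def, tensor_smul_def, map_smul]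
    rfl

end

/-- `V` is isomorphic to `P_{ν₁} ⊕ ⋯ ⊕ P_{νₙ}` with `dim P_{νₖ} = dₖ`, where `P_ν` is the projective
cover of the irreducible module of highest weight `ν` and `l = [(d₁, ν₁), …, (dₙ, νₙ)]`. -/
def IsSumOfProjectives (V : Type) [AddCommGroup V] [Module (U L) V] (l : List (ℕ × Weight)) :
    Prop :=
  ∃ P : Fin l.length → FDWeightModule L,
    (∀ k, (P k).IsProjectiveCover (Irr L (l.get k).2) ∧
      Module.finrank ℂ (P k).carrier = (l.get k).1) ∧
    Nonempty (V ≃ₗ[U L] ((k : Fin l.length) → (P k).carrier))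

end Modules

end UnrolledSl3

end

open UnrolledSl3

noncomputable section

set_option linter.unusedSectionVars false

namespace UnrolledSl3

/-! Everything rests on one element, `eTop * fTop`, the product of the longest words in the raising
and in the lowering operators. The algebra generated by the `F j` is spanned by eight words, and
every nonzero combination of them acting on a vector can be lowered further to a nonzero multiple of
`fTop` on that vector. Raising operators kill `eTop` from the left, so `eTop * fTop` turns any
vector of weight `y` into a maximal vector of weight `y`. On a vector that is already maximal it is
the scalar `typ i j y = -(qn (y i) * qn (y j) * qn (y i + y j + 1))`, where `qn z` is the sine of
`πz/2`. This scalar has one factor per positive root, and it is nonzero exactly when `y` is typical.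

For typical `y` three things follow. A maximal vector of weight `y` generates a simple module of
dimension eight (`IsMax.mem_span_of_mem`). Maximal vectors of weight `y` lift along surjections
(`IsMax.exists_lift`), so `Irr L y` is projective; with the adjunction between tensor product and
linear maps, `V ⊗ Irr L y` is projective too (`exists_tensor_lift`). The same argument in the
contragredient dual shows that the submodule generated by such a vector is a direct summand
(`IsMax.exists_isCompl`).

The module of highest weight `lam` has the basis `v`, `F j v`, `F i F j v`, `F j F i F j v`, linked
upwards by `E j`, `E i`, `E j`. Tensoring these vectors with the highest weight vector of the
typical factor gives a chain of four generators of the tensor product. Its dimension is 4 · 8 = 32,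
so the eight words on the four generators form a basis, and the module is filtered by four highest
weight modules of dimension eight whose highest weights are `chainWt j ν`.

Each typical weight of the chain yields an irreducible projective summand, which can be split off
(`ChainData.split`). All but one of the remaining generators lie in every maximal submodule: in a
simple quotient the first surviving generator is maximal, and if its weight is atypical in a
suitable direction, the raising operator that ought to reach it from the next generator must vanish
(`Superfluous.mem`). Hence the remainder is projective with simple head, that is, a projective cover
(`ChainData.exists_map`). The eight cases record which weights are typical and which generator
survives, expressed through the zeros of `qn`. -/

/-! ### The quantum integers -/

/-- `(𝐢 ^ z - 𝐢 ^ (-z)) / 2𝐢`. -/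
def qn (z : ℂ) : ℂ := (2 * Complex.I)⁻¹ * (iPow z - iPow (-z))

/-- With `qn z` a sine, `qn (z + 1)` is the corresponding cosine. All later scalar identities are
trigonometry in these two quantities. -/
theorem qn_eq_sin (z : ℂ) : qn z = Complex.sin (Real.pi / 2 * z) := by
  have h1 : iPow z = Complex.exp (Real.pi / 2 * z * Complex.I) := by
    rw [iPow]; congr 1; ring
  have h2 : iPow (-z) = Complex.exp (-(Real.pi / 2 * z) * Complex.I) := by
    rw [iPow]; congr 1; ring
  have hI : Complex.I⁻¹ = -Complex.I := Complex.inv_I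
  rw [qn, h1, h2, Complex.sin, mul_inv, hI]
  ring

theorem qn_add (z w : ℂ) : qn (z + w) = qn z * qn (w + 1) + qn (z + 1) * qn w := by
  have h (x : ℂ) : qn (x + 1) = Complex.cos (Real.pi / 2 * x) := by
    rw [qn_eq_sin, mul_add, mul_one, Complex.sin_add_pi_div_two]
  rw [h, h, qn_eq_sin, qn_eq_sin, qn_eq_sin, mul_add, Complex.sin_add]

theorem qn_one : qn 1 = 1 := by simp [qn_eq_sin]

theorem qn_two : qn 2 = 0 := by simp [qn_eq_sin]

theorem qn_add_two (z : ℂ) : qn (z + 2) = -qn z := by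
  have := qn_add z 2
  rw [this, qn_two, show (2 : ℂ) + 1 = 1 + 2 by ring, qn_add 1 2, qn_two]
  have h : qn (2 + 1) = -1 := by
    rw [qn_eq_sin, show (Real.pi / 2 * (2 + 1) : ℂ) = Real.pi / 2 + Real.pi by ring,
      Complex.sin_add_pi, Complex.sin_pi_div_two]
  rw [h, qn_one]
  ring

theorem qn_sub_one (z : ℂ) : qn (z - 1) = -qn (z + 1) := by
  rw [show z + 1 = z - 1 + 2 by ring, qn_add_two, neg_neg]

theorem qn_sub_two (z : ℂ) : qn (z - 2) = -qn z := by
  rw [← neg_neg (qn (z - 2)), ← qn_add_two, sub_add_cancel]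

theorem qn_sq_add (z : ℂ) : qn z ^ 2 + qn (z + 1) ^ 2 = 1 := by
  rw [qn_eq_sin, qn_eq_sin, mul_add, mul_one, Complex.sin_add_pi_div_two, Complex.sin_sq_add_cos_sq]

theorem qn_eq_zero_iff (z : ℂ) : qn z = 0 ↔ IsEvenInt z := by
  have hp : (Real.pi : ℂ) ≠ 0 := by exact_mod_cast Real.pi_ne_zero
  rw [qn_eq_sin, Complex.sin_eq_zero_iff]
  refine exists_congr fun k => ⟨fun h => ?_, fun h => ?_⟩
  · field_simp at h
    linear_combination h
  · rw [h]
    ring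

theorem qn_succ_eq_zero_iff (z : ℂ) : qn (z + 1) = 0 ↔ IsOddInt z := by
  rw [qn_eq_zero_iff]
  constructor
  · rintro ⟨n, hn⟩
    exact ⟨n - 1, by push_cast; linear_combination hn⟩
  · rintro ⟨n, hn⟩
    exact ⟨n + 1, by push_cast; linear_combination hn⟩

theorem form_add_left (x y z : Weight) : form (x + y) z = form x z + form y z := by
  simp only [form, Pi.add_apply]; ring

theorem form_add_right (x y z : Weight) : form x (y + z) = form x y + form x z := by
  simp only [form, Pi.add_apply]; ring

theorem form_sub_right (x y z : Weight) : form x (y - z) = form x y - form x z := by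
  simp only [form, Pi.sub_apply]; ring

theorem iPow_neg_mul (z : ℂ) : iPow (-z) * iPow z = 1 := by
  rw [← iPow_add, neg_add_cancel, iPow_zero]

theorem α_self (j : Fin 2) : α j j = 2 := by
  fin_cases j <;> simp [α, cartan]

theorem α_ne {i j : Fin 2} (h : i ≠ j) : α j i = -1 := by
  fin_cases i <;> fin_cases j <;> simp_all [α, cartan]

theorem eq_or_eq_of_ne {i j : Fin 2} (h : i ≠ j) (k : Fin 2) : k = i ∨ k = j := by
  omega

theorem α_add {i j : Fin 2} (h : i ≠ j) : α i + α j = α₃ := by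
  fin_cases i <;> fin_cases j <;> simp_all [α₃, add_comm]

theorem idx_α (y : Weight) (j : Fin 2) : idx y (α j) = y j + 1 := by
  rw [idx, form_α, Pi.add_apply]
  congr 1
  fin_cases j <;> simp [ρ, α₃, α, cartan] <;> norm_num

theorem idx_α₃ (y : Weight) : idx y α₃ = idx y (α 0) + idx y (α 1) := by
  rw [idx, α₃, form_add_right, idx, idx]

/-! ### The action of the generators -/

variable {L : MidLattice} {X : Type*} [AddCommGroup X] [Module ℂ X] [Module (U L) X]
  [IsScalarTower ℂ (U L) X]

theorem U.induction {p : U L → Prop} (hg : ∀ g, p (U.of L g)) (hc : ∀ c : ℂ, p (algebraMap ℂ _ c))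
    (ha : ∀ u v, p u → p v → p (u + v)) (hm : ∀ u v, p u → p v → p (u * v)) (u : U L) : p u := by
  obtain ⟨a, rfl⟩ := RingQuot.mkAlgHom_surjective ℂ (Rel L) u
  induction a using FreeAlgebra.induction with
  | grade0 r => simpa using hc r
  | grade1 x => exact hg x
  | mul a b h1 h2 => simpa using hm _ _ h1 h2
  | add a b h1 h2 => simpa using ha _ _ h1 h2

theorem U.smul_mem_of_gen (S : Submodule ℂ X) (hS : ∀ g, ∀ x ∈ S, U.of L g • x ∈ S) (u : U L) :
    ∀ x ∈ S, u • x ∈ S := by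
  induction u using U.induction with
  | hg g => exact hS g
  | hc c => intro x hx; rw [algebraMap_smul]; exact S.smul_mem c hx
  | ha u v hu hv => intro x hx; rw [add_smul]; exact S.add_mem (hu x hx) (hv x hx)
  | hm u v hu hv => intro x hx; rw [mul_smul]; exact hu _ (hv x hx)

/-- A complex subspace that is stable under the generators, as a submodule. -/
def U.submodule (S : Submodule ℂ X) (hS : ∀ g, ∀ x ∈ S, U.of L g • x ∈ S) :
    Submodule (U L) X where
  carrier := S
  zero_mem' := S.zero_mem
  add_mem' := S.add_mem
  smul_mem' u x hx := U.smul_mem_of_gen S hS u x hx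

theorem U.commutes (u : U L) (c : ℂ) (x : X) : u • c • x = c • u • x :=
  smul_comm u c x

/-- A complex-linear map that commutes with the generators is linear over the quantum group. -/
def U.linearMap {Y : Type*} [AddCommGroup Y] [Module ℂ Y] [Module (U L) Y]
    [IsScalarTower ℂ (U L) Y] (f : X →ₗ[ℂ] Y)
    (hf : ∀ g x, f (U.of L g • x) = U.of L g • f x) : X →ₗ[U L] Y where
  toFun := f
  map_add' := f.map_add
  map_smul' u := by
    induction u using U.induction with
    | hg g => exact hf g
    | hc c => intro x; simp
    | ha u v hu hv => intro x; simp only [add_smul, map_add, hu, hv, RingHom.id_apply]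
    | hm u v hu hv => intro x; simp only [mul_smul, hu, hv, RingHom.id_apply]

variable (L) in
/-- The vectors of weight `η` on which the `K γ` act accordingly. -/
def goodSpace (X : Type*) [AddCommGroup X] [Module ℂ X] [Module (U L) X]
    [IsScalarTower ℂ (U L) X] (η : Weight) : Submodule ℂ X where
  carrier := {x | (∀ j, U.of L (.H j) • x = η j • x) ∧
    ∀ γ : L.lat, U.of L (.K γ) • x = iPow (form γ η) • x}
  zero_mem' := by simp
  add_mem' := by
    rintro x y ⟨hx, hx'⟩ ⟨hy, hy'⟩
    exact ⟨fun j => by rw [smul_add, smul_add, hx, hy],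
      fun γ => by rw [smul_add, smul_add, hx', hy']⟩
  smul_mem' := by
    rintro c x ⟨hx, hx'⟩
    exact ⟨fun j => by rw [U.commutes, hx, smul_comm], fun γ => by rw [U.commutes, hx', smul_comm]⟩

theorem goodSpace_le (η : Weight) : goodSpace L X η ≤ weightSpace L X η := fun _ hx => hx.1

theorem H_smul {η : Weight} {x : X} (hx : x ∈ goodSpace L X η) (j : Fin 2) :
    U.of L (.H j) • x = η j • x := hx.1 j

theorem K_smul {η : Weight} {x : X} (hx : x ∈ goodSpace L X η) (γ : L.lat) :
    U.of L (.K γ) • x = iPow (form γ η) • x := hx.2 γ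

theorem map_mem_goodSpace {Y : Type*} [AddCommGroup Y] [Module ℂ Y] [Module (U L) Y]
    [IsScalarTower ℂ (U L) Y] (f : X →ₗ[U L] Y) {η : Weight} {x : X}
    (hx : x ∈ goodSpace L X η) : f x ∈ goodSpace L Y η := by
  have hc (c : ℂ) (x : X) : f (c • x) = c • f x := by
    rw [← algebraMap_smul (U L) c x, map_smul, algebraMap_smul]
  exact ⟨fun j => by rw [← map_smul, H_smul hx, hc], fun γ => by rw [← map_smul, K_smul hx, hc]⟩

theorem E_smul_mem {η : Weight} {x : X} (hx : x ∈ goodSpace L X η) (j : Fin 2) :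
    U.of L (.E j) • x ∈ goodSpace L X (η + α j) := by
  refine ⟨fun k => ?_, fun γ => ?_⟩
  · have h := congrArg (· • x) (H_E_comm (L := L) k j)
    simp only [sub_smul, mul_smul, smul_assoc, H_smul hx, U.commutes] at h
    rw [sub_eq_iff_eq_add] at h
    rw [h, ← add_smul, add_comm]
    rfl
  · have h := congrArg (· • x) (K_mul_E γ j)
    simp only [mul_smul, smul_assoc, K_smul hx, U.commutes] at h
    rw [h, smul_smul, form_add_right, add_comm, iPow_add]

theorem F_smul_mem {η : Weight} {x : X} (hx : x ∈ goodSpace L X η) (j : Fin 2) :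
    U.of L (.F j) • x ∈ goodSpace L X (η - α j) := by
  refine ⟨fun k => ?_, fun γ => ?_⟩
  · have h := congrArg (· • x) (H_F_comm (L := L) k j)
    simp only [sub_smul, mul_smul, smul_assoc, H_smul hx, U.commutes, neg_smul] at h
    rw [sub_eq_iff_eq_add] at h
    rw [h, ← neg_smul, ← add_smul, neg_add_eq_sub]
    rfl
  · have h := congrArg (· • x) (K_mul_F γ j)
    simp only [mul_smul, smul_assoc, K_smul hx, U.commutes] at h
    rw [h, smul_smul, form_sub_right, sub_eq_neg_add, iPow_add]

/-- On weight `η` the elements `K (±α j)` act as the powers of `𝐢` with exponents `±η j`, so the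
commutator of `E j` and `F j` becomes a scalar. -/
theorem E_F_smul_self {η : Weight} {x : X} (hx : x ∈ goodSpace L X η) (j : Fin 2) :
    U.of L (.E j) • U.of L (.F j) • x = U.of L (.F j) • U.of L (.E j) • x + qn (η j) • x := by
  have h := congrArg (· • x) (E_F_comm (L := L) j j)
  simp only [if_true, sub_smul, mul_smul, smul_assoc, K_smul hx] at h
  rw [sub_eq_iff_eq_add] at h
  rw [h, add_comm, qn, ← sub_smul, mul_smul]
  simp only [MidLattice.root, NegMemClass.coe_neg, form_neg_left, form_comm (α j) η, form_α]

theorem E_F_smul_ne {i j : Fin 2} (hij : i ≠ j) (x : X) :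
    U.of L (.E i) • U.of L (.F j) • x = U.of L (.F j) • U.of L (.E i) • x := by
  have h := congrArg (· • x) (E_F_comm (L := L) i j)
  simp only [if_neg hij, sub_smul, mul_smul, zero_smul] at h
  rwa [sub_eq_zero] at h

theorem F_F_smul (j : Fin 2) (x : X) : U.of L (.F j) • U.of L (.F j) • x = 0 := by
  rw [← mul_smul, F_mul_F, zero_smul]

theorem E_E_smul (j : Fin 2) (x : X) : U.of L (.E j) • U.of L (.E j) • x = 0 := by
  rw [← mul_smul, E_mul_E, zero_smul]

theorem F_braid_smul {i j : Fin 2} (hij : i ≠ j) (x : X) :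
    U.of L (.F j) • U.of L (.F i) • U.of L (.F j) • U.of L (.F i) • x =
      U.of L (.F i) • U.of L (.F j) • U.of L (.F i) • U.of L (.F j) • x := by
  have h := congrArg (· • x) (F_braid (L := L))
  simp only [pow_two, mul_smul] at h
  fin_cases i <;> fin_cases j <;> simp_all

theorem E_braid_smul {i j : Fin 2} (hij : i ≠ j) (x : X) :
    U.of L (.E j) • U.of L (.E i) • U.of L (.E j) • U.of L (.E i) • x =
      U.of L (.E i) • U.of L (.E j) • U.of L (.E i) • U.of L (.E j) • x := by
  have h := congrArg (· • x) (E_braid (L := L))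
  simp only [pow_two, mul_smul] at h
  fin_cases i <;> fin_cases j <;> simp_all

/-- The `H j` commute, and weight spaces lie in their joint generalised eigenspaces, which are
independent. -/
theorem iSupIndep_weightSpace : iSupIndep (weightSpace L X) := by
  let f : Fin 2 → Module.End ℂ X := fun j => Algebra.lsmul ℂ ℂ X (U.of L (.H j))
  have hf (η : Weight) : weightSpace L X η ≤ ⨅ j, (f j).maxGenEigenspace (η j) := by
    intro x hx
    rw [Submodule.mem_iInf]
    intro j
    refine Module.End.mem_maxGenEigenspace _ _ _ |>.2 ⟨1, ?_⟩
    have := hx j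
    simp [f, this]
  refine iSupIndep.mono (Module.End.independent_iInf_maxGenEigenspace_of_forall_mapsTo f ?_) hf
  intro j k φ
  refine Module.End.mapsTo_maxGenEigenspace_of_comm ?_ φ
  change f k * f j = f j * f k
  rw [← map_mul, ← map_mul, H_mul_H]

theorem eq_of_mem_goodSpace {η θ : Weight} {x : X} (hx : x ∈ goodSpace L X η)
    (hx' : x ∈ goodSpace L X θ) (h0 : x ≠ 0) : η = θ := by
  ext j
  have h : η j • x = θ j • x := (H_smul hx j).symm.trans (H_smul hx' j)
  exact smul_left_injective ℂ h0 h

theorem iSupIndep_goodSpace : iSupIndep (goodSpace L X) :=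
  iSupIndep_weightSpace.mono goodSpace_le

/-- The part of weight `η` of a sum of weight vectors. -/
theorem eq_sum_filter {ι : Type*} [Fintype ι] {η : Weight} {a : X} (ha : a ∈ goodSpace L X η)
    (θ : ι → Weight) (x : ι → X) (hx : ∀ w, x w ∈ goodSpace L X (θ w)) (hsum : a = ∑ w, x w)
    [DecidablePred fun w => θ w = η] :
    a = ∑ w with θ w = η, x w := by
  have h1 : a - ∑ w with θ w = η, x w = ∑ w with θ w ≠ η, x w := by
    rw [hsum, sub_eq_iff_eq_add, add_comm]
    exact (Finset.sum_filter_add_sum_filter_not _ _ _).symm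
  have h2 : a - ∑ w with θ w = η, x w ∈ goodSpace L X η := by
    refine Submodule.sub_mem _ ha (Submodule.sum_mem _ fun w hw => ?_)
    rw [← (Finset.mem_filter.1 hw).2]
    exact hx w
  have h3 : a - ∑ w with θ w = η, x w ∈ ⨆ (φ) (_ : φ ≠ η), goodSpace L X φ := by
    rw [h1]
    refine Submodule.sum_mem _ fun w hw => ?_
    exact Submodule.mem_iSup_of_mem (θ w)
      (Submodule.mem_iSup_of_mem (Finset.mem_filter.1 hw).2 (hx w))
  exact sub_eq_zero.1 (Submodule.disjoint_def.1 (iSupIndep_goodSpace (L := L) (X := X) η) _ h2 h3)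

variable {L : MidLattice} {X : Type*} [AddCommGroup X] [Module ℂ X] [Module (U L) X]
  [IsScalarTower ℂ (U L) X]

/-! ### Words in the lowering operators -/

variable (L) in
/-- A basis of the algebra generated by the `F j`, in the order of increasing length. -/
def word (i j : Fin 2) : Fin 8 → U L :=
  ![1, U.of L (.F i), U.of L (.F j), U.of L (.F i) * U.of L (.F j), U.of L (.F j) * U.of L (.F i),
    U.of L (.F i) * (U.of L (.F j) * U.of L (.F i)),
    U.of L (.F j) * (U.of L (.F i) * U.of L (.F j)),
    U.of L (.F i) * (U.of L (.F j) * (U.of L (.F i) * U.of L (.F j)))]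

variable (L) in
/-- The longest word in the lowering operators. -/
def fTop (i j : Fin 2) : U L :=
  U.of L (.F i) * (U.of L (.F j) * (U.of L (.F i) * U.of L (.F j)))

variable (L) in
/-- The longest word in the raising operators. -/
def eTop (i j : Fin 2) : U L :=
  U.of L (.E j) * (U.of L (.E i) * (U.of L (.E j) * U.of L (.E i)))

/-- The roots by which the words lower the weights. -/
def wordWt (i j : Fin 2) : Fin 8 → Weight :=
  ![0, α i, α j, α i + α j, α i + α j, α i + α i + α j, α i + α j + α j,
    α i + α i + α j + α j]

theorem mem_goodSpace_of_eq {η θ : Weight} {x : X} (hx : x ∈ goodSpace L X η) (h : η = θ) :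
    x ∈ goodSpace L X θ := h ▸ hx

theorem word_smul_mem {η : Weight} {x : X} (hx : x ∈ goodSpace L X η) (i j : Fin 2) (w : Fin 8) :
    word L i j w • x ∈ goodSpace L X (η - wordWt i j w) := by
  have h1 (k) := F_smul_mem hx k
  have h2 (k l) := F_smul_mem (h1 k) l
  have h3 (k l m) := F_smul_mem (h2 k l) m
  have h4 (k l m n) := F_smul_mem (h3 k l m) n
  fin_cases w <;> simp only [word, wordWt, Fin.reduceFinMk, Matrix.cons_val, mul_smul, one_smul,
    Fin.zero_eta, Fin.isValue, sub_zero, Fin.mk_one]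
  · exact hx
  · exact h1 _
  · exact h1 _
  · exact mem_goodSpace_of_eq (h2 j i) (by abel)
  · exact mem_goodSpace_of_eq (h2 i j) (by abel)
  · exact mem_goodSpace_of_eq (h3 i j i) (by abel)
  · exact mem_goodSpace_of_eq (h3 j i j) (by abel)
  · exact mem_goodSpace_of_eq (h4 j i j i) (by abel)

/-- A repeated letter gives zero, and the braid relation identifies the two alternating words of
length four. So the eight words together with zero are closed under left multiplication by letters.
-/
theorem F_word_smul {i j : Fin 2} (hij : i ≠ j) (k : Fin 2) (w : Fin 8) :
    (∃ w', ∀ x : X, U.of L (.F k) • word L i j w • x = word L i j w' • x) ∨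
      ∀ x : X, U.of L (.F k) • word L i j w • x = 0 := by
  have hb := fun x : X => F_braid_smul (L := L) hij x
  rcases eq_or_eq_of_ne hij k with rfl | rfl
  · fin_cases w <;> simp only [word, Fin.reduceFinMk, Matrix.cons_val, mul_smul, one_smul,
      Fin.zero_eta, Fin.isValue, Fin.mk_one]
    · exact .inl ⟨1, fun x => by simp⟩
    · exact .inr fun x => by simp [F_F_smul]
    · exact .inl ⟨3, fun x => by simp [mul_smul]⟩
    · exact .inr fun x => by simp [F_F_smul]
    · exact .inl ⟨5, fun x => by simp [mul_smul]⟩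
    · exact .inr fun x => by simp [F_F_smul]
    · exact .inl ⟨7, fun x => by simp [mul_smul]⟩
    · exact .inr fun x => by simp [F_F_smul]
  · fin_cases w <;> simp only [word, Fin.reduceFinMk, Matrix.cons_val, mul_smul, one_smul,
      Fin.zero_eta, Fin.isValue, Fin.mk_one]
    · exact .inl ⟨2, fun x => by simp⟩
    · exact .inl ⟨4, fun x => by simp [mul_smul]⟩
    · exact .inr fun x => by simp [F_F_smul]
    · exact .inl ⟨6, fun x => by simp [mul_smul]⟩
    · exact .inr fun x => by simp [F_F_smul]
    · exact .inl ⟨7, fun x => by simp [mul_smul, hb]⟩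
    · exact .inr fun x => by simp [F_F_smul]
    · exact .inr fun x => by rw [← hb, F_F_smul]

/-- The complementary word of each word. -/
def coword : Fin 8 → Fin 8 := ![7, 6, 5, 3, 4, 2, 1, 0]

theorem coword_smul_word {i j : Fin 2} (hij : i ≠ j) (w : Fin 8) (x : X) :
    word L i j (coword w) • word L i j w • x = fTop L i j • x := by
  have hb := fun x : X => F_braid_smul (L := L) hij x
  fin_cases w <;> simp [word, coword, fTop, mul_smul, hb]

/-- A later word of the same length produces a repeated letter, and a longer one exceeds the maximal
length four. Pairing words with their complements is thus triangular. -/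
theorem coword_smul_word_of_lt {i j : Fin 2} (hij : i ≠ j) {w w' : Fin 8} (hw : w < w') (x : X) :
    word L i j (coword w) • word L i j w' • x = 0 := by
  have h1 (x : X) : U.of L (.F i) • U.of L (.F j) • U.of L (.F i) • U.of L (.F j) •
      U.of L (.F i) • x = 0 := by
    rw [← F_braid_smul hij, F_F_smul, smul_zero, smul_zero, smul_zero]
  have h2 (x : X) : U.of L (.F j) • U.of L (.F i) • U.of L (.F j) • U.of L (.F i) •
      U.of L (.F j) • x = 0 := by
    rw [F_braid_smul hij, F_F_smul, smul_zero, smul_zero, smul_zero]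
  fin_cases w <;> fin_cases w' <;> first
    | exact absurd hw (by decide)
    | simp [word, coword, mul_smul, F_F_smul, h1, h2]

theorem fTop_smul_word {i j : Fin 2} (hij : i ≠ j) {w : Fin 8} (hw : w ≠ 0) (x : X) :
    fTop L i j • word L i j w • x = 0 := by
  have := coword_smul_word_of_lt (L := L) hij (Fin.pos_iff_ne_zero.2 hw) x
  simpa [word, coword, fTop] using this

/-- By the braid relation the longest word can be made to begin with either letter, and squares of
letters vanish. -/
theorem E_smul_eTop {i j : Fin 2} (hij : i ≠ j) (k : Fin 2) (x : X) :
    U.of L (.E k) • eTop L i j • x = 0 := by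
  rcases eq_or_eq_of_ne hij k with rfl | rfl
  · simp only [eTop, mul_smul]
    rw [E_braid_smul hij, E_E_smul]
  · simp only [eTop, mul_smul, E_E_smul]

theorem eTop_fTop_smul_mem {η : Weight} {x : X} (hx : x ∈ goodSpace L X η) (i j : Fin 2) :
    eTop L i j • fTop L i j • x ∈ goodSpace L X η := by
  simp only [eTop, fTop, mul_smul]
  exact mem_goodSpace_of_eq (E_smul_mem (E_smul_mem (E_smul_mem (E_smul_mem
    (F_smul_mem (F_smul_mem (F_smul_mem (F_smul_mem hx j) i) j) i) i) j) i) j) (by abel)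

/-! ### The span of the words on a family of vectors -/

variable {ι : Type*}

variable (L) in
/-- The complex span of the words in the lowering operators applied to a family of vectors. -/
def wordSpan (i j : Fin 2) (n : ι → X) : Submodule ℂ X :=
  Submodule.span ℂ (Set.range fun p : Fin 8 × ι => word L i j p.1 • n p.2)

theorem word_smul_mem_wordSpan (i j : Fin 2) (n : ι → X) (w : Fin 8) (k : ι) :
    word L i j w • n k ∈ wordSpan L i j n :=
  Submodule.subset_span ⟨(w, k), rfl⟩

theorem mem_wordSpan (i j : Fin 2) (n : ι → X) (k : ι) : n k ∈ wordSpan L i j n := by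
  simpa [word] using word_smul_mem_wordSpan i j n 0 k

theorem smul_mem_span_of_gen {S : Submodule ℂ X} {s : Set X} (u : U L)
    (h : ∀ x ∈ s, u • x ∈ S) : ∀ x ∈ Submodule.span ℂ s, u • x ∈ S := by
  intro x hx
  induction hx using Submodule.span_induction with
  | mem x hx => exact h x hx
  | zero => simp
  | add x y _ _ h1 h2 => rw [smul_add]; exact S.add_mem h1 h2
  | smul c x _ h1 => rw [U.commutes]; exact S.smul_mem c h1

/-- A triangular decomposition: raising operators are moved past the lowering ones until they meet
the generators, where the hypothesis keeps them in the span. -/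
theorem wordSpan_stable {i j : Fin 2} (hij : i ≠ j) {n : ι → X} {y : ι → Weight}
    (hn : ∀ k, n k ∈ goodSpace L X (y k))
    (hE : ∀ l k, U.of L (.E l) • n k ∈ Submodule.span ℂ (Set.range n)) :
    ∀ g, ∀ x ∈ wordSpan L i j n, U.of L g • x ∈ wordSpan L i j n := by
  set S := wordSpan L i j n with hS
  have hF (k : Fin 2) : ∀ x ∈ S, U.of L (.F k) • x ∈ S := by
    refine smul_mem_span_of_gen _ ?_
    rintro _ ⟨⟨w, k'⟩, rfl⟩
    rcases F_word_smul (X := X) (L := L) hij k w with ⟨w', h⟩ | h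
    · simpa only [h] using word_smul_mem_wordSpan i j n w' k'
    · simp only [h, S.zero_mem]
  -- Induction on the length of a word: the three properties pass from `x` to `F m x`, because the
  -- commutator with a raising operator is zero or a scalar on `x`.
  have hstep (x : X) (m : Fin 2)
      (hx : x ∈ S ∧ (∃ η, x ∈ goodSpace L X η) ∧ ∀ l, U.of L (.E l) • x ∈ S) :
      U.of L (.F m) • x ∈ S ∧ (∃ η, U.of L (.F m) • x ∈ goodSpace L X η) ∧
        ∀ l, U.of L (.E l) • U.of L (.F m) • x ∈ S := by
    obtain ⟨h1, ⟨η, h2⟩, h3⟩ := hx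
    refine ⟨hF m x h1, ⟨_, F_smul_mem h2 m⟩, fun l => ?_⟩
    by_cases hl : l = m
    · subst hl
      rw [E_F_smul_self h2]
      exact S.add_mem (hF _ _ (h3 l)) (S.smul_mem _ h1)
    · rw [E_F_smul_ne hl]
      exact hF _ _ (h3 l)
  have hn' (k : ι) : n k ∈ S := mem_wordSpan i j n k
  have hspan : Submodule.span ℂ (Set.range n) ≤ S := by
    rw [Submodule.span_le]
    rintro _ ⟨k, rfl⟩
    exact hn' k
  intro g
  cases g with
  | F k => exact hF k
  | H k =>
    refine smul_mem_span_of_gen _ ?_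
    rintro _ ⟨⟨w, k'⟩, rfl⟩
    simp only [H_smul (word_smul_mem (hn k') i j w)]
    exact S.smul_mem _ (word_smul_mem_wordSpan i j n w k')
  | K γ =>
    refine smul_mem_span_of_gen _ ?_
    rintro _ ⟨⟨w, k'⟩, rfl⟩
    simp only [K_smul (word_smul_mem (hn k') i j w)]
    exact S.smul_mem _ (word_smul_mem_wordSpan i j n w k')
  | E l =>
    refine smul_mem_span_of_gen _ ?_
    rintro _ ⟨⟨w, k⟩, rfl⟩
    have h0 : n k ∈ S ∧ (∃ η, n k ∈ goodSpace L X η) ∧ ∀ l, U.of L (.E l) • n k ∈ S :=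
      ⟨hn' k, ⟨_, hn k⟩, fun l => hspan (hE l k)⟩
    have h1 (a) := hstep _ a h0
    have h2 (a b) := hstep _ b (h1 a)
    have h3 (a b c) := hstep _ c (h2 a b)
    have h4 (a b c d) := hstep _ d (h3 a b c)
    fin_cases w <;> simp only [word, Fin.reduceFinMk, Matrix.cons_val, mul_smul, one_smul,
      Fin.zero_eta, Fin.isValue, Fin.mk_one]
    · exact h0.2.2 l
    · exact (h1 _).2.2 l
    · exact (h1 _).2.2 l
    · exact (h2 _ _).2.2 l
    · exact (h2 _ _).2.2 l
    · exact (h3 _ _ _).2.2 l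
    · exact (h3 _ _ _).2.2 l
    · exact (h4 _ _ _ _).2.2 l

theorem span_eq_wordSpan {i j : Fin 2} (hij : i ≠ j) {n : ι → X} {y : ι → Weight}
    (hn : ∀ k, n k ∈ goodSpace L X (y k))
    (hE : ∀ l k, U.of L (.E l) • n k ∈ Submodule.span ℂ (Set.range n)) (x : X) :
    x ∈ Submodule.span (U L) (Set.range n) ↔ x ∈ wordSpan L i j n := by
  constructor
  · intro hx
    have : Submodule.span (U L) (Set.range n) ≤
        U.submodule (wordSpan L i j n) (wordSpan_stable hij hn hE) := by
      rw [Submodule.span_le]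
      rintro _ ⟨k, rfl⟩
      exact mem_wordSpan i j n k
    exact this hx
  · intro hx
    induction hx using Submodule.span_induction with
    | mem x hx =>
      obtain ⟨⟨w, k⟩, rfl⟩ := hx
      exact Submodule.smul_mem _ _ (Submodule.subset_span ⟨k, rfl⟩)
    | zero => exact Submodule.zero_mem _
    | add x y _ _ h1 h2 => exact Submodule.add_mem _ h1 h2
    | smul c x _ h1 => exact Submodule.smul_of_tower_mem _ c h1

/-! ### Maximal vectors -/

variable (L) in
/-- A maximal vector of weight `y`. -/
structure IsMax (y : Weight) (z : X) : Prop where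
  mem : z ∈ goodSpace L X y
  E_smul (k : Fin 2) : U.of L (.E k) • z = 0

theorem IsMax.map {Y : Type*} [AddCommGroup Y] [Module ℂ Y] [Module (U L) Y]
    [IsScalarTower ℂ (U L) Y] (f : X →ₗ[U L] Y) {y : Weight} {z : X} (hz : IsMax L y z) :
    IsMax L y (f z) :=
  ⟨map_mem_goodSpace f hz.mem, fun k => by rw [← map_smul, hz.E_smul, map_zero]⟩

/-- The source of maximal vectors: an arbitrary weight vector is made maximal without a change of
weight. The result may be zero. -/
theorem isMax_eTop_fTop {i j : Fin 2} (hij : i ≠ j) {y : Weight} {x : X}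
    (hx : x ∈ goodSpace L X y) : IsMax L y (eTop L i j • fTop L i j • x) :=
  ⟨eTop_fTop_smul_mem hx i j, fun k => E_smul_eTop hij k _⟩

theorem IsMax.mem_span_iff {i j : Fin 2} (hij : i ≠ j) {y : Weight} {z : X} (hz : IsMax L y z)
    (a : X) : a ∈ Submodule.span (U L) {z} ↔ ∃ c : Fin 8 → ℂ, a = ∑ w, c w • word L i j w • z := by
  have h := span_eq_wordSpan (L := L) hij (n := fun _ : Unit => z) (y := fun _ => y)
    (fun _ => hz.mem) (fun l _ => by rw [hz.E_smul]; exact Submodule.zero_mem _) a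
  rw [Set.range_const] at h
  rw [h, wordSpan]
  have hr : (Set.range fun p : Fin 8 × Unit => word L i j p.1 • z) =
      Set.range fun w : Fin 8 => word L i j w • z := by
    ext x
    simp
  rw [hr, Submodule.mem_span_range_iff_exists_fun]
  exact exists_congr fun c => eq_comm

/-- The scalar by which `eTop * fTop` acts on a maximal vector of weight `y`. -/
def typ (i j : Fin 2) (y : Weight) : ℂ :=
  qn (y i) * qn (y j) * (qn (y i) * qn (y j) - qn (y i + 1) * qn (y j + 1))

theorem IsMax.E_F {y : Weight} {z : X} (hz : IsMax L y z) (k : Fin 2) :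
    U.of L (.E k) • U.of L (.F k) • z = qn (y k) • z := by
  rw [E_F_smul_self hz.mem, hz.E_smul, smul_zero, zero_add]

theorem IsMax.E_F_ne {i j : Fin 2} (hij : i ≠ j) {y : Weight} {z : X} (hz : IsMax L y z) :
    U.of L (.E i) • U.of L (.F j) • z = 0 := by
  rw [E_F_smul_ne hij, hz.E_smul, smul_zero]

theorem IsMax.E_F_F {i j : Fin 2} (hij : i ≠ j) {y : Weight} {z : X} (hz : IsMax L y z) :
    U.of L (.E i) • U.of L (.F i) • U.of L (.F j) • z = qn (y i + 1) • U.of L (.F j) • z := by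
  rw [E_F_smul_self (F_smul_mem hz.mem j), hz.E_F_ne hij, smul_zero, zero_add, Pi.sub_apply,
    α_ne hij, sub_neg_eq_add]

theorem IsMax.E_F_F' {i j : Fin 2} (hij : i ≠ j) {y : Weight} {z : X} (hz : IsMax L y z) :
    U.of L (.E i) • U.of L (.F j) • U.of L (.F i) • z = qn (y i) • U.of L (.F j) • z := by
  rw [E_F_smul_ne hij, hz.E_F, U.commutes]

/-- The four raising operators are removed from the inside outwards. The only branching is at the
second one (`e3`), which leaves two words and is responsible for the difference in `typ`. -/
theorem IsMax.eTop_fTop {i j : Fin 2} (hij : i ≠ j) {y : Weight} {z : X} (hz : IsMax L y z) :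
    eTop L i j • fTop L i j • z = typ i j y • z := by
  simp only [eTop, fTop, mul_smul]
  have m1 := F_smul_mem hz.mem j
  have m2 := F_smul_mem m1 i
  have m3 := F_smul_mem m2 j
  have e1 : U.of L (.E i) • U.of L (.F j) • U.of L (.F i) • U.of L (.F j) • z = 0 := by
    rw [E_F_smul_ne hij, hz.E_F_F hij, U.commutes, F_F_smul, smul_zero]
  have e2 : U.of L (.E i) • U.of L (.F i) • U.of L (.F j) • U.of L (.F i) • U.of L (.F j) • z =
      qn (y i) • U.of L (.F j) • U.of L (.F i) • U.of L (.F j) • z := by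
    rw [E_F_smul_self m3, e1, smul_zero, zero_add]
    congr 2
    simp only [Pi.sub_apply, α_self, α_ne hij]
    ring
  have e3 : U.of L (.E j) • U.of L (.F j) • U.of L (.F i) • U.of L (.F j) • z =
      qn (y j) • U.of L (.F j) • U.of L (.F i) • z -
        qn (y j + 1) • U.of L (.F i) • U.of L (.F j) • z := by
    have h : (y - α j - α i) j = y j - 1 := by
      simp only [Pi.sub_apply, α_self, α_ne hij.symm]
      ring
    rw [E_F_smul_self m2, hz.E_F_F' hij.symm, U.commutes, h, qn_sub_one, neg_smul, sub_eq_add_neg]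
  rw [e2, U.commutes, e3]
  simp only [U.commutes, smul_sub, hz.E_F_F hij, hz.E_F_F' hij, hz.E_F,
    smul_smul (M := ℂ), ← sub_smul]
  congr 1
  rw [typ]
  ring

/-- The bracket in `typ` is `-qn (y i + y j + 1)` by the addition formula, so the three factors
correspond to the three positive roots. -/
theorem typ_ne_zero {i j : Fin 2} (hij : i ≠ j) {y : Weight} (hi : ¬ IsOddInt (idx y (α i)))
    (hj : ¬ IsOddInt (idx y (α j))) (h3 : ¬ IsOddInt (idx y α₃)) : typ i j y ≠ 0 := by
  have h (z : ℂ) : IsOddInt (z + 1) ↔ IsEvenInt z := by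
    rw [← qn_succ_eq_zero_iff, ← qn_eq_zero_iff, add_assoc, show (1 + 1 : ℂ) = 2 by norm_num,
      qn_add_two, neg_eq_zero]
  rw [idx_α, h, ← qn_eq_zero_iff] at hi hj
  have h3' : idx y α₃ = (y i + y j + 1) + 1 := by
    rw [idx_α₃, idx_α, idx_α]
    fin_cases i <;> fin_cases j <;> simp_all <;> ring
  rw [h3', h, ← qn_eq_zero_iff] at h3
  refine mul_ne_zero (mul_ne_zero hi hj) fun h0 => h3 ?_
  rw [add_assoc, qn_add, add_assoc, show (1 + 1 : ℂ) = 2 by norm_num, qn_add_two]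
  linear_combination -h0

theorem IsMax.fTop_ne_zero {i j : Fin 2} (hij : i ≠ j) {y : Weight} {z : X} (hz : IsMax L y z)
    (hy : typ i j y ≠ 0) (h0 : z ≠ 0) : fTop L i j • z ≠ 0 := by
  intro h
  have := hz.eTop_fTop hij
  rw [h, smul_zero] at this
  exact smul_ne_zero hy h0 this.symm

/-- A nonzero combination of the words on a maximal vector can be raised to the lowest word. -/
theorem exists_smul_eq_fTop {i j : Fin 2} (hij : i ≠ j) (z : X) {c : Fin 8 → ℂ} (hc : c ≠ 0) :
    ∃ (u : U L) (d : ℂ), d ≠ 0 ∧ u • ∑ w, c w • word L i j w • z = d • fTop L i j • z := by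
  classical
  -- The complement of the first word that occurs takes this word to the longest one and kills all
  -- later ones.
  obtain ⟨w, hw, hmin⟩ : ∃ w, c w ≠ 0 ∧ ∀ w' < w, c w' = 0 := by
    obtain ⟨w₀, hw₀⟩ := Function.ne_iff.1 hc
    obtain ⟨w, hw, hmin⟩ := WellFounded.has_min (wellFounded_lt (α := Fin 8)) {w | c w ≠ 0} ⟨w₀, hw₀⟩
    exact ⟨w, hw, fun w' h => by_contra fun h' => hmin w' h' h⟩
  refine ⟨word L i j (coword w), c w, hw, ?_⟩
  rw [Finset.smul_sum, Finset.sum_eq_single w]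
  · rw [U.commutes, coword_smul_word hij]
  · intro w' _ hne
    rw [U.commutes]
    rcases lt_or_gt_of_ne hne with h | h
    · rw [hmin w' h, zero_smul]
    · rw [coword_smul_word_of_lt hij h, smul_zero]
  · simp

theorem IsMax.linearIndependent {i j : Fin 2} (hij : i ≠ j) {y : Weight} {z : X}
    (hz : IsMax L y z) (hy : typ i j y ≠ 0) (h0 : z ≠ 0) :
    LinearIndependent ℂ fun w => word L i j w • z := by
  rw [Fintype.linearIndependent_iff]
  intro c hc
  by_contra h
  obtain ⟨u, d, hd, hu⟩ := exists_smul_eq_fTop (L := L) hij z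
    (c := c) (fun h' => h fun w => congrFun h' w)
  rw [hc, smul_zero] at hu
  exact smul_ne_zero hd (hz.fTop_ne_zero hij hy h0) hu.symm

/-- A typical maximal vector generates a simple module. -/
theorem IsMax.mem_span_of_mem {i j : Fin 2} (hij : i ≠ j) {y : Weight} {z : X}
    (hz : IsMax L y z) (hy : typ i j y ≠ 0) {a : X} (ha : a ∈ Submodule.span (U L) {z})
    (h0 : a ≠ 0) : z ∈ Submodule.span (U L) {a} := by
  obtain ⟨c, rfl⟩ := (hz.mem_span_iff hij a).1 ha
  have hc : c ≠ 0 := by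
    rintro rfl
    simp at h0
  obtain ⟨u, d, hd, hu⟩ := exists_smul_eq_fTop (L := L) hij z hc
  set a := ∑ w, c w • word L i j w • z
  -- Any nonzero element can be lowered to the bottom of the module, and from there `eTop` climbs
  -- back to a nonzero multiple of `z`.
  have : z = (d * typ i j y)⁻¹ • (eTop L i j * u) • a := by
    rw [mul_smul, hu, U.commutes, hz.eTop_fTop hij, smul_smul, smul_smul, mul_assoc,
      inv_mul_cancel₀ (mul_ne_zero hd hy), one_smul]
  rw [this]
  exact Submodule.smul_of_tower_mem _ _ (Submodule.smul_mem _ _ (Submodule.mem_span_singleton_self a))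

/-! ### The Verma module does not vanish -/

/-- The `E j` on the eight-dimensional highest weight module of highest weight `y`. -/
def modelE (y : Weight) : Fin 2 → Module.End ℂ (Fin 8 → ℂ) :=
  ![{ toFun := fun v => ![qn (y 0) * v 1, 0, qn (y 0 + 1) * v 3 + qn (y 0) * v 4, qn (y 0) * v 5,
        -qn (y 0 + 1) * v 5, 0, qn (y 0) * v 7, 0]
      map_add' := by intro v v'; ext w; fin_cases w <;> simp <;> ring
      map_smul' := by intro c v; ext w; fin_cases w <;> simp <;> ring },
    { toFun := fun v => ![qn (y 1) * v 2, qn (y 1 + 1) * v 4 + qn (y 1) * v 3, 0,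
        -qn (y 1 + 1) * v 6, qn (y 1) * v 6, qn (y 1) * v 7, 0, 0]
      map_add' := by intro v v'; ext w; fin_cases w <;> simp <;> ring
      map_smul' := by intro c v; ext w; fin_cases w <;> simp <;> ring }]

/-- The `F j` on the eight-dimensional highest weight module. -/
def modelF : Fin 2 → Module.End ℂ (Fin 8 → ℂ) :=
  ![{ toFun := fun v => ![0, v 0, 0, v 2, 0, v 4, 0, v 6]
      map_add' := by intro v v'; ext w; fin_cases w <;> simp
      map_smul' := by intro c v; ext w; fin_cases w <;> simp },
    { toFun := fun v => ![0, 0, v 0, 0, v 1, 0, v 3, v 5]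
      map_add' := by intro v v'; ext w; fin_cases w <;> simp
      map_smul' := by intro c v; ext w; fin_cases w <;> simp }]

/-- A diagonal operator. -/
def modelDiag (d : Fin 8 → ℂ) : Module.End ℂ (Fin 8 → ℂ) where
  toFun v w := d w * v w
  map_add' v v' := by ext w; simp [mul_add]
  map_smul' c v := by ext w; simp [mul_left_comm]

/-- The generators on the eight-dimensional highest weight module of highest weight `y`. -/
def modelGen (L : MidLattice) (y : Weight) : Gen L → Module.End ℂ (Fin 8 → ℂ)
  | .E j => modelE y j
  | .F j => modelF j
  | .H j => modelDiag fun w => (y - wordWt 0 1 w) j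
  | .K γ => modelDiag fun w => iPow (form γ (y - wordWt 0 1 w))

theorem modelDiag_apply (d v : Fin 8 → ℂ) (w : Fin 8) : modelDiag d v w = d w * v w := rfl

theorem modelE_zero (y : Weight) (v : Fin 8 → ℂ) : modelE y 0 v = ![qn (y 0) * v 1, 0,
    qn (y 0 + 1) * v 3 + qn (y 0) * v 4, qn (y 0) * v 5, -qn (y 0 + 1) * v 5, 0, qn (y 0) * v 7,
    0] := rfl

theorem modelE_one (y : Weight) (v : Fin 8 → ℂ) : modelE y 1 v = ![qn (y 1) * v 2,
    qn (y 1 + 1) * v 4 + qn (y 1) * v 3, 0, -qn (y 1 + 1) * v 6, qn (y 1) * v 6, qn (y 1) * v 7,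
    0, 0] := rfl

theorem modelF_zero (v : Fin 8 → ℂ) : modelF 0 v = ![0, v 0, 0, v 2, 0, v 4, 0, v 6] := rfl

theorem modelF_one (v : Fin 8 → ℂ) : modelF 1 v = ![0, 0, v 0, 0, v 1, 0, v 3, v 5] := rfl

/-- The numbers of letters of the words. -/
def letters : Fin 8 → Fin 2 → ℕ :=
  ![![0, 0], ![1, 0], ![0, 1], ![1, 1], ![1, 1], ![2, 1], ![1, 2], ![2, 2]]

theorem wordWt_of_letters {j : Fin 2} {a b : Fin 8} (h : letters b = letters a + Pi.single j 1) :
    wordWt 0 1 b = wordWt 0 1 a + α j := by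
  fin_cases j <;> fin_cases a <;> fin_cases b <;> first
    | exact absurd h (by decide)
    | (simp only [wordWt, Fin.reduceFinMk, Matrix.cons_val, Fin.zero_eta, Fin.isValue, Fin.mk_one]
       first | done | abel)

/-- The matrices are graded by letter counts, here used in place of weights because equality of
natural numbers is decidable. -/
theorem modelE_local (y : Weight) (j : Fin 2) (a : Fin 8) (v v' : Fin 8 → ℂ)
    (h : ∀ b, letters b = letters a + Pi.single j 1 → v b = v' b) :
    modelE y j v a = modelE y j v' a := by
  fin_cases j <;> fin_cases a <;> simp (discharger := decide) [modelE_zero, modelE_one, h]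

theorem modelF_local (j : Fin 2) (a : Fin 8) (v v' : Fin 8 → ℂ)
    (h : ∀ b, letters a = letters b + Pi.single j 1 → v b = v' b) :
    modelF j v a = modelF j v' a := by
  fin_cases j <;> fin_cases a <;> simp (discharger := decide) [modelF_zero, modelF_one, h]

/-- A diagonal operator depending only on the weight is constant on the entries that row `a` reads,
so the relations with `H` and `K` become comparisons of scalars. -/
theorem modelE_diag (y : Weight) (j : Fin 2) (a : Fin 8) (d v : Fin 8 → ℂ) (c : ℂ)
    (h : ∀ b, wordWt 0 1 b = wordWt 0 1 a + α j → d b = c) :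
    modelE y j (modelDiag d v) a = c * modelE y j v a := by
  rw [modelE_local y j a _ (c • v), map_smul]
  · rfl
  · intro b hb
    rw [modelDiag_apply, h b (wordWt_of_letters hb)]
    rfl

theorem modelF_diag (j : Fin 2) (a : Fin 8) (d v : Fin 8 → ℂ) (c : ℂ)
    (h : ∀ b, wordWt 0 1 a = wordWt 0 1 b + α j → d b = c) :
    modelF j (modelDiag d v) a = c * modelF j v a := by
  rw [modelF_local j a _ (c • v), map_smul]
  · rfl
  · intro b hb
    rw [modelDiag_apply, h b (wordWt_of_letters hb)]
    rfl

/-- The words shift `y j` by small integers, and `qn` changes sign under a shift by two. So only `qn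
(y j)` and `qn (y j + 1)` occur, the same quantities as in `modelE`. -/
theorem qn_wordWt (y : Weight) (j : Fin 2) (w : Fin 8) : qn ((y - wordWt 0 1 w) j) =
    (![![qn (y 0), -qn (y 0), qn (y 0 + 1), -qn (y 0 + 1), -qn (y 0 + 1), qn (y 0 + 1), qn (y 0),
        -qn (y 0)],
      ![qn (y 1), qn (y 1 + 1), -qn (y 1), -qn (y 1 + 1), -qn (y 1 + 1), qn (y 1), qn (y 1 + 1),
        -qn (y 1)]] : Fin 2 → Fin 8 → ℂ) j w := by
  have h3 (z : ℂ) : qn (z - 3) = qn (z + 1) := by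
    rw [show z - 3 = z - 1 - 2 by ring, qn_sub_two, qn_sub_one, neg_neg]
  rw [Pi.sub_apply]
  fin_cases j
  · have h : (fun w => wordWt 0 1 w 0) = ![0, 2, -1, 1, 1, 3, 0, 2] := by
      funext w
      fin_cases w <;> simp [wordWt, α, cartan] <;> norm_num
    have h' := congrFun h w
    simp only [Fin.zero_eta] at h' ⊢
    rw [h']
    fin_cases w <;> simp [qn_sub_one, qn_sub_two, h3]
  · have h : (fun w => wordWt 0 1 w 1) = ![0, -1, 2, 1, 1, 0, 3, 2] := by
      funext w
      fin_cases w <;> simp [wordWt, α, cartan] <;> norm_num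
    have h' := congrFun h w
    simp only [Fin.mk_one] at h' ⊢
    rw [h']
    fin_cases w <;> simp [qn_sub_one, qn_sub_two, h3]

theorem modelE_modelF (y : Weight) (j : Fin 2) :
    modelE y j * modelF j - modelF j * modelE y j =
      modelDiag fun w => qn ((y - wordWt 0 1 w) j) := by
  simp only [qn_wordWt]
  refine LinearMap.ext fun v => funext fun w => ?_
  fin_cases j <;> fin_cases w <;>
    simp [modelDiag_apply, modelF_zero, modelF_one, modelE_zero, modelE_one, Module.End.mul_apply]

theorem modelE_modelF_ne (y : Weight) {j j' : Fin 2} (hj : j ≠ j') :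
    modelE y j * modelF j' - modelF j' * modelE y j = 0 := by
  refine LinearMap.ext fun v => funext fun w => ?_
  fin_cases j <;> fin_cases j' <;> first
    | exact absurd rfl hj
    | (fin_cases w <;>
        simp [modelF_zero, modelF_one, modelE_zero, modelE_one, Module.End.mul_apply])

theorem modelE_sq (y : Weight) (j : Fin 2) : modelE y j * modelE y j = 0 := by
  refine LinearMap.ext fun v => funext fun w => ?_
  fin_cases j <;> fin_cases w <;> simp [modelE_zero, modelE_one, Module.End.mul_apply] <;> ring

theorem modelF_sq (j : Fin 2) : modelF j * modelF j = 0 := by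
  refine LinearMap.ext fun v => funext fun w => ?_
  fin_cases j <;> fin_cases w <;> simp [modelF_zero, modelF_one, Module.End.mul_apply]

theorem modelE_braid (y : Weight) : modelE y 0 * modelE y 1 * (modelE y 0 * modelE y 1) =
    modelE y 1 * modelE y 0 * (modelE y 1 * modelE y 0) := by
  refine LinearMap.ext fun v => funext fun w => ?_
  fin_cases w <;> simp [modelE_zero, modelE_one, Module.End.mul_apply]
  ring

theorem modelF_braid : modelF 0 * modelF 1 * (modelF 0 * modelF 1) =
    modelF 1 * modelF 0 * (modelF 1 * modelF 0) := by
  refine LinearMap.ext fun v => funext fun w => ?_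
  fin_cases w <;> simp [modelF_zero, modelF_one, Module.End.mul_apply]

theorem modelGen_rel (L : MidLattice) (y : Weight) {a b : FreeAlgebra ℂ (Gen L)} (h : Rel L a b) :
    FreeAlgebra.lift ℂ (modelGen L y) a = FreeAlgebra.lift ℂ (modelGen L y) b := by
  cases h with
  | K_zero =>
    simp only [gen, FreeAlgebra.lift_ι_apply, map_one, modelGen]
    refine LinearMap.ext fun v => funext fun w => ?_
    simp [modelDiag_apply, form, iPow_zero]
  | K_add γ δ =>
    simp only [gen, FreeAlgebra.lift_ι_apply, map_mul, modelGen]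
    refine LinearMap.ext fun v => funext fun w => ?_
    simp [modelDiag_apply, form_add_left, iPow_add, mul_assoc]
  | K_E γ j =>
    simp only [gen, FreeAlgebra.lift_ι_apply, map_mul, map_smul, modelGen]
    refine LinearMap.ext fun v => funext fun w => ?_
    simp only [Module.End.mul_apply, modelDiag_apply, LinearMap.smul_apply, Pi.smul_apply,
      smul_eq_mul]
    rw [modelE_diag y j w _ v (iPow (form (-γ) (y - (wordWt 0 1 w + α j))))
      (fun b hb => by rw [hb]; rfl), ← mul_assoc, ← iPow_add]
    congr 2
    rw [form_neg_left, form_sub_right, form_sub_right, form_add_right]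
    ring
  | K_F γ j =>
    simp only [gen, FreeAlgebra.lift_ι_apply, map_mul, map_smul, modelGen]
    refine LinearMap.ext fun v => funext fun w => ?_
    simp only [Module.End.mul_apply, modelDiag_apply, LinearMap.smul_apply, Pi.smul_apply,
      smul_eq_mul]
    rw [modelF_diag j w _ v (iPow (form (-γ) (y - (wordWt 0 1 w - α j))))
      (fun b hb => by rw [hb, add_sub_cancel_right]; rfl), ← mul_assoc, ← iPow_add]
    congr 2
    rw [form_neg_left, form_sub_right, form_sub_right, form_sub_right]
    ring
  | E_F j j' =>
    have hK : FreeAlgebra.lift ℂ (modelGen L y)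
        ((2 * Complex.I)⁻¹ • (gen (.K (L.root j)) - gen (.K (-L.root j)))) =
        modelDiag fun w => qn ((y - wordWt 0 1 w) j) := by
      simp only [gen, FreeAlgebra.lift_ι_apply, map_sub, map_smul, modelGen]
      refine LinearMap.ext fun v => funext fun w => ?_
      simp only [LinearMap.smul_apply, LinearMap.sub_apply, Pi.smul_apply, Pi.sub_apply,
        modelDiag_apply, smul_eq_mul, MidLattice.root, NegMemClass.coe_neg, form_neg_left,
        form_comm (α j), form_α, qn]
      ring
    split_ifs with hj
    · subst hj
      rw [hK, ← modelE_modelF]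
      simp only [gen, FreeAlgebra.lift_ι_apply, map_mul, map_sub, modelGen]
    · simpa only [gen, FreeAlgebra.lift_ι_apply, map_mul, map_sub, modelGen, map_zero] using
        modelE_modelF_ne y hj
  | E_sq j =>
    simpa only [gen, FreeAlgebra.lift_ι_apply, map_mul, modelGen, pow_two, map_zero] using
      modelE_sq y j
  | F_sq j =>
    simpa only [gen, FreeAlgebra.lift_ι_apply, map_mul, modelGen, pow_two, map_zero] using
      modelF_sq j
  | E_braid =>
    simpa only [gen, FreeAlgebra.lift_ι_apply, map_mul, modelGen, pow_two] using modelE_braid y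
  | F_braid =>
    simpa only [gen, FreeAlgebra.lift_ι_apply, map_mul, modelGen, pow_two] using modelF_braid
  | H_E j j' =>
    simp only [gen, FreeAlgebra.lift_ι_apply, map_mul, map_sub, map_smul, modelGen]
    refine LinearMap.ext fun v => funext fun w => ?_
    simp only [Module.End.mul_apply, modelDiag_apply, LinearMap.smul_apply, Pi.smul_apply,
      smul_eq_mul, LinearMap.sub_apply, Pi.sub_apply]
    rw [modelE_diag y j' w _ v (y j - (wordWt 0 1 w + α j') j) (fun b hb => by rw [hb]),
      Pi.add_apply, α]
    ring
  | H_F j j' =>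
    simp only [gen, FreeAlgebra.lift_ι_apply, map_mul, map_sub, map_smul, modelGen]
    refine LinearMap.ext fun v => funext fun w => ?_
    simp only [Module.End.mul_apply, modelDiag_apply, LinearMap.smul_apply, Pi.smul_apply,
      smul_eq_mul, LinearMap.sub_apply, Pi.sub_apply]
    rw [modelF_diag j' w _ v (y j - (wordWt 0 1 w - α j') j)
      (fun b hb => by rw [hb, add_sub_cancel_right]), Pi.sub_apply, α]
    ring
  | H_H j j' =>
    simp only [gen, FreeAlgebra.lift_ι_apply, map_mul, modelGen]
    refine LinearMap.ext fun v => funext fun w => ?_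
    simp only [modelDiag_apply, Module.End.mul_apply]
    ring
  | H_K j γ =>
    simp only [gen, FreeAlgebra.lift_ι_apply, map_mul, modelGen]
    refine LinearMap.ext fun v => funext fun w => ?_
    simp only [modelDiag_apply, Module.End.mul_apply]
    ring

/-- The eight-dimensional representation of highest weight `y`. -/
def modelRep (L : MidLattice) (y : Weight) : U L →ₐ[ℂ] Module.End ℂ (Fin 8 → ℂ) :=
  RingQuot.liftAlgHom ℂ ⟨FreeAlgebra.lift ℂ (modelGen L y), fun _ _ h => modelGen_rel L y h⟩

theorem modelRep_of (L : MidLattice) (y : Weight) (g : Gen L) :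
    modelRep L y (U.of L g) = modelGen L y g := by
  simp [modelRep, U.of]

/-- The annihilator of the top vector of the eight-dimensional representation is a left ideal that
contains the generators of `vermaIdeal` but not 1. -/
theorem vermaIdeal_ne_top (L : MidLattice) (y : Weight) : vermaIdeal L y ≠ ⊤ := by
  intro h
  let e : Fin 8 → ℂ := Pi.single 0 1
  let I : Submodule (U L) (U L) :=
    { carrier := {u | modelRep L y u e = 0}
      zero_mem' := by simp
      add_mem' := by
        intro a b ha hb
        simp only [Set.mem_ofPred_eq] at ha hb
        simp [ha, hb]
      smul_mem' := by
        intro c a ha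
        simp only [Set.mem_ofPred_eq] at ha
        simp [ha] }
  have hI : vermaIdeal L y ≤ I := by
    rw [vermaIdeal, Submodule.span_le]
    rintro _ ((⟨j, rfl⟩ | ⟨j, rfl⟩) | ⟨γ, rfl⟩)
    · change modelRep L y (U.of L (.E j)) e = 0
      rw [modelRep_of]
      funext w
      fin_cases j <;> fin_cases w <;> simp [modelGen, modelE_zero, modelE_one, e]
    · change modelRep L y (U.of L (.H j) - _) e = 0
      rw [map_sub, modelRep_of, AlgHom.commutes]
      funext w
      fin_cases w <;> simp [modelGen, modelDiag_apply, e, wordWt]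
    · change modelRep L y (U.of L (.K γ) - _) e = 0
      rw [map_sub, modelRep_of, AlgHom.commutes]
      funext w
      fin_cases w <;> simp [modelGen, modelDiag_apply, e, wordWt]
  rw [h, top_le_iff] at hI
  have h1 : (1 : U L) ∈ I := hI ▸ Submodule.mem_top
  have h2 : modelRep L y 1 e = 0 := h1
  rw [map_one] at h2
  have := congrFun h2 0
  simp [e] at this

variable {L : MidLattice} {X : Type*} [AddCommGroup X] [Module ℂ X] [Module (U L) X]
  [IsScalarTower ℂ (U L) X] {Y : Type*} [AddCommGroup Y] [Module ℂ Y] [Module (U L) Y]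
  [IsScalarTower ℂ (U L) Y]

/-! ### Weights of a highest weight module -/

theorem root_combination_injective {i j : Fin 2} (hij : i ≠ j) {p q p' q' : ℂ}
    (h : p • α i + q • α j = p' • α i + q' • α j) : p = p' ∧ q = q' := by
  have hi := congrFun h i
  have hj := congrFun h j
  simp only [Pi.add_apply, Pi.smul_apply, α_self, α_ne hij, α_ne hij.symm, smul_eq_mul] at hi hj
  constructor
  · linear_combination (2 * hi + hj) / 3
  · linear_combination (2 * hj + hi) / 3

theorem wordWt_eq (i j : Fin 2) (w : Fin 8) :
    wordWt i j w = (letters w 0 : ℂ) • α i + (letters w 1 : ℂ) • α j := by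
  fin_cases w <;> simp [wordWt, letters, two_smul] <;> abel

theorem letters_eq_iff {i j : Fin 2} (hij : i ≠ j) (w : Fin 8) (p q : ℕ) :
    wordWt i j w = (p : ℂ) • α i + (q : ℂ) • α j ↔ letters w 0 = p ∧ letters w 1 = q := by
  rw [wordWt_eq]
  constructor
  · intro h
    exact_mod_cast root_combination_injective hij h
  · rintro ⟨h1, h2⟩
    rw [h1, h2]

/-- Only the independence of different weights enters, so this also serves atypical maximal vectors,
on which the words may be linearly dependent. -/
theorem IsMax.eq_sum_letters {i j : Fin 2} (hij : i ≠ j) {y : Weight} {z : X} (hz : IsMax L y z)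
    {c : Fin 8 → ℂ} (p q : ℕ)
    (ha : ∑ w, c w • word L i j w • z ∈ goodSpace L X (y - ((p : ℂ) • α i + (q : ℂ) • α j))) :
    ∑ w, c w • word L i j w • z =
      ∑ w with letters w 0 = p ∧ letters w 1 = q, c w • word L i j w • z := by
  classical
  rw [eq_sum_filter (ι := Fin 8) ha (fun w => y - wordWt i j w) _
    (fun w => Submodule.smul_mem _ (c w) (word_smul_mem hz.mem i j w)) rfl]
  refine Finset.sum_congr ?_ fun _ _ => rfl
  ext w
  simp only [Finset.mem_filter, Finset.mem_univ, true_and, sub_right_inj, letters_eq_iff hij]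

theorem IsMax.eq_smul_zero {i j : Fin 2} (hij : i ≠ j) {y : Weight} {z : X} (hz : IsMax L y z)
    {c : Fin 8 → ℂ} (ha : ∑ w, c w • word L i j w • z ∈ goodSpace L X y) :
    ∑ w, c w • word L i j w • z = c 0 • z := by
  rw [hz.eq_sum_letters hij 0 0 (by simpa using ha),
    show (Finset.univ.filter fun w => letters w 0 = 0 ∧ letters w 1 = 0) = {0} by decide]
  simp [word]

theorem IsMax.exists_eq_smul_F {i j : Fin 2} (hij : i ≠ j) {y : Weight} {z : X} (hz : IsMax L y z)
    {a : X} (ha : a ∈ Submodule.span (U L) {z}) (ha' : a ∈ goodSpace L X (y - α i)) :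
    ∃ c : ℂ, a = c • U.of L (.F i) • z := by
  obtain ⟨c, rfl⟩ := (hz.mem_span_iff hij a).1 ha
  refine ⟨c 1, ?_⟩
  rw [hz.eq_sum_letters hij 1 0 (by simpa using ha'),
    show (Finset.univ.filter fun w => letters w 0 = 1 ∧ letters w 1 = 0) = {1} by decide]
  simp [word]

theorem IsMax.exists_eq_smul_F_F {i j : Fin 2} (hij : i ≠ j) {y : Weight} {z : X}
    (hz : IsMax L y z) {a : X} (ha : a ∈ Submodule.span (U L) {z})
    (ha' : a ∈ goodSpace L X (y - α i - α j)) :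
    ∃ c d : ℂ, a = c • U.of L (.F i) • U.of L (.F j) • z + d • U.of L (.F j) • U.of L (.F i) • z := by
  obtain ⟨c, rfl⟩ := (hz.mem_span_iff hij a).1 ha
  refine ⟨c 3, c 4, ?_⟩
  rw [hz.eq_sum_letters hij 1 1 (by simpa [sub_sub] using ha'),
    show (Finset.univ.filter fun w => letters w 0 = 1 ∧ letters w 1 = 1) = {3, 4} by decide]
  simp [word, mul_smul]

/-- A maximal vector below a maximal vector does not generate it. -/
theorem IsMax.eq_zero_of_mem_span_F {i j : Fin 2} (hij : i ≠ j) {y : Weight} {z : X}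
    (hz : IsMax L y z) (hF : IsMax L (y - α i) (U.of L (.F i) • z))
    (h : z ∈ Submodule.span (U L) {U.of L (.F i) • z}) : z = 0 := by
  classical
  obtain ⟨c, hc⟩ := (hF.mem_span_iff hij z).1 h
  have h1 := eq_sum_filter (ι := Fin 8) hz.mem (fun w => y - α i - wordWt i j w) _
    (fun w => Submodule.smul_mem _ (c w) (word_smul_mem hF.mem i j w)) hc
  rw [h1, Finset.filter_false_of_mem, Finset.sum_empty]
  -- Every word on `F i z` lies below `y` by at least one `α i`, so none contributes to weight `y`.
  intro w _ hw
  have h2 : ((letters w 0 + 1 : ℕ) : ℂ) • α i + (letters w 1 : ℂ) • α j =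
      ((0 : ℕ) : ℂ) • α i + ((0 : ℕ) : ℂ) • α j := by
    have h3 : α i + wordWt i j w = 0 := by
      rw [sub_sub] at hw
      exact sub_eq_self.1 hw
    rw [wordWt_eq] at h3
    push_cast
    rw [add_smul, one_smul, zero_smul, zero_smul, add_zero, ← h3]
    abel
  have := (root_combination_injective hij h2).1
  exact Nat.succ_ne_zero _ (Nat.cast_injective this)

/-- The proper submodules of a highest weight module avoid the highest weight space. -/
theorem IsMax.coeff_eq_zero {i j : Fin 2} (hij : i ≠ j) {y : Weight} {z : X} (hz : IsMax L y z)
    {N : Submodule (U L) X} (hN : z ∉ N) {c : Fin 8 → ℂ}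
    (hc : ∑ w, c w • word L i j w • z ∈ N) : c 0 = 0 := by
  -- Modulo `N` the combination vanishes, and its part of weight `y` is `c 0` times the nonzero
  -- image of `z`.
  have hz' : IsMax L y (N.mkQ z) := hz.map N.mkQ
  have h0 : ∑ w, c w • word L i j w • N.mkQ z = 0 := by
    rw [← Submodule.Quotient.mk_eq_zero] at hc
    have h1 := hc
    simp only [← Submodule.mkQ_apply, map_sum] at h1
    rw [← h1]
    rfl
  have h1 := hz'.eq_smul_zero hij (c := c) (by rw [h0]; exact Submodule.zero_mem _)
  rw [h0] at h1
  refine (smul_eq_zero.1 h1.symm).resolve_right fun h => hN ?_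
  exact (Submodule.Quotient.mk_eq_zero N).1 h

/-- Elements of proper submodules can be written without the empty word, and this property is
additive. A vector of the top weight written in this way is zero. -/
theorem IsMax.notMem_sSup {y : Weight} {z : X} (hz : IsMax L y z)
    (h0 : z ≠ 0) (hgen : Submodule.span (U L) {z} = ⊤) :
    z ∉ sSup {N : Submodule (U L) X | N ≠ ⊤} := by
  have hij : (0 : Fin 2) ≠ 1 := by decide
  have key : ∀ a ∈ sSup {N : Submodule (U L) X | N ≠ ⊤},
      ∃ c : Fin 8 → ℂ, c 0 = 0 ∧ a = ∑ w, c w • word L 0 1 w • z := by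
    intro a ha
    rw [sSup_eq_iSup'] at ha
    induction ha using Submodule.iSup_induction' with
    | mem N a ha =>
      obtain ⟨c, rfl⟩ := (hz.mem_span_iff hij a).1 (hgen ▸ Submodule.mem_top)
      refine ⟨c, hz.coeff_eq_zero hij (N := N) ?_ ha, rfl⟩
      intro hzN
      exact N.2 (top_le_iff.1 (hgen.ge.trans ((Submodule.span_singleton_le_iff_mem _ _).2 hzN)))
    | zero => exact ⟨0, rfl, by simp⟩
    | add a b _ _ ha hb =>
      obtain ⟨c, hc, rfl⟩ := ha
      obtain ⟨d, hd, rfl⟩ := hb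
      exact ⟨c + d, by simp [hc, hd], by simp [add_smul, Finset.sum_add_distrib]⟩
  intro h
  obtain ⟨c, hc, hz'⟩ := key z h
  have := hz.eq_smul_zero hij (c := c) (by rw [← hz']; exact hz.mem)
  rw [hc, zero_smul, ← hz'] at this
  exact h0 this

/-! ### Verma modules and their irreducible quotients -/

variable (L) in
/-- The universal maximal vector. -/
def vermaGen (y : Weight) : Verma L y := (vermaIdeal L y).mkQ 1

theorem smul_vermaGen (y : Weight) (u : U L) : u • vermaGen L y = (vermaIdeal L y).mkQ u := by
  rw [vermaGen, ← map_smul, smul_eq_mul, mul_one]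

theorem smul_eq_of_sub_smul {u : U L} {c : ℂ} {x : X} (h : (u - algebraMap ℂ (U L) c) • x = 0) :
    u • x = c • x := by
  rwa [sub_smul, algebraMap_smul, sub_eq_zero] at h

theorem isMax_vermaGen (y : Weight) : IsMax L y (vermaGen L y) := by
  have h (u : U L) (c : ℂ) (hu : u - algebraMap ℂ (U L) c ∈ vermaIdeal L y) :
      u • vermaGen L y = c • vermaGen L y := by
    refine smul_eq_of_sub_smul (x := vermaGen L y) ?_
    rw [smul_vermaGen]
    exact (Submodule.Quotient.mk_eq_zero _).2 hu
  refine ⟨⟨fun j => h _ _ ?_, fun γ => h _ _ ?_⟩, fun k => ?_⟩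
  · exact Submodule.subset_span (.inl (.inr ⟨j, rfl⟩))
  · exact Submodule.subset_span (.inr ⟨γ, rfl⟩)
  · rw [smul_vermaGen]
    exact (Submodule.Quotient.mk_eq_zero _).2 (Submodule.subset_span (.inl (.inl ⟨k, rfl⟩)))

theorem span_vermaGen (y : Weight) : Submodule.span (U L) {vermaGen L y} = ⊤ := by
  rw [eq_top_iff]
  intro x _
  obtain ⟨u, rfl⟩ := (vermaIdeal L y).mkQ_surjective x
  rw [← smul_vermaGen]
  exact Submodule.smul_mem _ _ (Submodule.mem_span_singleton_self _)

theorem vermaGen_ne_zero (y : Weight) : vermaGen L y ≠ 0 := by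
  intro h
  apply vermaIdeal_ne_top L y
  have h1 : (1 : U L) ∈ vermaIdeal L y := (Submodule.Quotient.mk_eq_zero _).1 h
  rw [eq_top_iff]
  intro u _
  simpa using (vermaIdeal L y).smul_mem u h1

/-- The map from the Verma module given by a maximal vector. -/
def IsMax.lift {y : Weight} {z : X} (hz : IsMax L y z) : Verma L y →ₗ[U L] X :=
  (vermaIdeal L y).liftQ (LinearMap.toSpanSingleton (U L) X z) <| by
    rw [vermaIdeal, Submodule.span_le]
    rintro _ ((⟨j, rfl⟩ | ⟨j, rfl⟩) | ⟨γ, rfl⟩)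
    · exact hz.E_smul j
    · change (U.of L (.H j) - algebraMap ℂ (U L) (y j)) • z = 0
      rw [sub_smul, algebraMap_smul, H_smul hz.mem, sub_self]
    · change (U.of L (.K γ) - algebraMap ℂ (U L) (iPow (form γ y))) • z = 0
      rw [sub_smul, algebraMap_smul, K_smul hz.mem, sub_self]

theorem IsMax.lift_vermaGen {y : Weight} {z : X} (hz : IsMax L y z) : hz.lift (vermaGen L y) = z := by
  rw [vermaGen, IsMax.lift, Submodule.mkQ_apply, Submodule.liftQ_apply]
  simp

theorem vermaGen_notMem_vermaMax (y : Weight) : vermaGen L y ∉ vermaMax L y :=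
  (isMax_vermaGen y).notMem_sSup (vermaGen_ne_zero y) (span_vermaGen y)

variable (L) in
/-- The maximal vector of the irreducible quotient of the Verma module. -/
def irrGen (y : Weight) : Irr L y := (vermaMax L y).mkQ (vermaGen L y)

theorem irrGen_ne_zero (y : Weight) : irrGen L y ≠ 0 := fun h =>
  vermaGen_notMem_vermaMax y ((Submodule.Quotient.mk_eq_zero _).1 h)

theorem isMax_irrGen (y : Weight) : IsMax L y (irrGen L y) := (isMax_vermaGen y).map _

theorem span_irrGen (y : Weight) : Submodule.span (U L) {irrGen L y} = ⊤ := by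
  rw [irrGen, ← Set.image_singleton, Submodule.span_image, span_vermaGen, Submodule.map_top,
    Submodule.range_mkQ]

/-- A proper submodule of `Irr L y` vanishes. -/
theorem irr_eq_bot {y : Weight} {N : Submodule (U L) (Irr L y)} (hN : N ≠ ⊤) : N = ⊥ := by
  have h1 : N.comap (vermaMax L y).mkQ ≠ ⊤ := by
    intro h
    apply hN
    rw [← Submodule.map_comap_eq_of_surjective (vermaMax L y).mkQ_surjective N, h,
      Submodule.map_top, Submodule.range_mkQ]
  have h2 : N.comap (vermaMax L y).mkQ ≤ vermaMax L y := le_sSup h1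
  rw [← Submodule.map_comap_eq_of_surjective (vermaMax L y).mkQ_surjective N, eq_bot_iff,
    Submodule.map_le_iff_le_comap]
  exact h2.trans ((Submodule.ker_mkQ (vermaMax L y)).ge.trans (LinearMap.ker_le_comap _))

theorem irrGen_mem_span {y : Weight} {a : Irr L y} (ha : a ≠ 0) :
    irrGen L y ∈ Submodule.span (U L) {a} := by
  by_cases h : Submodule.span (U L) {a} = ⊤
  · rw [h]
    exact Submodule.mem_top
  · have := irr_eq_bot h
    rw [Submodule.span_singleton_eq_bot] at this
    exact absurd this ha

/-- A typical Verma module is already simple. Hence a maximal vector of typical weight defines a map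
from `Irr L y`, and not only from the Verma module. -/
theorem vermaMax_eq_bot {i j : Fin 2} (hij : i ≠ j) {y : Weight} (hy : typ i j y ≠ 0) :
    vermaMax L y = ⊥ := by
  rw [vermaMax, sSup_eq_bot]
  intro N hN
  by_contra h
  obtain ⟨a, ha, ha0⟩ := Submodule.exists_mem_ne_zero_of_ne_bot h
  have h1 := (isMax_vermaGen (L := L) y).mem_span_of_mem hij hy (a := a)
    (by rw [span_vermaGen]; exact Submodule.mem_top) ha0
  apply hN
  rw [eq_top_iff, ← span_vermaGen, Submodule.span_singleton_le_iff_mem]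
  exact (Submodule.span_singleton_le_iff_mem a N).2 ha h1

/-- The map from a typical irreducible module given by a maximal vector. -/
theorem IsMax.exists_irr_lift {i j : Fin 2} (hij : i ≠ j) {y : Weight} (hy : typ i j y ≠ 0) {z : X}
    (hz : IsMax L y z) : ∃ f : Irr L y →ₗ[U L] X, f (irrGen L y) = z := by
  refine ⟨(vermaMax L y).liftQ hz.lift ?_, ?_⟩
  · rw [vermaMax_eq_bot hij hy]
    exact bot_le
  · rw [irrGen, Submodule.mkQ_apply, Submodule.liftQ_apply, hz.lift_vermaGen]

theorem finrank_irr_of_typical {i j : Fin 2} (hij : i ≠ j) {y : Weight} (hy : typ i j y ≠ 0) :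
    Module.finrank ℂ (Irr L y) = 8 := by
  have hli := (isMax_irrGen (L := L) y).linearIndependent hij hy (irrGen_ne_zero y)
  have hsp : ⊤ ≤ Submodule.span ℂ (Set.range fun w => word L i j w • irrGen L y) := by
    intro a _
    obtain ⟨c, hc⟩ := ((isMax_irrGen (L := L) y).mem_span_iff hij a).1
      (by rw [span_irrGen]; exact Submodule.mem_top)
    exact (Submodule.mem_span_range_iff_exists_fun ℂ).2 ⟨c, hc.symm⟩
  rw [Module.finrank_eq_card_basis (Module.Basis.mk hli hsp), Fintype.card_fin]

instance finite_irr (y : Weight) : Module.Finite ℂ (Irr L y) := by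
  classical
  refine Module.finite_def.2 ⟨Finset.univ.image fun w => word L 0 1 w • irrGen L y, ?_⟩
  rw [eq_top_iff]
  intro a _
  obtain ⟨c, hc⟩ := ((isMax_irrGen (L := L) y).mem_span_iff (i := 0) (j := 1) (by decide) a).1
    (by rw [span_irrGen]; exact Submodule.mem_top)
  rw [Finset.coe_image, Finset.coe_univ, Set.image_univ]
  exact (Submodule.mem_span_range_iff_exists_fun ℂ).2 ⟨c, hc.symm⟩

/-! ### Weight modules -/

theorem iSup_goodSpace_eq_top_of_span {s : Set X} (hs : ∀ x ∈ s, ∃ η, x ∈ goodSpace L X η)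
    (hspan : Submodule.span (U L) s = ⊤) : ⨆ η, goodSpace L X η = ⊤ := by
  have hst : ∀ g, ∀ x ∈ ⨆ η, goodSpace L X η, U.of L g • x ∈ ⨆ η, goodSpace L X η := by
    intro g x hx
    induction hx using Submodule.iSup_induction' with
    | mem η x hx =>
      cases g with
      | E j => exact Submodule.mem_iSup_of_mem _ (E_smul_mem hx j)
      | F j => exact Submodule.mem_iSup_of_mem _ (F_smul_mem hx j)
      | H j => rw [H_smul hx]; exact Submodule.mem_iSup_of_mem η (Submodule.smul_mem _ _ hx)
      | K γ => rw [K_smul hx]; exact Submodule.mem_iSup_of_mem η (Submodule.smul_mem _ _ hx)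
    | zero => simp
    | add a b _ _ ha hb => rw [smul_add]; exact Submodule.add_mem _ ha hb
  have h : Submodule.span (U L) s ≤ U.submodule _ hst := by
    rw [Submodule.span_le]
    intro x hx
    obtain ⟨η, hη⟩ := hs x hx
    exact Submodule.mem_iSup_of_mem η hη
  rw [eq_top_iff]
  intro x _
  exact h (hspan ▸ Submodule.mem_top : x ∈ Submodule.span (U L) s)

theorem iSup_goodSpace_irr (y : Weight) : ⨆ η, goodSpace L (Irr L y) η = ⊤ :=
  iSup_goodSpace_eq_top_of_span (s := {irrGen L y})
    (fun x hx => ⟨y, by rw [Set.mem_singleton_iff.1 hx]; exact (isMax_irrGen y).mem⟩)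
    (span_irrGen y)

theorem exists_add_of_iSup_goodSpace (h : ⨆ η, goodSpace L X η = ⊤) (η : Weight) (x : X) :
    ∃ a ∈ goodSpace L X η, ∃ b ∈ ⨆ (φ) (_ : φ ≠ η), goodSpace L X φ, a + b = x := by
  have hx : x ∈ goodSpace L X η ⊔ ⨆ (φ) (_ : φ ≠ η), goodSpace L X φ := by
    have : ⨆ φ, goodSpace L X φ ≤ goodSpace L X η ⊔ ⨆ (φ) (_ : φ ≠ η), goodSpace L X φ := by
      refine iSup_le fun φ => ?_
      by_cases hφ : φ = η
      · rw [hφ]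
        exact le_sup_left
      · exact (le_iSup₂_of_le (f := fun φ (_ : φ ≠ η) => goodSpace L X φ) φ hφ le_rfl).trans le_sup_right
    exact this (h ▸ Submodule.mem_top)
  exact Submodule.mem_sup.1 hx

/-- Once vectors with the right action of `K` span, the parts of other weights of an `H`-eigenvector
vanish by independence. -/
theorem goodSpace_eq_weightSpace (h : ⨆ η, goodSpace L X η = ⊤) (η : Weight) :
    goodSpace L X η = weightSpace L X η := by
  refine le_antisymm (goodSpace_le η) fun x hx => ?_
  obtain ⟨a, ha, b, hb, rfl⟩ := exists_add_of_iSup_goodSpace h η x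
  have hb' : b ∈ ⨆ (φ) (_ : φ ≠ η), weightSpace L X φ :=
    (iSup₂_mono fun φ _ => goodSpace_le φ) hb
  have hb'' : b ∈ weightSpace L X η := by
    have := Submodule.sub_mem _ hx (goodSpace_le η ha)
    rwa [add_sub_cancel_left] at this
  rw [Submodule.disjoint_def.1 (iSupIndep_weightSpace (L := L) (X := X) η) b hb'' hb', add_zero]
  exact ha

/-- A finite-dimensional module that is spanned by weight vectors, as an object of the category. -/
def FDWeightModule.mk' (X : Type) [AddCommGroup X] [Module ℂ X] [Module (U L) X]
    [IsScalarTower ℂ (U L) X] (hfin : Module.Finite ℂ X) (h : ⨆ η, goodSpace L X η = ⊤) :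
    FDWeightModule L where
  carrier := X
  finiteDimensional := hfin
  isInternal := by
    rw [DirectSum.isInternal_submodule_iff_iSupIndep_and_iSup_eq_top]
    refine ⟨iSupIndep_weightSpace, ?_⟩
    rw [← h]
    exact iSup_congr fun η => (goodSpace_eq_weightSpace h η).symm
  K_smul γ η v hv := by
    rw [← goodSpace_eq_weightSpace h] at hv
    exact UnrolledSl3.K_smul hv γ

theorem FDWeightModule.iSup_goodSpace (M : FDWeightModule L) :
    ⨆ η, goodSpace L M.carrier η = ⊤ := by
  have h := M.isInternal.submodule_iSup_eq_top
  rw [eq_top_iff, ← h]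
  exact iSup_mono fun η v hv => ⟨hv, fun γ => M.K_smul γ η v hv⟩

/-- Weight vectors lift to weight vectors. -/
theorem exists_goodSpace_lift (h : ⨆ η, goodSpace L X η = ⊤) (p : X →ₗ[U L] Y)
    (hp : Function.Surjective p) {η : Weight} {b : Y} (hb : b ∈ goodSpace L Y η) :
    ∃ a ∈ goodSpace L X η, p a = b := by
  obtain ⟨x, rfl⟩ := hp b
  obtain ⟨a, ha, c, hc, rfl⟩ := exists_add_of_iSup_goodSpace h η x
  refine ⟨a, ha, ?_⟩
  have h1 : p c ∈ goodSpace L Y η := by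
    have := Submodule.sub_mem _ hb (map_mem_goodSpace p ha)
    rwa [map_add, add_sub_cancel_left] at this
  have h2 : ∀ c ∈ ⨆ (φ) (_ : φ ≠ η), goodSpace L X φ,
      p c ∈ ⨆ (φ) (_ : φ ≠ η), goodSpace L Y φ := by
    intro c hc
    rw [iSup_subtype'] at hc
    induction hc using Submodule.iSup_induction' with
    | mem φ x hx =>
      exact Submodule.mem_iSup_of_mem φ.1 (Submodule.mem_iSup_of_mem φ.2 (map_mem_goodSpace p hx))
    | zero => simp
    | add a b _ _ ha hb => rw [map_add]; exact Submodule.add_mem _ ha hb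
  rw [map_add, Submodule.disjoint_def.1 (iSupIndep_goodSpace (L := L) (X := Y) η) _ h1 (h2 c hc),
    add_zero]

/-! ### The inverse of the antipode -/

open MulOpposite

/-- The values of the inverse of the antipode on the generators. -/
def antiGen (L : MidLattice) : Gen L → (U L)ᵐᵒᵖ
  | .E j => op ((-1 : ℂ) • (U.of L (.K (-L.root j)) * U.of L (.E j)))
  | .F j => op ((-1 : ℂ) • (U.of L (.F j) * U.of L (.K (L.root j))))
  | .H j => op ((-1 : ℂ) • U.of L (.H j))
  | .K γ => op (U.of L (.K (-γ)))

section

variable {L : MidLattice}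

theorem K_comm (γ δ : L.lat) : U.of L (.K γ) * U.of L (.K δ) = U.of L (.K δ) * U.of L (.K γ) := by
  rw [K_mul_K, K_mul_K, add_comm]

theorem E_mul_K (γ : L.lat) (j : Fin 2) :
    U.of L (.E j) * U.of L (.K γ) = iPow (-form γ (α j)) • (U.of L (.K γ) * U.of L (.E j)) := by
  rw [K_mul_E, smul_smul, iPow_neg_mul, one_smul]

theorem F_mul_K (γ : L.lat) (j : Fin 2) :
    U.of L (.F j) * U.of L (.K γ) = iPow (form γ (α j)) • (U.of L (.K γ) * U.of L (.F j)) := by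
  rw [K_mul_F, smul_smul, ← iPow_add, add_neg_cancel, iPow_zero, one_smul]

theorem form_neg_root (i j : Fin 2) : form ((-L.root i : L.lat) : Weight) (α j) = -(cartan i j : ℂ) := by
  rw [NegMemClass.coe_neg, form_neg_left, form_α_root]

theorem neg_one_smul_mul {R : Type*} [Semiring R] [Algebra ℂ R] (x y : R) :
    ((-1 : ℂ) • x) * ((-1 : ℂ) • y) = x * y := by
  rw [smul_mul_smul_comm, neg_mul_neg, one_mul, one_smul]

section Ring

variable {R : Type*} [Ring R] [Algebra ℂ R]

theorem anti_comm {e f g e' f' z : R} {c : ℂ} (h1 : f' * e' = c • (f * e * g))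
    (h2 : e' * f' = c • (e * f * g)) (h : e * f - f * e = z) :
    f' * e' - e' * f' = (-c) • (z * g) := by
  rw [h1, h2, ← h, sub_mul, ← smul_sub, neg_smul, ← smul_neg, neg_sub]

theorem anti_H_left {h k e : R} {c : ℂ} (hk : h * k = k * h) (he : h * e - e * h = c • e) :
    ((-1 : ℂ) • (k * e)) * ((-1 : ℂ) • h) - ((-1 : ℂ) • h) * ((-1 : ℂ) • (k * e)) =
      c • (-1 : ℂ) • (k * e) := by
  rw [neg_one_smul_mul, neg_one_smul_mul, ← mul_assoc h, hk, mul_assoc, mul_assoc, ← mul_sub,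
    ← neg_sub, he, mul_neg, mul_smul_comm, neg_smul, one_smul, smul_neg]

theorem anti_H_right {h k e : R} {c : ℂ} (hk : h * k = k * h) (he : h * e - e * h = c • e) :
    ((-1 : ℂ) • (e * k)) * ((-1 : ℂ) • h) - ((-1 : ℂ) • h) * ((-1 : ℂ) • (e * k)) =
      c • (-1 : ℂ) • (e * k) := by
  rw [neg_one_smul_mul, neg_one_smul_mul, mul_assoc, ← hk, ← mul_assoc, ← mul_assoc, ← sub_mul,
    ← neg_sub, he, neg_mul, smul_mul_assoc, neg_smul, one_smul, smul_neg]

theorem neg_one_mul_smul_sub (a : ℂ) (x y : R) : (-1 : ℂ) • a • (x - y) = a • (y - x) := by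
  rw [neg_smul, one_smul, ← smul_neg, neg_sub]

end Ring

/-- In the commutator and braid relations, collecting the factors `K` costs the same scalar on both
sides, because the Cartan matrix is symmetric with equal diagonal entries. What remains is the
original relation. -/
theorem antiGen_rel {x y : FreeAlgebra ℂ (Gen L)} (h : Rel L x y) :
    FreeAlgebra.lift ℂ (antiGen L) x = FreeAlgebra.lift ℂ (antiGen L) y := by
  have hEK (a b : Fin 2) : U.of L (.E a) * U.of L (.K (-L.root b)) =
      iPow (cartan b a) • (U.of L (.K (-L.root b)) * U.of L (.E a)) := by
    rw [E_mul_K, form_neg_root, neg_neg]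
  have hFK (a b : Fin 2) : U.of L (.F a) * U.of L (.K (L.root b)) =
      iPow (cartan b a) • (U.of L (.K (L.root b)) * U.of L (.F a)) := by
    rw [F_mul_K, form_α_root]
  have hEK' (a b : Fin 2) (x : U L) : U.of L (.E a) * (U.of L (.K (-L.root b)) * x) =
      iPow (cartan b a) • (U.of L (.K (-L.root b)) * (U.of L (.E a) * x)) := by
    rw [← mul_assoc, hEK, smul_mul_assoc, mul_assoc]
  have hFK' (a b : Fin 2) (x : U L) : U.of L (.F a) * (U.of L (.K (L.root b)) * x) =
      iPow (cartan b a) • (U.of L (.K (L.root b)) * (U.of L (.F a) * x)) := by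
    rw [← mul_assoc, hFK, smul_mul_assoc, mul_assoc]
  have hKK (x : U L) : U.of L (.K (-L.root 1)) * (U.of L (.K (-L.root 0)) * x) =
      U.of L (.K (-L.root 0)) * (U.of L (.K (-L.root 1)) * x) := by
    rw [← mul_assoc, K_comm, mul_assoc]
  have hKK' (x : U L) : U.of L (.K (L.root 1)) * (U.of L (.K (L.root 0)) * x) =
      U.of L (.K (L.root 0)) * (U.of L (.K (L.root 1)) * x) := by
    rw [← mul_assoc, K_comm, mul_assoc]
  apply unop_injective
  cases h with
  | K_zero => simp [antiGen, K_zero]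
  | K_add γ δ => simp [antiGen, K_mul_K]
  | K_E γ j =>
    simp only [gen, map_mul, map_smul, FreeAlgebra.lift_ι_apply, antiGen, unop_mul, unop_op,
      unop_smul, neg_neg, mul_smul_comm, smul_mul_assoc]
    rw [smul_comm, mul_assoc (U.of L (.K (-L.root j))), E_mul_K, mul_smul_comm, mul_smul_comm,
      ← mul_assoc (U.of L (.K (-L.root j))), K_comm (-L.root j), ← mul_assoc, ← mul_assoc,
      K_mul_neg, one_mul, NegMemClass.coe_neg, form_neg_left, neg_neg]
  | K_F γ j =>
    simp only [gen, map_mul, map_smul, FreeAlgebra.lift_ι_apply, antiGen, unop_mul, unop_op,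
      unop_smul, neg_neg, mul_smul_comm, smul_mul_assoc]
    rw [smul_comm, mul_assoc (U.of L (.F j)), K_comm, ← mul_assoc (U.of L (.F j)), F_mul_K,
      smul_mul_assoc, mul_smul_comm, mul_assoc, ← mul_assoc (U.of L (.K γ)),
      K_mul_neg, one_mul, NegMemClass.coe_neg, form_neg_left]
  | E_F j j' =>
    have h1 : ((-1 : ℂ) • (U.of L (.F j') * U.of L (.K (L.root j')))) *
        ((-1 : ℂ) • (U.of L (.K (-L.root j)) * U.of L (.E j))) =
        iPow (cartan j j' - cartan j j) • (U.of L (.F j') * U.of L (.E j) *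
          (U.of L (.K (-L.root j)) * U.of L (.K (L.root j')))) := by
      rw [neg_one_smul_mul, mul_assoc, ← mul_assoc (U.of L (.K (L.root j'))), K_mul_K, K_mul_E,
        mul_smul_comm, ← mul_assoc, AddSubgroup.coe_add, form_add_left, ← K_mul_K, K_comm,
        form_neg_root, form_α_root, cartan_symm j' j, sub_eq_add_neg]
    have h2 : ((-1 : ℂ) • (U.of L (.K (-L.root j)) * U.of L (.E j))) *
        ((-1 : ℂ) • (U.of L (.F j') * U.of L (.K (L.root j')))) =
        iPow (cartan j j' - cartan j j) • (U.of L (.E j) * U.of L (.F j') *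
          (U.of L (.K (-L.root j)) * U.of L (.K (L.root j')))) := by
      rw [neg_one_smul_mul, K_mul_E, smul_mul_assoc, mul_assoc,
        ← mul_assoc (U.of L (.K (-L.root j))), K_mul_F, smul_mul_assoc, mul_smul_comm, smul_smul,
        ← iPow_add, mul_assoc, mul_assoc, form_neg_root, form_neg_root, neg_neg, neg_add_eq_sub]
    have h3 := anti_comm (R := U L) h1 h2 (E_F_comm j j')
    simp only [gen, map_sub, map_mul, FreeAlgebra.lift_ι_apply, antiGen, unop_sub, unop_mul,
      unop_op, h3]
    split_ifs with hj
    · subst hj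
      simp only [map_sub, map_smul, FreeAlgebra.lift_ι_apply, antiGen, unop_sub, unop_smul, unop_op,
        neg_neg, K_neg_mul, mul_one, sub_self, iPow_zero, neg_one_mul_smul_sub]
    · simp
  | E_sq j =>
    simp only [gen, pow_two, map_mul, map_zero, FreeAlgebra.lift_ι_apply, antiGen, unop_mul,
      unop_op, mul_smul_comm, smul_mul_assoc, unop_zero, mul_assoc, hEK', E_mul_E, mul_zero,
      smul_zero]
  | F_sq j =>
    simp only [gen, pow_two, map_mul, map_zero, FreeAlgebra.lift_ι_apply, antiGen, unop_mul,
      unop_op, mul_smul_comm, smul_mul_assoc, unop_zero]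
    rw [mul_assoc, ← mul_assoc (U.of L (.K _)), K_mul_F, smul_mul_assoc, mul_smul_comm, mul_assoc,
      ← mul_assoc, F_mul_F, zero_mul, smul_zero, smul_zero, smul_zero]
  | E_braid =>
    have hb := E_braid (L := L)
    simp only [pow_two, mul_assoc] at hb
    simp only [gen, pow_two, map_mul, FreeAlgebra.lift_ι_apply, antiGen, unop_mul,
      unop_op, mul_smul_comm, smul_mul_assoc, mul_assoc, hEK', smul_smul, hKK, hb]
    rw [cartan_symm 1 0, show cartan 1 1 = cartan 0 0 from rfl]
  | F_braid =>
    have hb := F_braid (L := L)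
    simp only [pow_two, mul_assoc] at hb
    simp only [gen, pow_two, map_mul, FreeAlgebra.lift_ι_apply, antiGen, unop_mul,
      unop_op, mul_smul_comm, smul_mul_assoc, mul_assoc, hFK', hFK, smul_smul, hKK', hb]
    rw [cartan_symm 1 0, show cartan 1 1 = cartan 0 0 from rfl]
  | H_E j j' =>
    simp only [gen, map_sub, map_mul, map_smul, FreeAlgebra.lift_ι_apply, antiGen, unop_sub,
      unop_mul, unop_op, unop_smul]
    exact anti_H_left (H_mul_K j _) (H_E_comm j j')
  | H_F j j' =>
    simp only [gen, map_sub, map_mul, map_smul, FreeAlgebra.lift_ι_apply, antiGen, unop_sub,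
      unop_mul, unop_op, unop_smul]
    exact anti_H_right (H_mul_K j _) (H_F_comm j j')
  | H_H j j' =>
    simp only [gen, map_mul, FreeAlgebra.lift_ι_apply, antiGen, unop_mul, unop_op, mul_smul_comm,
      smul_mul_assoc, H_mul_H j j']
  | H_K j γ =>
    simp only [gen, map_mul, FreeAlgebra.lift_ι_apply, antiGen, unop_mul, unop_op, mul_smul_comm,
      smul_mul_assoc, H_mul_K]

end

open MulOpposite

/-- The inverse of the antipode. -/
def antipodeInv (L : MidLattice) : U L →ₐ[ℂ] (U L)ᵐᵒᵖ :=
  RingQuot.liftAlgHom ℂ ⟨FreeAlgebra.lift ℂ (antiGen L), fun _ _ h => antiGen_rel h⟩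

theorem antipodeInv_of (L : MidLattice) (g : Gen L) : antipodeInv L (U.of L g) = antiGen L g := by
  simp [antipodeInv, U.of]

/-! ### The module of linear maps -/

section

variable (L : MidLattice) (V A : Type*) [AddCommGroup V] [Module ℂ V] [Module (U L) V]
  [IsScalarTower ℂ (U L) V] [AddCommGroup A] [Module ℂ A]

/-- The action of the quantum group on linear maps through their arguments. -/
def precomp : U L →ₐ[ℂ] Module.End ℂ (V →ₗ[ℂ] A) where
  toFun u := LinearMap.lcomp ℂ A (Algebra.lsmul ℂ ℂ V (unop (antipodeInv L u)))
  map_one' := by ext φ v; simp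
  map_mul' u u' := by ext φ v; simp
  map_zero' := by ext φ v; simp
  map_add' u u' := by ext φ v; simp
  commutes' c := by ext φ v; simp

theorem precomp_apply (u : U L) (φ : V →ₗ[ℂ] A) (v : V) :
    precomp L V A u φ v = φ (unop (antipodeInv L u) • v) := rfl

variable [Module (U L) A] [IsScalarTower ℂ (U L) A]

/-- The action of the quantum group on linear maps through their values. -/
def postcomp : U L →ₐ[ℂ] Module.End ℂ (V →ₗ[ℂ] A) where
  toFun u := LinearMap.llcomp ℂ V A A (Algebra.lsmul ℂ ℂ A u)
  map_one' := by ext φ v; simp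
  map_mul' u u' := by ext φ v; simp
  map_zero' := by ext φ v; simp
  map_add' u u' := by ext φ v; simp
  commutes' c := by ext φ v; simp

theorem postcomp_apply (u : U L) (φ : V →ₗ[ℂ] A) (v : V) :
    postcomp L V A u φ v = u • φ v := rfl

/-- The action of the quantum group on linear maps. -/
def homAct : U L →ₐ[ℂ] Module.End ℂ (V →ₗ[ℂ] A) :=
  -- In Sweedler notation `(u φ) v = ∑ u₂ φ (S⁻¹(u₁) v)`. The inverse of the antipode appears
  -- because `V` is the left tensor factor: linearity of currying needs `∑ u₂ S⁻¹(u₁) = ε(u)`.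
  (Algebra.TensorProduct.lift (precomp L V A) (postcomp L V A) (fun _ _ => by
    rw [commute_iff_eq]; rfl)).comp (comul L)

/-- The linear maps `V → A`, as a module over the quantum group through `homAct`. -/
def HomMod (_ : MidLattice) (V A : Type*) [AddCommGroup V] [Module ℂ V] [AddCommGroup A]
    [Module ℂ A] : Type _ :=
  V →ₗ[ℂ] A

instance : AddCommGroup (HomMod L V A) := inferInstanceAs (AddCommGroup (V →ₗ[ℂ] A))

instance : Module ℂ (HomMod L V A) := inferInstanceAs (Module ℂ (V →ₗ[ℂ] A))

instance : Module (U L) (HomMod L V A) :=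
  letI : Module (Module.End ℂ (V →ₗ[ℂ] A)) (HomMod L V A) :=
    inferInstanceAs (Module (Module.End ℂ (V →ₗ[ℂ] A)) (V →ₗ[ℂ] A))
  Module.compHom (HomMod L V A) (homAct L V A).toRingHom

theorem homMod_smul_def (u : U L) (φ : HomMod L V A) : u • φ = homAct L V A u φ := rfl

instance : IsScalarTower ℂ (U L) (HomMod L V A) where
  smul_assoc c u x := by
    rw [homMod_smul_def, homMod_smul_def, map_smul]
    rfl

variable {L V A}

/-- The underlying linear map. -/
def HomMod.ap : HomMod L V A →ₗ[ℂ] V →ₗ[ℂ] A := LinearMap.id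

/-- A linear map, as an element of the module of linear maps. -/
def HomMod.mk : (V →ₗ[ℂ] A) →ₗ[ℂ] HomMod L V A := LinearMap.id

theorem HomMod.ext {φ ψ : HomMod L V A} (h : ∀ v, φ.ap v = ψ.ap v) : φ = ψ :=
  LinearMap.ext h

theorem homAct_E (j : Fin 2) (φ : V →ₗ[ℂ] A) (v : V) :
    homAct L V A (U.of L (.E j)) φ v = U.of L (.E j) • φ v -
      U.of L (.K (L.root j)) • φ (U.of L (.K (-L.root j)) • U.of L (.E j) • v) := by
  simp only [homAct, AlgHom.comp_apply, comul_of, comulGen, map_add, Algebra.TensorProduct.lift_tmul,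
    map_one, one_mul, LinearMap.add_apply, Module.End.mul_apply, precomp_apply, antipodeInv_of,
    antiGen, unop_op, postcomp_apply, smul_assoc, mul_smul, neg_smul, one_smul]
  rw [map_neg, smul_neg, neg_add_eq_sub]

theorem HomMod.ap_E (j : Fin 2) (φ : HomMod L V A) (v : V) :
    (U.of L (.E j) • φ).ap v = U.of L (.E j) • φ.ap v -
      U.of L (.K (L.root j)) • φ.ap (U.of L (.K (-L.root j)) • U.of L (.E j) • v) :=
  homAct_E j _ _

theorem homAct_F (j : Fin 2) (φ : V →ₗ[ℂ] A) (v : V) :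
    homAct L V A (U.of L (.F j)) φ v = U.of L (.F j) • φ (U.of L (.K (L.root j)) • v) -
      φ (U.of L (.F j) • U.of L (.K (L.root j)) • v) := by
  simp only [homAct, AlgHom.comp_apply, comul_of, comulGen, map_add, Algebra.TensorProduct.lift_tmul,
    map_one, mul_one, LinearMap.add_apply, Module.End.mul_apply, precomp_apply, antipodeInv_of,
    antiGen, unop_op, postcomp_apply, smul_assoc, mul_smul, neg_smul, one_smul, neg_neg]
  rw [map_neg, neg_add_eq_sub]

theorem HomMod.ap_F (j : Fin 2) (φ : HomMod L V A) (v : V) :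
    (U.of L (.F j) • φ).ap v = U.of L (.F j) • φ.ap (U.of L (.K (L.root j)) • v) -
      φ.ap (U.of L (.F j) • U.of L (.K (L.root j)) • v) :=
  homAct_F j _ _

theorem homAct_H (j : Fin 2) (φ : V →ₗ[ℂ] A) (v : V) :
    homAct L V A (U.of L (.H j)) φ v = U.of L (.H j) • φ v - φ (U.of L (.H j) • v) := by
  simp only [homAct, AlgHom.comp_apply, comul_of, comulGen, map_add, Algebra.TensorProduct.lift_tmul,
    map_one, mul_one, one_mul, LinearMap.add_apply, precomp_apply, antipodeInv_of,
    antiGen, unop_op, postcomp_apply, smul_assoc, neg_smul, one_smul]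
  rw [map_neg, ← sub_eq_add_neg]

theorem HomMod.ap_H (j : Fin 2) (φ : HomMod L V A) (v : V) :
    (U.of L (.H j) • φ).ap v = U.of L (.H j) • φ.ap v - φ.ap (U.of L (.H j) • v) :=
  homAct_H j _ _

theorem homAct_K (γ : L.lat) (φ : V →ₗ[ℂ] A) (v : V) :
    homAct L V A (U.of L (.K γ)) φ v = U.of L (.K γ) • φ (U.of L (.K (-γ)) • v) := by
  simp only [homAct, AlgHom.comp_apply, comul_of, comulGen, Algebra.TensorProduct.lift_tmul,
    Module.End.mul_apply, precomp_apply, antipodeInv_of, antiGen, unop_op, postcomp_apply]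

theorem HomMod.ap_K (γ : L.lat) (φ : HomMod L V A) (v : V) :
    (U.of L (.K γ) • φ).ap v = U.of L (.K γ) • φ.ap (U.of L (.K (-γ)) • v) :=
  homAct_K γ _ _

end

/-! ### Tensor products -/

section

variable {L : MidLattice} {V W : Type*} [AddCommGroup V] [Module ℂ V] [Module (U L) V]
    [IsScalarTower ℂ (U L) V] [AddCommGroup W] [Module ℂ W] [Module (U L) W]
    [IsScalarTower ℂ (U L) W]

variable (L V W) in
/-- The pure tensors. -/
def tmk : V →ₗ[ℂ] W →ₗ[ℂ] Tensor L V W := TensorProduct.mk ℂ V W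

theorem tmk_E (j : Fin 2) (v : V) (x : W) : U.of L (.E j) • tmk L V W v x =
    tmk L V W (U.of L (.E j) • v) (U.of L (.K (L.root j)) • x) +
      tmk L V W v (U.of L (.E j) • x) := by
  rw [tensor_smul_def, tensorAct, AlgHom.comp_apply, AlgHom.comp_apply, comul_of, comulGen]
  simp only [map_add, Algebra.TensorProduct.map_tmul, map_one]
  rfl

theorem tmk_F (j : Fin 2) (v : V) (x : W) : U.of L (.F j) • tmk L V W v x =
    tmk L V W (U.of L (.F j) • v) x +
      tmk L V W (U.of L (.K (-L.root j)) • v) (U.of L (.F j) • x) := by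
  rw [tensor_smul_def, tensorAct, AlgHom.comp_apply, AlgHom.comp_apply, comul_of, comulGen]
  simp only [map_add, Algebra.TensorProduct.map_tmul, map_one]
  rfl

theorem tmk_H (j : Fin 2) (v : V) (x : W) : U.of L (.H j) • tmk L V W v x =
    tmk L V W v (U.of L (.H j) • x) + tmk L V W (U.of L (.H j) • v) x := by
  rw [tensor_smul_def, tensorAct, AlgHom.comp_apply, AlgHom.comp_apply, comul_of, comulGen]
  simp only [map_add, Algebra.TensorProduct.map_tmul, map_one]
  rfl

theorem tmk_K (γ : L.lat) (v : V) (x : W) : U.of L (.K γ) • tmk L V W v x =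
    tmk L V W (U.of L (.K γ) • v) (U.of L (.K γ) • x) := by
  rw [tensor_smul_def, tensorAct, AlgHom.comp_apply, AlgHom.comp_apply, comul_of, comulGen]
  simp only [Algebra.TensorProduct.map_tmul]
  rfl

theorem tmk_mem_goodSpace {η θ : Weight} {v : V} {x : W} (hv : v ∈ goodSpace L V η)
    (hx : x ∈ goodSpace L W θ) : tmk L V W v x ∈ goodSpace L (Tensor L V W) (η + θ) := by
  refine ⟨fun j => ?_, fun γ => ?_⟩
  · rw [tmk_H, H_smul hv, H_smul hx, map_smul, map_smul, LinearMap.smul_apply, Pi.add_apply,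
      add_smul, add_comm]
  · rw [tmk_K, K_smul hv, K_smul hx, map_smul, map_smul, LinearMap.smul_apply, form_add_right,
      iPow_add, mul_smul, smul_comm]

variable (L) in
/-- The linear map on a tensor product that is induced by a bilinear map. -/
def tensorLift {B : Type*} [AddCommGroup B] [Module ℂ B] (g : V →ₗ[ℂ] W →ₗ[ℂ] B) :
    Tensor L V W →ₗ[ℂ] B :=
  TensorProduct.lift g

theorem tensorLift_tmk {B : Type*} [AddCommGroup B] [Module ℂ B] (g : V →ₗ[ℂ] W →ₗ[ℂ] B) (v : V)
    (x : W) : tensorLift L g (tmk L V W v x) = g v x :=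
  TensorProduct.lift.tmul v x

/-- Linear maps on a tensor product agree if they agree on pure tensors. -/
theorem tensor_induction {p : Tensor L V W → Prop} (h0 : p 0) (h1 : ∀ v x, p (tmk L V W v x))
    (h2 : ∀ a b, p a → p b → p (a + b)) (a : Tensor L V W) : p a :=
  TensorProduct.induction_on a h0 h1 h2

theorem K_neg_smul (γ : L.lat) (v : V) : U.of L (.K (-γ)) • U.of L (.K γ) • v = v := by
  rw [← mul_smul, K_neg_mul, one_smul]

theorem K_smul_neg (γ : L.lat) (v : V) : U.of L (.K γ) • U.of L (.K (-γ)) • v = v := by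
  rw [← mul_smul, K_mul_neg, one_smul]

variable {A : Type*} [AddCommGroup A] [Module ℂ A] [Module (U L) A] [IsScalarTower ℂ (U L) A]

/-- A linear map commutes with complex scalars. -/
theorem map_complex_smul (f : V →ₗ[U L] W) (c : ℂ) (x : V) : f (c • x) = c • f x := by
  rw [← algebraMap_smul (U L) c x, map_smul, algebraMap_smul]

/-- A linear map over the quantum group, as a complex linear map. -/
def toComplex (f : V →ₗ[U L] W) : V →ₗ[ℂ] W where
  toFun := f
  map_add' := map_add f
  map_smul' := map_complex_smul f

/-- Currying of the maps on a tensor product. -/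
def curry (f : Tensor L V W →ₗ[U L] A) : W →ₗ[U L] HomMod L V A :=
  U.linearMap (X := W) (Y := HomMod L V A)
    (HomMod.mk ∘ₗ (tmk L V W).flip.compr₂ (toComplex f)) <| by
    have hap (x : W) (v : V) : HomMod.ap ((HomMod.mk (L := L) ∘ₗ (tmk L V W).flip.compr₂ (toComplex f)) x) v =
        f (tmk L V W v x) := rfl
    intro g x
    refine HomMod.ext fun v => ?_
    rw [hap]
    cases g with
    | E j =>
      rw [HomMod.ap_E, hap, hap, ← LinearMap.map_smul f, ← LinearMap.map_smul f, ← LinearMap.map_sub f, tmk_E, tmk_K, K_smul_neg,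
        add_sub_cancel_left]
    | F j =>
      rw [HomMod.ap_F, hap, hap, ← LinearMap.map_smul f, ← LinearMap.map_sub f, tmk_F, K_neg_smul, add_sub_cancel_left]
    | H j =>
      rw [HomMod.ap_H, hap, hap, ← LinearMap.map_smul f, ← LinearMap.map_sub f, tmk_H, add_sub_cancel_right]
    | K γ =>
      rw [HomMod.ap_K, hap, ← LinearMap.map_smul f, tmk_K, K_smul_neg]

theorem curry_ap (f : Tensor L V W →ₗ[U L] A) (x : W) (v : V) :
    (curry f x).ap v = f (tmk L V W v x) := rfl

/-- Uncurrying of the maps on a tensor product. -/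
def uncurry (f : W →ₗ[U L] HomMod L V A) : Tensor L V W →ₗ[U L] A :=
  U.linearMap (X := Tensor L V W) (Y := A)
    (tensorLift L (HomMod.ap ∘ₗ toComplex f).flip) <| by
    have hap (v : V) (x : W) : tensorLift L (HomMod.ap ∘ₗ toComplex f).flip
        (tmk L V W v x) = (f x).ap v := tensorLift_tmk _ v x
    intro g a
    induction a using tensor_induction with
    | h0 => simp
    | h1 v x =>
      cases g with
      | E j =>
        rw [tmk_E, map_add, hap, hap, hap, LinearMap.map_smul f, LinearMap.map_smul f, HomMod.ap_E, HomMod.ap_K,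
          add_sub_cancel]
      | F j =>
        rw [tmk_F, map_add, hap, hap, hap, LinearMap.map_smul f, HomMod.ap_F, K_smul_neg, add_sub_cancel]
      | H j =>
        rw [tmk_H, map_add, hap, hap, hap, LinearMap.map_smul f, HomMod.ap_H, sub_add_cancel]
      | K γ =>
        rw [tmk_K, hap, hap, LinearMap.map_smul f, HomMod.ap_K, K_neg_smul]
    | h2 a b ha hb => rw [smul_add, map_add, map_add, smul_add, ha, hb]

theorem uncurry_tmk (f : W →ₗ[U L] HomMod L V A) (v : V) (x : W) :
    uncurry f (tmk L V W v x) = (f x).ap v :=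
  tensorLift_tmk (L := L) _ v x

/-- Functoriality of the module of linear maps. -/
def HomMod.push {B : Type*} [AddCommGroup B] [Module ℂ B] [Module (U L) B] [IsScalarTower ℂ (U L) B]
    (p : A →ₗ[U L] B) : HomMod L V A →ₗ[U L] HomMod L V B :=
  U.linearMap (X := HomMod L V A) (Y := HomMod L V B)
    (HomMod.mk ∘ₗ LinearMap.llcomp ℂ V A B (toComplex p) ∘ₗ HomMod.ap) <| by
    have hap (φ : HomMod L V A) (v : V) :
        HomMod.ap ((HomMod.mk (L := L) ∘ₗ
          LinearMap.llcomp ℂ V A B (toComplex p) ∘ₗ HomMod.ap) φ) v = p (φ.ap v) := rfl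
    intro g φ
    refine HomMod.ext fun v => ?_
    rw [hap]
    cases g with
    | E j => rw [HomMod.ap_E, HomMod.ap_E, hap, hap, LinearMap.map_sub p, LinearMap.map_smul p, LinearMap.map_smul p]
    | F j => rw [HomMod.ap_F, HomMod.ap_F, hap, hap, LinearMap.map_sub p, LinearMap.map_smul p]
    | H j => rw [HomMod.ap_H, HomMod.ap_H, hap, hap, LinearMap.map_sub p, LinearMap.map_smul p]
    | K γ => rw [HomMod.ap_K, HomMod.ap_K, hap, LinearMap.map_smul p]

theorem HomMod.push_ap {B : Type*} [AddCommGroup B] [Module ℂ B] [Module (U L) B]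
    [IsScalarTower ℂ (U L) B] (p : A →ₗ[U L] B) (φ : HomMod L V A) (v : V) :
    (HomMod.push p φ).ap v = p (φ.ap v) := rfl

/-- The tensors with the generator of the second factor generate the tensor product. -/
theorem span_tmk_irrGen (y : Weight) : Submodule.span (U L)
    (Set.range fun v : V => tmk L V (Irr L y) v (irrGen L y)) = ⊤ := by
  set N := Submodule.span (U L) (Set.range fun v : V => tmk L V (Irr L y) v (irrGen L y)) with hN
  have h0 : ∀ v, tmk L V (Irr L y) v (irrGen L y) ∈ N := fun v => Submodule.subset_span ⟨v, rfl⟩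
  have hF (x : Irr L y) (hx : ∀ v, tmk L V (Irr L y) v x ∈ N) (j : Fin 2) (v : V) :
      tmk L V (Irr L y) v (U.of L (.F j) • x) ∈ N := by
    -- Replacing `v` by `K v` cancels the `K⁻¹` that the coproduct of `F j` puts on the left factor,
    -- so the relation can be solved for `v ⊗ F j x`.
    have h := tmk_F (L := L) j (U.of L (.K (L.root j)) • v) x
    rw [K_neg_smul, ← sub_eq_iff_eq_add'] at h
    rw [← h]
    exact N.sub_mem (N.smul_mem _ (hx _)) (hx _)
  have hw (w : Fin 8) (v : V) : tmk L V (Irr L y) v (word L 0 1 w • irrGen L y) ∈ N := by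
    have h1 (a) := hF _ h0 a
    have h2 (a b) := hF _ (h1 a) b
    have h3 (a b c) := hF _ (h2 a b) c
    have h4 (a b c d) := hF _ (h3 a b c) d
    fin_cases w <;> simp only [word, Fin.reduceFinMk, Matrix.cons_val, mul_smul, one_smul,
      Fin.zero_eta, Fin.isValue, Fin.mk_one]
    · exact h0 v
    · exact h1 _ v
    · exact h1 _ v
    · exact h2 _ _ v
    · exact h2 _ _ v
    · exact h3 _ _ _ v
    · exact h3 _ _ _ v
    · exact h4 _ _ _ _ v
  rw [eq_top_iff]
  intro a _
  induction a using tensor_induction with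
  | h0 => exact N.zero_mem
  | h1 v x =>
    obtain ⟨c, rfl⟩ := ((isMax_irrGen (L := L) y).mem_span_iff (i := 0) (j := 1) (by decide) x).1
      (by rw [span_irrGen]; exact Submodule.mem_top)
    rw [map_sum]
    refine N.sum_mem fun w _ => ?_
    rw [map_smul]
    exact N.smul_of_tower_mem _ (hw w v)
  | h2 a b ha hb => exact N.add_mem (ha trivial) (hb trivial)

/-- Typical maximal vectors lift to maximal vectors. -/
theorem IsMax.exists_lift {i j : Fin 2} (hij : i ≠ j) {y : Weight} (hy : typ i j y ≠ 0)
    (p : V →ₗ[U L] W) {a : V} (ha : a ∈ goodSpace L V y) (hb : IsMax L y (p a)) :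
    ∃ a' : V, IsMax L y a' ∧ p a' = p a := by
  -- On `p a`, which is maximal, `eTop * fTop` is the scalar `typ i j y`. Division by it makes `a`
  -- maximal and leaves its image unchanged.
  have h := isMax_eTop_fTop hij ha
  refine ⟨(typ i j y)⁻¹ • eTop L i j • fTop L i j • a, ⟨Submodule.smul_mem _ _ h.mem, fun k => ?_⟩,
    ?_⟩
  · rw [U.commutes, h.E_smul, smul_zero]
  · rw [map_complex_smul, map_smul, map_smul, hb.eTop_fTop hij, smul_smul, inv_mul_cancel₀ hy,
      one_smul]

/-- The tensor product with a typical irreducible module is projective. -/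
theorem exists_tensor_lift {i j : Fin 2} (hij : i ≠ j) {y : Weight} (hy : typ i j y ≠ 0)
    {ι : Type*} (b : Module.Basis ι ℂ V) (θ : ι → Weight) (hb : ∀ k, b k ∈ goodSpace L V (θ k))
    {B : Type*} [AddCommGroup B] [Module ℂ B] [Module (U L) B] [IsScalarTower ℂ (U L) B]
    (hA : ⨆ η, goodSpace L A η = ⊤) (p : A →ₗ[U L] B) (hp : Function.Surjective p)
    (f : Tensor L V (Irr L y) →ₗ[U L] B) :
    ∃ g : Tensor L V (Irr L y) →ₗ[U L] A, p ∘ₗ g = f := by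
  have hmax : IsMax L y (curry f (irrGen L y)) := (isMax_irrGen y).map _
  -- The curried map corresponds to a maximal vector of `Hom(V, B)`. It is first lifted to `φ` of
  -- the same weight in `Hom(V, A)` by lifting its values on a weight basis, so `Hom(V, A)` need not
  -- itself be a weight module.
  choose a ha ha' using fun k => exists_goodSpace_lift hA p hp
    (map_mem_goodSpace f (tmk_mem_goodSpace (hb k) (isMax_irrGen y).mem))
  let φ : HomMod L V A := HomMod.mk (b.constr ℂ a)
  have hφ (k : ι) : φ.ap (b k) = a k := b.constr_basis ℂ a k
  have hext (ψ χ : HomMod L V A) (h : ∀ k, ψ.ap (b k) = χ.ap (b k)) : ψ = χ := b.ext h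
  have hφy : φ ∈ goodSpace L (HomMod L V A) y := by
    refine ⟨fun j => hext _ _ fun k => ?_, fun γ => hext _ _ fun k => ?_⟩
    · rw [HomMod.ap_H, H_smul (hb k), map_smul, map_smul, LinearMap.smul_apply, hφ,
        H_smul (ha k), ← sub_smul, Pi.add_apply, add_sub_cancel_left]
    · rw [HomMod.ap_K, K_smul (hb k), map_smul, map_smul, LinearMap.smul_apply, hφ, U.commutes,
        K_smul (ha k), smul_smul, ← iPow_add, NegMemClass.coe_neg, form_neg_left, form_add_right,
        neg_add_cancel_left]
  have hpφ : HomMod.push p φ = curry f (irrGen L y) := by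
    refine b.ext (f₁ := (HomMod.push p φ).ap) (f₂ := (curry f (irrGen L y)).ap) fun k => ?_
    rw [HomMod.push_ap, curry_ap, hφ, ha']
  -- So far `φ` only has the right weight; typicality of `y` makes it maximal over the same image.
  obtain ⟨ψ, hψ, hψ'⟩ := IsMax.exists_lift hij hy (HomMod.push p) hφy (hpφ ▸ hmax)
  obtain ⟨F, hF⟩ := hψ.exists_irr_lift hij hy
  refine ⟨uncurry F, LinearMap.ext_on (span_tmk_irrGen y) ?_⟩
  rintro _ ⟨v, rfl⟩
  rw [LinearMap.comp_apply, uncurry_tmk, hF, ← HomMod.push_ap, hψ', hpφ, curry_ap]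

/-- Typical irreducible modules are projective. -/
theorem exists_irr_lift_of_surjective {i j : Fin 2} (hij : i ≠ j) {y : Weight} (hy : typ i j y ≠ 0)
    (hA : ⨆ η, goodSpace L A η = ⊤) (p : A →ₗ[U L] V) (hp : Function.Surjective p)
    (f : Irr L y →ₗ[U L] V) : ∃ g : Irr L y →ₗ[U L] A, p ∘ₗ g = f := by
  have hmax : IsMax L y (f (irrGen L y)) := (isMax_irrGen y).map _
  obtain ⟨a, ha, ha'⟩ := exists_goodSpace_lift hA p hp hmax.mem
  obtain ⟨a', h1, h2⟩ := IsMax.exists_lift hij hy p ha (ha' ▸ hmax)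
  obtain ⟨g, hg⟩ := h1.exists_irr_lift hij hy
  refine ⟨g, LinearMap.ext_on (span_irrGen y) ?_⟩
  rintro _ rfl
  rw [LinearMap.comp_apply, hg, h2, ha']

end

/-! ### The contragredient dual -/

open MulOpposite

/-- The values on the generators of the anti-automorphism that exchanges the `E j` and the `F j`. -/
def transposeGen (L : MidLattice) : Gen L → (U L)ᵐᵒᵖ
  | .E j => op (U.of L (.F j))
  | .F j => op (U.of L (.E j))
  | .H j => op (U.of L (.H j))
  | .K γ => op (U.of L (.K γ))

section

variable {L : MidLattice}

theorem sub_swap {R : Type*} [Ring R] [Algebra ℂ R] {a b x : R} {c : ℂ}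
    (h : a * b - b * a = c • x) : b * a - a * b = -c • x := by
  rw [neg_smul, ← h, neg_sub]

theorem transposeGen_rel {x y : FreeAlgebra ℂ (Gen L)} (h : Rel L x y) :
    FreeAlgebra.lift ℂ (transposeGen L) x = FreeAlgebra.lift ℂ (transposeGen L) y := by
  apply unop_injective
  cases h with
  | K_zero => simp [transposeGen, K_zero]
  | K_add γ δ => simp [transposeGen, K_mul_K, add_comm]
  | K_E γ j =>
    simp only [gen, map_mul, map_smul, FreeAlgebra.lift_ι_apply, transposeGen, unop_mul, unop_op,
      unop_smul]
    have h := K_conj_F (-γ) j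
    rwa [neg_neg, NegMemClass.coe_neg, form_neg_left, neg_neg, mul_assoc] at h
  | K_F γ j =>
    simp only [gen, map_mul, map_smul, FreeAlgebra.lift_ι_apply, transposeGen, unop_mul, unop_op,
      unop_smul]
    have h := K_conj_E (-γ) j
    rwa [neg_neg, NegMemClass.coe_neg, form_neg_left, mul_assoc] at h
  | E_F j j' =>
    have h := E_F_comm (L := L) j' j
    simp only [gen, map_mul, map_sub, FreeAlgebra.lift_ι_apply, transposeGen, unop_mul, unop_op,
      unop_sub]
    rw [h]
    by_cases hj : j = j'
    · subst hj
      simp only [if_true, map_sub, map_smul, FreeAlgebra.lift_ι_apply, transposeGen, unop_sub,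
        unop_smul, unop_op]
    · simp [hj, Ne.symm hj]
  | E_sq j => simp [transposeGen, pow_two, F_mul_F]
  | F_sq j => simp [transposeGen, pow_two, E_mul_E]
  | E_braid => simpa [transposeGen, pow_two, mul_assoc] using (F_braid (L := L)).symm
  | F_braid => simpa [transposeGen, pow_two, mul_assoc] using (E_braid (L := L)).symm
  | H_E j j' =>
    simp only [gen, map_sub, map_mul, map_smul, FreeAlgebra.lift_ι_apply, transposeGen, unop_sub,
      unop_mul, unop_smul, unop_op, sub_swap (R := U L) (H_F_comm j j'), neg_neg]
  | H_F j j' =>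
    simp only [gen, map_sub, map_mul, map_smul, FreeAlgebra.lift_ι_apply, transposeGen, unop_sub,
      unop_mul, unop_smul, unop_op, sub_swap (R := U L) (H_E_comm j j')]
  | H_H j j' => simp [transposeGen, H_mul_H j' j]
  | H_K j γ => simp [transposeGen, H_mul_K]

variable (L) in
/-- The anti-automorphism that exchanges the `E j` and the `F j`. -/
def transpose : U L →ₐ[ℂ] (U L)ᵐᵒᵖ :=
  RingQuot.liftAlgHom ℂ ⟨FreeAlgebra.lift ℂ (transposeGen L), fun _ _ h => transposeGen_rel h⟩

theorem transpose_of (g : Gen L) : transpose L (U.of L g) = transposeGen L g := by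
  simp [transpose, U.of]

variable (X : Type*) [AddCommGroup X] [Module ℂ X] [Module (U L) X]
  [IsScalarTower ℂ (U L) X]

variable (L) in
/-- The action of the quantum group on functionals, through the transpose. -/
def dualAct : U L →ₐ[ℂ] Module.End ℂ (X →ₗ[ℂ] ℂ) where
  toFun u := LinearMap.lcomp ℂ ℂ (Algebra.lsmul ℂ ℂ X (unop (transpose L u)))
  map_one' := by ext φ v; simp
  map_mul' u u' := by ext φ v; simp
  map_zero' := by ext φ v; simp
  map_add' u u' := by ext φ v; simp
  commutes' c := by ext φ v; simp

/-- The functionals on `X`, as a module over the quantum group through `dualAct`. -/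
def DualMod (_ : MidLattice) (X : Type*) [AddCommGroup X] [Module ℂ X] : Type _ :=
  X →ₗ[ℂ] ℂ

instance : AddCommGroup (DualMod L X) := inferInstanceAs (AddCommGroup (X →ₗ[ℂ] ℂ))

instance : Module ℂ (DualMod L X) := inferInstanceAs (Module ℂ (X →ₗ[ℂ] ℂ))

instance : Module (U L) (DualMod L X) :=
  letI : Module (Module.End ℂ (X →ₗ[ℂ] ℂ)) (DualMod L X) :=
    inferInstanceAs (Module (Module.End ℂ (X →ₗ[ℂ] ℂ)) (X →ₗ[ℂ] ℂ))
  Module.compHom (DualMod L X) (dualAct L X).toRingHom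

theorem dualMod_smul_def (u : U L) (φ : DualMod L X) : u • φ = dualAct L X u φ := rfl

instance : IsScalarTower ℂ (U L) (DualMod L X) where
  smul_assoc c u x := by
    rw [dualMod_smul_def, dualMod_smul_def, map_smul]
    rfl

variable {X}

/-- The underlying functional. -/
def DualMod.ap : DualMod L X →ₗ[ℂ] X →ₗ[ℂ] ℂ := LinearMap.id

theorem DualMod.ext {φ ψ : DualMod L X} (h : ∀ x, φ.ap x = ψ.ap x) : φ = ψ :=
  LinearMap.ext h

theorem DualMod.ap_smul (u : U L) (φ : DualMod L X) (x : X) :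
    (u • φ).ap x = φ.ap (unop (transpose L u) • x) := rfl

theorem DualMod.ap_of (g : Gen L) (φ : DualMod L X) (x : X) :
    (U.of L g • φ).ap x = φ.ap (unop (transposeGen L g) • x) := by
  rw [DualMod.ap_smul, transpose_of]

theorem DualMod.ap_smul_of (g : Gen L) (φ : DualMod L X) (x : X) :
    φ.ap (U.of L g • x) = (unop (transposeGen L g) • φ).ap x := by
  cases g with
  | E j => exact (DualMod.ap_of (.F j) φ x).symm
  | F j => exact (DualMod.ap_of (.E j) φ x).symm
  | H j => exact (DualMod.ap_of (.H j) φ x).symm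
  | K γ => exact (DualMod.ap_of (.K γ) φ x).symm

theorem DualMod.ap_fTop (i j : Fin 2) (φ : DualMod L X) (x : X) :
    (fTop L i j • φ).ap x = φ.ap (eTop L i j • x) := by
  simp only [fTop, eTop, mul_smul, DualMod.ap_of, transposeGen, unop_op]

theorem DualMod.ap_eTop (i j : Fin 2) (φ : DualMod L X) (x : X) :
    (eTop L i j • φ).ap x = φ.ap (fTop L i j • x) := by
  simp only [fTop, eTop, mul_smul, DualMod.ap_of, transposeGen, unop_op]

/-- A functional that vanishes on the vectors of weight other than `y` has weight `y`. -/
theorem DualMod.mem_goodSpace (h : ⨆ η, goodSpace L X η = ⊤) {y : Weight} (φ : DualMod L X)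
    (hφ : ∀ η ≠ y, ∀ x ∈ goodSpace L X η, φ.ap x = 0) : φ ∈ goodSpace L (DualMod L X) y := by
  have key (u : U L) (c : Weight → ℂ) (hu : ∀ η, ∀ x ∈ goodSpace L X η, u • x = c η • x) (x : X) :
      φ.ap (u • x) = c y • φ.ap x := by
    have hx : x ∈ ⨆ η, goodSpace L X η := h ▸ Submodule.mem_top
    induction hx using Submodule.iSup_induction' with
    | mem η x hx =>
      rw [hu η x hx, map_smul]
      by_cases hη : η = y
      · rw [hη]
      · rw [hφ η hη x hx, smul_zero, smul_zero]
    | zero => rw [smul_zero, map_zero, smul_zero]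
    | add a b _ _ ha hb => rw [smul_add, map_add, map_add, ha, hb, smul_add]
  refine ⟨fun j => DualMod.ext fun x => ?_, fun γ => DualMod.ext fun x => ?_⟩
  · rw [DualMod.ap_of, transposeGen, unop_op, key _ (fun η => η j) (fun η x hx => H_smul hx j),
      map_smul, LinearMap.smul_apply]
  · rw [DualMod.ap_of, transposeGen, unop_op,
      key _ (fun η => iPow (form γ η)) (fun η x hx => UnrolledSl3.K_smul hx γ),
      map_smul, LinearMap.smul_apply]

/-- A nonzero vector of weight `y` is detected by a functional of weight `y`. -/
theorem DualMod.exists_ap_ne_zero (h : ⨆ η, goodSpace L X η = ⊤) {y : Weight} {z : X}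
    (hz : z ∈ goodSpace L X y) (h0 : z ≠ 0) :
    ∃ φ ∈ goodSpace L (DualMod L X) y, φ.ap z ≠ 0 := by
  have hz' : z ∉ ⨆ (η) (_ : η ≠ y), goodSpace L X η := fun hz' =>
    h0 (Submodule.disjoint_def.1 (iSupIndep_goodSpace y) z hz hz')
  obtain ⟨φ, hφ, hle⟩ := Submodule.exists_le_ker_of_notMem hz'
  refine ⟨φ, DualMod.mem_goodSpace h _ fun η hη x hx => ?_, hφ⟩
  exact hle (Submodule.mem_iSup_of_mem η (Submodule.mem_iSup_of_mem hη hx))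

/-- The submodule generated by a typical maximal vector is a direct summand. -/
theorem IsMax.exists_isCompl {i j : Fin 2} (hij : i ≠ j) {y : Weight} (hy : typ i j y ≠ 0)
    (h : ⨆ η, goodSpace L X η = ⊤) {z : X} (hz : IsMax L y z) (h0 : z ≠ 0) :
    ∃ K : Submodule (U L) X, IsCompl (Submodule.span (U L) {z}) K := by
  obtain ⟨ζ, hζ, hζz⟩ := DualMod.exists_ap_ne_zero h hz.mem h0
  set φ := eTop L i j • fTop L i j • ζ with hφ
  have hmax : IsMax L y φ := isMax_eTop_fTop hij hζ
  have hφz : φ.ap z ≠ 0 := by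
    rw [hφ, DualMod.ap_eTop, DualMod.ap_fTop, hz.eTop_fTop hij, map_smul]
    exact smul_ne_zero hy hζz
  -- The complement is the annihilator of the submodule generated by `φ`. Since `φ` is maximal in
  -- the dual, eight functionals cut it out.
  let T : X →ₗ[ℂ] Fin 8 → ℂ := LinearMap.pi fun w => (word L i j w • φ).ap
  have hT (x : X) : x ∈ LinearMap.ker T ↔ ∀ ψ ∈ Submodule.span (U L) {φ}, ψ.ap x = 0 := by
    rw [LinearMap.mem_ker, funext_iff]
    refine ⟨fun hx ψ hψ => ?_, fun hx w =>
      hx _ (Submodule.smul_mem _ _ (Submodule.mem_span_singleton_self φ))⟩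
    obtain ⟨c, rfl⟩ := (hmax.mem_span_iff hij ψ).1 hψ
    rw [map_sum, LinearMap.sum_apply]
    refine Finset.sum_eq_zero fun w _ => ?_
    rw [map_smul, LinearMap.smul_apply, show (word L i j w • φ).ap x = 0 from hx w, smul_zero]
  let K : Submodule (U L) X := U.submodule (LinearMap.ker T) fun g x hx => by
    rw [hT] at hx ⊢
    intro ψ hψ
    rw [DualMod.ap_smul_of]
    exact hx _ (Submodule.smul_mem _ _ hψ)
  have hK (x : X) : x ∈ K ↔ T x = 0 := Iff.rfl
  -- The module generated by `z` is simple, so a nonzero intersection would contain `z`, on which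
  -- `φ` does not vanish.
  have hdisj : ∀ a ∈ Submodule.span (U L) {z}, a ∈ K → a = 0 := by
    intro a ha haK
    by_contra ha0
    have hzK : z ∈ K :=
      (Submodule.span_singleton_le_iff_mem a K).2 haK (hz.mem_span_of_mem hij hy ha ha0)
    exact hφz ((hT z).1 hzK φ (Submodule.mem_span_singleton_self φ))
  let B : (Fin 8 → ℂ) →ₗ[ℂ] X := Fintype.linearCombination ℂ fun w => word L i j w • z
  have hB (c : Fin 8 → ℂ) : B c ∈ Submodule.span (U L) {z} := by
    rw [hz.mem_span_iff hij]
    exact ⟨c, Fintype.linearCombination_apply ℂ _ c⟩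
  -- An injective endomorphism of an eight-dimensional space is surjective: the module generated by
  -- `z` attains every value of `T`, so together with the kernel of `T` it fills `X`.
  have hinj : Function.Injective (T ∘ₗ B) := by
    rw [← LinearMap.ker_eq_bot, LinearMap.ker_eq_bot']
    intro c hc
    have hBc := hdisj _ (hB c) hc
    rw [Fintype.linearCombination_apply] at hBc
    exact funext (Fintype.linearIndependent_iff.1 (hz.linearIndependent hij hy h0) c hBc)
  refine ⟨K, Submodule.disjoint_def.2 hdisj, codisjoint_iff.2 (eq_top_iff.2 fun x _ => ?_)⟩
  obtain ⟨c, hc⟩ := LinearMap.injective_iff_surjective.1 hinj (T x)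
  refine Submodule.mem_sup.2 ⟨B c, hB c, x - B c, ?_, add_sub_cancel _ _⟩
  rw [hK, map_sub, sub_eq_zero]
  exact hc.symm

/-- A typical maximal vector generates an irreducible module. -/
theorem IsMax.nonempty_irr_equiv {i j : Fin 2} (hij : i ≠ j) {y : Weight} (hy : typ i j y ≠ 0)
    {z : X} (hz : IsMax L y z) (h0 : z ≠ 0) :
    Nonempty (Irr L y ≃ₗ[U L] Submodule.span (U L) {z}) := by
  obtain ⟨f, hf⟩ := hz.exists_irr_lift hij hy
  have hinj : Function.Injective f := by
    rw [← LinearMap.ker_eq_bot]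
    refine irr_eq_bot fun htop => h0 ?_
    rw [← hf, ← LinearMap.mem_ker, htop]
    exact Submodule.mem_top
  have hrange : LinearMap.range f = Submodule.span (U L) {z} := by
    rw [← Submodule.map_top, ← span_irrGen, Submodule.map_span, Set.image_singleton, hf]
  exact ⟨(LinearEquiv.ofInjective f hinj).trans (LinearEquiv.ofEq _ _ hrange)⟩

/-- A typical maximal vector splits off an irreducible module. -/
theorem IsMax.nonempty_split {i j : Fin 2} (hij : i ≠ j) {y : Weight} (hy : typ i j y ≠ 0)
    (h : ⨆ η, goodSpace L X η = ⊤) {z : X} (hz : IsMax L y z) (h0 : z ≠ 0) :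
    Nonempty (X ≃ₗ[U L] Irr L y × (X ⧸ Submodule.span (U L) {z})) := by
  obtain ⟨K, hK⟩ := hz.exists_isCompl hij hy h h0
  obtain ⟨e⟩ := hz.nonempty_irr_equiv hij hy h0
  exact ⟨(Submodule.prodEquivOfIsCompl _ _ hK).symm.trans
    (LinearEquiv.prodCongr e.symm (Submodule.quotientEquivOfIsCompl _ _ hK).symm)⟩

end

/-! ### Chains -/

section

variable {L : MidLattice} {X : Type*} [AddCommGroup X] [Module ℂ X] [Module (U L) X]
  [IsScalarTower ℂ (U L) X]

/-- The weights of the generators of a chain. -/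
def chainWt (j : Fin 2) (ν : Weight) : Fin 4 → Weight :=
  ![ν, ν - α j, ν - α₃, ν - α j - α₃]

theorem α₃_apply {i j : Fin 2} (hij : i ≠ j) : α₃ i = 1 := by
  rw [← α_add hij, Pi.add_apply, α_self, α_ne hij]
  norm_num

/-- The values on the coroot `H j` are `ν j` minus 0, 2, 1, 3, which are distinct. -/
theorem chainWt_injective (j : Fin 2) (ν : Weight) : Function.Injective (chainWt j ν) := by
  obtain ⟨i, hij⟩ : ∃ i : Fin 2, j ≠ i := ⟨j + 1, by fin_cases j <;> decide⟩
  have key (k : Fin 4) : chainWt j ν k j = ν j - (![0, 2, 1, 3] : Fin 4 → ℂ) k := by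
    fin_cases k <;> simp [chainWt, α_self, α₃_apply hij]
    ring
  intro k l h
  have h' := key k
  rw [h, key l] at h'
  have h2 := sub_right_injective h'
  fin_cases k <;> fin_cases l <;> simp at h2 ⊢

variable (L) in
/-- A chain: generators, each of which is maximal modulo the preceding ones, and which are connected
by raising operators. -/
structure IsChain (i j : Fin 2) (ν : Weight) (n : Fin 4 → X) : Prop where
  mem (k : Fin 4) : n k ∈ goodSpace L X (chainWt j ν k)
  E_zero (l : Fin 2) : U.of L (.E l) • n 0 = 0
  E_one : U.of L (.E i) • n 1 = 0
  E_one' : ∃ c : ℂ, c ≠ 0 ∧ U.of L (.E j) • n 1 = c • n 0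
  E_two : U.of L (.E j) • n 2 = 0
  E_two' : ∃ c : ℂ, c ≠ 0 ∧ U.of L (.E i) • n 2 = c • n 1
  E_three : U.of L (.E i) • n 3 = 0
  E_three' : ∃ c : ℂ, c ≠ 0 ∧ U.of L (.E j) • n 3 = c • n 2
  span_eq_top : Submodule.span (U L) (Set.range n) = ⊤

variable {i j : Fin 2} {ν : Weight} {n : Fin 4 → X}

theorem IsChain.map (hn : IsChain L i j ν n) {Y : Type*} [AddCommGroup Y] [Module ℂ Y]
    [Module (U L) Y] [IsScalarTower ℂ (U L) Y] (f : X →ₗ[U L] Y) (hf : Function.Surjective f) :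
    IsChain L i j ν (f ∘ n) where
  mem k := map_mem_goodSpace f (hn.mem k)
  E_zero l := by rw [Function.comp_apply, ← map_smul, hn.E_zero, map_zero]
  E_one := by rw [Function.comp_apply, ← map_smul, hn.E_one, map_zero]
  E_one' := by
    obtain ⟨c, hc, h⟩ := hn.E_one'
    exact ⟨c, hc, by rw [Function.comp_apply, ← map_smul, h, map_complex_smul]; rfl⟩
  E_two := by rw [Function.comp_apply, ← map_smul, hn.E_two, map_zero]
  E_two' := by
    obtain ⟨c, hc, h⟩ := hn.E_two'
    exact ⟨c, hc, by rw [Function.comp_apply, ← map_smul, h, map_complex_smul]; rfl⟩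
  E_three := by rw [Function.comp_apply, ← map_smul, hn.E_three, map_zero]
  E_three' := by
    obtain ⟨c, hc, h⟩ := hn.E_three'
    exact ⟨c, hc, by rw [Function.comp_apply, ← map_smul, h, map_complex_smul]; rfl⟩
  span_eq_top := by
    rw [Set.range_comp, ← Submodule.map_span, hn.span_eq_top, Submodule.map_top,
      LinearMap.range_eq_top.2 hf]

theorem IsChain.E_mem (hij : i ≠ j) (hn : IsChain L i j ν n) (l : Fin 2) (k : Fin 4) :
    U.of L (.E l) • n k ∈ Submodule.span ℂ (n '' {m | m < k}) := by
  have hmem {m k : Fin 4} (h : m < k) (c : ℂ) : c • n m ∈ Submodule.span ℂ (n '' {m | m < k}) :=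
    Submodule.smul_mem _ _ (Submodule.subset_span ⟨m, h, rfl⟩)
  obtain ⟨c₁, -, h₁⟩ := hn.E_one'
  obtain ⟨c₂, -, h₂⟩ := hn.E_two'
  obtain ⟨c₃, -, h₃⟩ := hn.E_three'
  match k with
  | 0 => exact hn.E_zero l ▸ Submodule.zero_mem _
  | 1 =>
    rcases eq_or_eq_of_ne hij l with rfl | rfl
    · exact hn.E_one ▸ Submodule.zero_mem _
    · exact h₁ ▸ hmem (by decide) c₁
  | 2 =>
    rcases eq_or_eq_of_ne hij l with rfl | rfl
    · exact h₂ ▸ hmem (by decide) c₂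
    · exact hn.E_two ▸ Submodule.zero_mem _
  | 3 =>
    rcases eq_or_eq_of_ne hij l with rfl | rfl
    · exact hn.E_three ▸ Submodule.zero_mem _
    · exact h₃ ▸ hmem (by decide) c₃

/-- Raising operators send a generator into the span of its predecessors, so the successive
quotients of a chain are highest weight modules. -/
theorem IsChain.isMax_mkQ (hij : i ≠ j) (hn : IsChain L i j ν n) {k : Fin 4}
    {R : Submodule (U L) X} (hR : ∀ m < k, n m ∈ R) : IsMax L (chainWt j ν k) (R.mkQ (n k)) := by
  refine ⟨map_mem_goodSpace _ (hn.mem k), fun l => ?_⟩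
  rw [← map_smul, Submodule.mkQ_apply, Submodule.Quotient.mk_eq_zero]
  have h : Submodule.span ℂ (n '' {m | m < k}) ≤ R.restrictScalars ℂ := by
    rw [Submodule.span_le]
    rintro _ ⟨m, hm, rfl⟩
    exact hR m hm
  exact h (hn.E_mem hij l k)

theorem IsChain.iSup_goodSpace (hn : IsChain L i j ν n) : ⨆ η, goodSpace L X η = ⊤ := by
  refine iSup_goodSpace_eq_top_of_span ?_ hn.span_eq_top
  rintro _ ⟨k, rfl⟩
  exact ⟨_, hn.mem k⟩

theorem IsChain.wordSpan_eq_top (hij : i ≠ j) (hn : IsChain L i j ν n) :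
    wordSpan L i j n = ⊤ := by
  rw [eq_top_iff]
  intro x _
  rw [← span_eq_wordSpan hij hn.mem fun l k =>
    Submodule.span_mono (Set.image_subset_range _ _) (hn.E_mem hij l k), hn.span_eq_top]
  exact Submodule.mem_top

/-- In a chain of maximal dimension no generator depends on the preceding ones. -/
theorem IsChain.notMem_span (hij : i ≠ j) (hn : IsChain L i j ν n)
    (hX : Module.finrank ℂ X = 32) (k : Fin 4) :
    n k ∉ Submodule.span (U L) (Set.range fun m : {m // m < k} => n m) := by
  -- Eight words on four generators span a space of dimension 32, so they form a basis.
  have hli : LinearIndependent ℂ fun p : Fin 8 × Fin 4 => word L i j p.1 • n p.2 :=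
    linearIndependent_of_top_le_span_of_card_eq_finrank
      (hn.wordSpan_eq_top hij).ge (by simp [hX])
  intro h
  rw [span_eq_wordSpan (y := fun m : {m // m < k} => chainWt j ν m) hij (fun m => hn.mem m)
    fun l m => Submodule.span_mono ?_ (hn.E_mem hij l m)] at h
  · refine hli.notMem_span_image (s := {p | p.2 < k}) (x := (0, k)) (by simp) ?_
    have h0 : word L i j 0 • n k = n k := one_smul _ _
    rw [h0]
    refine Submodule.span_mono ?_ h
    rintro _ ⟨⟨w, m⟩, rfl⟩
    exact ⟨(w, m), m.2, rfl⟩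
  · rintro _ ⟨m', hm', rfl⟩
    exact ⟨⟨m', hm'.trans m.2⟩, rfl⟩

/-- Modulo its predecessors the generator is a nonzero maximal vector, on which `eTop * fTop` is the
nonzero scalar `typ`. -/
theorem IsChain.eTop_fTop_ne_zero (hij : i ≠ j) (hn : IsChain L i j ν n)
    (hX : Module.finrank ℂ X = 32) {k : Fin 4} (hk : typ i j (chainWt j ν k) ≠ 0) :
    eTop L i j • fTop L i j • n k ≠ 0 := by
  intro h
  set R := Submodule.span (U L) (Set.range fun m : {m // m < k} => n m) with hR
  have hmax := hn.isMax_mkQ hij (R := R) (k := k) fun m hm => Submodule.subset_span ⟨⟨m, hm⟩, rfl⟩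
  have h1 := hmax.eTop_fTop hij
  rw [← map_smul, ← map_smul, h, map_zero] at h1
  refine hn.notMem_span hij hX k ?_
  rw [← hR, ← Submodule.Quotient.mk_eq_zero, ← Submodule.mkQ_apply]
  exact (smul_eq_zero.1 h1.symm).resolve_left hk

/-- A maximal vector in the module generated by a typical maximal vector has the same weight. -/
theorem IsMax.weight_eq_of_mem_span (hij : i ≠ j) {y y' : Weight} (hy' : typ i j y' ≠ 0)
    {z z' : X} (hz : IsMax L y z) (hz' : IsMax L y' z') (h0 : z' ≠ 0)
    (h : z' ∈ Submodule.span (U L) {z}) : y' = y := by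
  obtain ⟨c, hc⟩ := (hz.mem_span_iff hij z').1 h
  -- `fTop` kills every word except the empty one, so both vectors have the same lowest weight line,
  -- and the highest weights agree.
  have h1 : fTop L i j • z' = c 0 • fTop L i j • z := by
    rw [hc, Finset.smul_sum, Finset.sum_eq_single 0]
    · rw [U.commutes]
      congr 2
      exact one_smul _ _
    · intro w _ hw
      rw [U.commutes, fTop_smul_word hij hw, smul_zero]
    · simp
  have hmem : fTop L i j • z' ∈ goodSpace L X (y - wordWt i j 7) := by
    rw [h1]
    exact Submodule.smul_mem _ _ (word_smul_mem hz.mem i j 7)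
  have h2 := eq_of_mem_goodSpace (word_smul_mem hz'.mem i j 7) hmem (hz'.fTop_ne_zero hij hy' h0)
  exact sub_left_injective h2

/-! ### Projective modules -/

variable (L X) in
/-- Lifting of the maps out of `X` along surjections in the category. -/
def IsProj : Prop :=
  ∀ (M N : FDWeightModule L) (p : M.carrier →ₗ[U L] N.carrier) (f : X →ₗ[U L] N.carrier),
    Function.Surjective p → ∃ g : X →ₗ[U L] M.carrier, p ∘ₗ g = f

theorem IsProj.of_equiv_prod {Y Z : Type*} [AddCommGroup Y] [Module (U L) Y] [AddCommGroup Z]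
    [Module ℂ Z] [Module (U L) Z] [IsScalarTower ℂ (U L) Z]
    (hX : IsProj L X) (e : X ≃ₗ[U L] Y × Z) : IsProj L Z := by
  intro M N p f hp
  obtain ⟨g, hg⟩ := hX M N p (f ∘ₗ LinearMap.snd (U L) Y Z ∘ₗ e.toLinearMap) hp
  refine ⟨g ∘ₗ e.symm.toLinearMap ∘ₗ LinearMap.inr (U L) Y Z, ?_⟩
  rw [← LinearMap.comp_assoc, hg]
  ext x
  simp

theorem isProj_irr (hij : i ≠ j) {y : Weight} (hy : typ i j y ≠ 0) : IsProj L (Irr L y) :=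
  fun M _ p f hp => exists_irr_lift_of_surjective hij hy M.iSup_goodSpace p hp f

variable (L) in
/-- A finite-dimensional projective module of dimension `d` with a chain of generators, of which
those with index in `s` contribute a typical maximal vector. -/
structure ChainData (i j : Fin 2) (ν : Weight) (n : Fin 4 → X) (d : ℕ) (s : Set (Fin 4)) :
    Prop where
  chain : IsChain L i j ν n
  finite : Module.Finite ℂ X
  proj : IsProj L X
  finrank_eq : Module.finrank ℂ X = d
  ne_zero (k : Fin 4) : k ∈ s → eTop L i j • fTop L i j • n k ≠ 0
  eq_zero (k : Fin 4) : k ∉ s → typ i j (chainWt j ν k) ≠ 0 →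
    eTop L i j • fTop L i j • n k = 0

/-- The maximal vector made from `n k` generates an irreducible summand. The quotient by it is again
a summand, hence projective, and it inherits the chain. The other typical maximal vectors survive
because their weights differ from that of the summand. -/
theorem ChainData.split (hij : i ≠ j) {d : ℕ} {s : Set (Fin 4)} (hX : ChainData L i j ν n d s)
    {k : Fin 4} (hk : typ i j (chainWt j ν k) ≠ 0) (hks : k ∈ s)
    (hs : ∀ l ∈ s, typ i j (chainWt j ν l) ≠ 0) :
    ∃ N : Submodule (U L) X, Nonempty (X ≃ₗ[U L] Irr L (chainWt j ν k) × (X ⧸ N)) ∧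
      ChainData L i j ν (N.mkQ ∘ n) (d - 8) (s \ {k}) := by
  have := hX.finite
  set z := eTop L i j • fTop L i j • n k with hz
  have hmax : IsMax L (chainWt j ν k) z := isMax_eTop_fTop hij (hX.chain.mem k)
  obtain ⟨e⟩ := hmax.nonempty_split hij hk hX.chain.iSup_goodSpace (hX.ne_zero k hks)
  refine ⟨Submodule.span (U L) {z}, ⟨e⟩, hX.chain.map _ (Submodule.mkQ_surjective _),
    inferInstance, hX.proj.of_equiv_prod e, ?_, fun l hl h => ?_, fun l hl hl' => ?_⟩
  · have h1 := (e.restrictScalars ℂ).finrank_eq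
    rw [Module.finrank_prod, finrank_irr_of_typical hij hk, hX.finrank_eq] at h1
    omega
  · rw [Function.comp_apply, ← map_smul, ← map_smul, Submodule.mkQ_apply,
      Submodule.Quotient.mk_eq_zero] at h
    refine hl.2 (chainWt_injective j ν (hmax.weight_eq_of_mem_span hij (hs l hl.1)
      (isMax_eTop_fTop hij (hX.chain.mem l)) (hX.ne_zero l hl.1) h))
  · rw [Function.comp_apply, ← map_smul, ← map_smul, Submodule.mkQ_apply,
      Submodule.Quotient.mk_eq_zero]
    by_cases hlk : l = k
    · rw [hlk]
      exact Submodule.mem_span_singleton_self _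
    · rw [hX.eq_zero l (fun h => hl ⟨h, hlk⟩) hl']
      exact Submodule.zero_mem _

end

section

variable {L : MidLattice}

/-! ### Vectors in irreducible modules -/

section

variable {X : Type*} [AddCommGroup X] [Module ℂ X] [Module (U L) X] [IsScalarTower ℂ (U L) X]

/-- In an irreducible module a maximal vector vanishes if it is killed by raising after lowering,
and is obtained by raising. -/
theorem IsMax.eq_zero_of_qn_eq_zero {p q : Fin 2} (hpq : p ≠ q)
    (hX : ∀ a : X, a ≠ 0 → Submodule.span (U L) {a} = ⊤) {y : Weight} {m m' : X}
    (hm : IsMax L y m) (hy : qn (y p) = 0) (hm' : m' ∈ goodSpace L X (y - α p)) {c : ℂ}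
    (hc : c ≠ 0) (h : U.of L (.E p) • m' = c • m) : m = 0 := by
  by_contra h0
  -- As `qn (y p) = 0`, the vector `F p m` is again maximal. A nonzero one would generate the
  -- irreducible module from below its top weight, so it is zero.
  have hF : IsMax L (y - α p) (U.of L (.F p) • m) := by
    refine ⟨F_smul_mem hm.mem p, fun k => ?_⟩
    rcases eq_or_eq_of_ne hpq k with rfl | rfl
    · rw [hm.E_F, hy, zero_smul]
    · exact hm.E_F_ne hpq.symm
  have hF0 : U.of L (.F p) • m = 0 := by
    by_contra hF0
    exact h0 (hm.eq_zero_of_mem_span_F hpq hF (hX _ hF0 ▸ Submodule.mem_top))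
  -- The weight space of `m'` is spanned by `F p m = 0`, so nothing in it can be raised to `m`.
  obtain ⟨d, rfl⟩ := hm.exists_eq_smul_F hpq (hX m h0 ▸ Submodule.mem_top) hm'
  rw [hF0, smul_zero, smul_zero] at h
  exact (smul_ne_zero hc h0) h.symm

/-- The determinant of the two linear forms in `(c, d)` is `-qn (u + v + 1)`. When it vanishes, the
second form is the first times `qn (u + v)`, because `(qn v, qn (v + 1))` has square sum one. -/
theorem qn_combination_eq_zero {u v c d : ℂ} (h : qn (u + v + 1) = 0)
    (h1 : c * qn v + d * qn (v + 1) = 0) : c * qn (u + 1) + d * qn u = 0 := by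
  rw [add_assoc, qn_add, add_assoc, one_add_one_eq_two, qn_add_two] at h
  linear_combination (c * qn (u + 1) + d * qn u) * (-qn_sq_add v) +
    (qn v * qn (u + 1) + qn (v + 1) * qn u) * h1 + (c * qn (v + 1) - d * qn v) * h

/-- If a weight is atypical for the highest root, a vector below the maximal vector is killed by
one simple raising operator if it is killed by the other. -/
theorem IsMax.E_smul_eq_zero {p q : Fin 2} (hpq : p ≠ q) {y : Weight} {m m' : X}
    (hm : IsMax L y m) (h0 : m ≠ 0) (hy : qn (y p + y q + 1) = 0) (hp : qn (y p) ≠ 0)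
    (hm' : m' ∈ goodSpace L X (y - α p - α q)) (hspan : m' ∈ Submodule.span (U L) {m})
    (h : U.of L (.E q) • m' = 0) : U.of L (.E p) • m' = 0 := by
  obtain ⟨c, d, rfl⟩ := hm.exists_eq_smul_F_F hpq hspan hm'
  have hF : U.of L (.F p) • m ≠ 0 := by
    intro hF
    have h1 := hm.E_F p
    rw [hF, smul_zero] at h1
    exact smul_ne_zero hp h0 h1.symm
  -- `E q` and `E p` send `m'` to multiples of `F p m ≠ 0` and of `F q m`; the two coefficients are
  -- the proportional linear forms.
  rw [smul_add, U.commutes, U.commutes, hm.E_F_F' hpq.symm, hm.E_F_F hpq.symm,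
    smul_smul (M := ℂ), smul_smul (M := ℂ), ← add_smul] at h
  rw [smul_add, U.commutes, U.commutes, hm.E_F_F' hpq, hm.E_F_F hpq,
    smul_smul (M := ℂ), smul_smul (M := ℂ), ← add_smul,
    qn_combination_eq_zero hy ((smul_eq_zero.1 h).resolve_right hF), zero_smul]

end

/-! ### Superfluous generators of chains -/

section

variable {X : Type*} [AddCommGroup X] [Module ℂ X] [Module (U L) X] [IsScalarTower ℂ (U L) X]
  {i j : Fin 2} {ν : Weight} {n : Fin 4 → X}

/-- The conditions under which a generator of a chain does not survive in any irreducible quotient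
that is generated by it. -/
def Superfluous (i j : Fin 2) (ν : Weight) : Fin 4 → Prop :=
  ![qn (ν j) = 0 ∨ qn (ν i + ν j + 1) = 0 ∧ qn (ν i) ≠ 0,
    qn (ν i + 1) = 0 ∨ qn (ν i + ν j) = 0 ∧ qn (ν j) ≠ 0,
    qn (ν j + 1) = 0, False]

/-- In the simple quotient by `K` the image of `n k` is maximal. If its weight is atypical for the
simple root leading to the next generator, that generator cannot be raised to it. If it is atypical
for the highest root, the generator two steps below is killed by one simple raising operator, hence
by the other, and the links of the chain then collapse upwards to `n k`. -/
theorem Superfluous.mem (hij : i ≠ j) (hn : IsChain L i j ν n) {k : Fin 4}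
    (hk : Superfluous i j ν k) {K : Submodule (U L) X} (hK : IsCoatom K)
    (h : ∀ l < k, n l ∈ K) : n k ∈ K := by
  have hsimple : IsSimpleModule (U L) (X ⧸ K) := isSimpleModule_iff_isCoatom.2 hK
  have hS (a : X ⧸ K) (ha : a ≠ 0) : Submodule.span (U L) {a} = ⊤ :=
    IsSimpleModule.span_singleton_eq_top (U L) ha
  have hmax := hn.isMax_mkQ hij h
  have hch := hn.map K.mkQ (Submodule.mkQ_surjective K)
  have hmkQ {x : X} : x ∈ K ↔ K.mkQ x = 0 := by
    rw [Submodule.mkQ_apply, Submodule.Quotient.mk_eq_zero]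
  rw [hmkQ]
  obtain ⟨c₁, hc₁, h₁⟩ := hch.E_one'
  obtain ⟨c₂, hc₂, h₂⟩ := hch.E_two'
  obtain ⟨c₃, hc₃, h₃⟩ := hch.E_three'
  have h10 (h : K.mkQ (n 1) = 0) : K.mkQ (n 0) = 0 := by
    simp only [Function.comp_apply] at h₁
    rw [h, smul_zero] at h₁
    exact (smul_eq_zero.1 h₁.symm).resolve_left hc₁
  have h21 (h : U.of L (.E i) • K.mkQ (n 2) = 0) : K.mkQ (n 1) = 0 := by
    simp only [Function.comp_apply] at h₂
    rw [h] at h₂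
    exact (smul_eq_zero.1 h₂.symm).resolve_left hc₂
  have h32 (h : U.of L (.E j) • K.mkQ (n 3) = 0) : K.mkQ (n 2) = 0 := by
    simp only [Function.comp_apply] at h₃
    rw [h] at h₃
    exact (smul_eq_zero.1 h₃.symm).resolve_left hc₃
  have hαi : α₃ = α i + α j := (α_add hij).symm
  match k with
  | 0 =>
    rcases hk with hk | ⟨hk, hk'⟩
    · exact hmax.eq_zero_of_qn_eq_zero hij.symm hS hk (hch.mem 1) hc₁ h₁
    · by_contra h0
      refine h0 (h10 (h21 (hmax.E_smul_eq_zero hij h0 hk hk' ?_ ?_ hch.E_two)))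
      · exact mem_goodSpace_of_eq (hch.mem 2) (by simp only [chainWt, hαi]; exact sub_add_eq_sub_sub _ _ _)
      · exact hS _ h0 ▸ Submodule.mem_top
  | 1 =>
    have hi : chainWt j ν 1 i = ν i + 1 := by simp [chainWt, α_ne hij]
    have hj : chainWt j ν 1 j = ν j - 2 := by simp [chainWt, α_self]
    rcases hk with hk | ⟨hk, hk'⟩
    · refine hmax.eq_zero_of_qn_eq_zero hij hS (hi ▸ hk)
        (mem_goodSpace_of_eq (hch.mem 2) ?_) hc₂ h₂
      simp only [chainWt, hαi]
      exact sub_add_eq_sub_sub_swap _ _ _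
    · by_contra h0
      refine h0 (h21 ?_)
      have h3 := h32 (hmax.E_smul_eq_zero hij.symm h0 ?_ ?_ ?_ ?_ hch.E_three)
      · rw [h3, smul_zero]
      · rw [hi, hj, show ν j - 2 + (ν i + 1) + 1 = ν i + ν j by ring, hk]
      · rw [hj, qn_sub_two]
        exact neg_ne_zero.2 hk'
      · refine mem_goodSpace_of_eq (hch.mem 3) ?_
        simp only [chainWt, hαi]
        exact sub_add_eq_sub_sub_swap _ _ _
      · exact hS _ h0 ▸ Submodule.mem_top
  | 2 =>
    refine hmax.eq_zero_of_qn_eq_zero hij.symm hS ?_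
      (mem_goodSpace_of_eq (hch.mem 3) ?_) hc₃ h₃
    · have hj : chainWt j ν 2 j = ν j - 1 := by simp [chainWt, α₃_apply hij.symm]
      rw [hj, qn_sub_one, show qn (ν j + 1) = 0 from hk, neg_zero]
    · simp only [chainWt]
      exact sub_right_comm _ _ _
  | 3 => exact hk.elim

/-- After the typical summand has been split off, `eTop * fTop` kills `n k`, yet modulo the earlier
generators it multiplies `n k` by a nonzero scalar. -/
theorem IsChain.mem_of_typical (hij : i ≠ j) (hn : IsChain L i j ν n) {k : Fin 4}
    (hk : typ i j (chainWt j ν k) ≠ 0) (h0 : eTop L i j • fTop L i j • n k = 0)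
    {K : Submodule (U L) X} (h : ∀ l < k, n l ∈ K) : n k ∈ K := by
  have h1 := (hn.isMax_mkQ hij h).eTop_fTop hij
  rw [← map_smul, ← map_smul, h0, map_zero] at h1
  rw [← Submodule.Quotient.mk_eq_zero, ← Submodule.mkQ_apply]
  exact (smul_eq_zero.1 h1.symm).resolve_left hk

/-! ### Projective covers -/

/-- A module maps onto an irreducible module with superfluous kernel, if every maximal submodule
contains a given submodule, modulo which it is generated by a maximal vector. -/
theorem exists_superfluous_map [IsCoatomic (Submodule (U L) X)] [Nontrivial X] {y : Weight} {g : X}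
    {R : Submodule (U L) X} (hmax : IsMax L y (R.mkQ g))
    (hK : ∀ K : Submodule (U L) X, IsCoatom K → R ≤ K ∧ g ∉ K) :
    ∃ p : X →ₗ[U L] Irr L y, Function.Surjective p ∧
      ∀ N : Submodule (U L) X, N.map p = ⊤ → N = ⊤ := by
  -- Otherwise some maximal submodule would contain `g`.
  have hgen : R ⊔ Submodule.span (U L) {g} = ⊤ := by
    by_contra htop
    obtain ⟨K, hKc, hle⟩ := (eq_top_or_exists_le_coatom _).resolve_left htop
    exact (hK K hKc).2 (hle (Submodule.mem_sup_right (Submodule.mem_span_singleton_self g)))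
  have hgR : g ∉ R := by
    obtain ⟨K, hKc, -⟩ := (eq_top_or_exists_le_coatom (⊥ : Submodule (U L) X)).resolve_left
      bot_ne_top
    exact fun h => (hK K hKc).2 ((hK K hKc).1 h)
  let q := hmax.lift
  have hqg : q (vermaGen L y) = R.mkQ g := hmax.lift_vermaGen
  have hq : Function.Surjective q := by
    rw [← LinearMap.range_eq_top, eq_top_iff, ← LinearMap.range_eq_top.2 (Submodule.mkQ_surjective R),
      ← Submodule.map_top, ← hgen, Submodule.map_sup, Submodule.map_span, Set.image_singleton,
      sup_le_iff]
    constructor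
    · rw [Submodule.mkQ_map_self]
      exact bot_le
    · rw [Submodule.span_singleton_le_iff_mem, ← hqg]
      exact LinearMap.mem_range_self q _
  have hle {N : Submodule (U L) (Verma L y)} (hN : vermaGen L y ∉ N) : N ≤ vermaMax L y :=
    le_sSup fun h => hN (h ▸ Submodule.mem_top)
  have hker : LinearMap.ker q ≤ vermaMax L y := hle fun h => hgR <| by
    rwa [LinearMap.mem_ker, hqg, Submodule.mkQ_apply, Submodule.Quotient.mk_eq_zero] at h
  have hker' : LinearMap.ker q ≤ LinearMap.ker (vermaMax L y).mkQ := by rwa [Submodule.ker_mkQ]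
  -- The quotient by `R` is the Verma module modulo the proper submodule `ker q`, so the projection
  -- onto the irreducible quotient factors through it.
  let p' : (X ⧸ R) →ₗ[U L] Irr L y :=
    (LinearMap.ker q).liftQ (vermaMax L y).mkQ hker' ∘ₗ
      (q.quotKerEquivOfSurjective hq).symm.toLinearMap
  have hp' (v : Verma L y) : p' (q v) = (vermaMax L y).mkQ v := by
    have h1 : (q.quotKerEquivOfSurjective hq).symm (q v) = (LinearMap.ker q).mkQ v := by
      rw [LinearEquiv.symm_apply_eq]
      rfl
    change (LinearMap.ker q).liftQ _ hker' ((q.quotKerEquivOfSurjective hq).symm (q v)) = _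
    rw [h1]
    rfl
  refine ⟨p' ∘ₗ R.mkQ, ?_, fun N hN => ?_⟩
  · rw [LinearMap.coe_comp]
    refine Function.Surjective.comp (fun a => ?_) (Submodule.mkQ_surjective R)
    obtain ⟨v, rfl⟩ := Submodule.mkQ_surjective _ a
    exact ⟨q v, hp' v⟩
  -- A proper `N` lies in a maximal `K`. The preimage of `K / R` in the Verma module misses the
  -- generator, so it is killed in `Irr L y`, although `N` was to reach `irrGen`.
  · by_contra htop
    obtain ⟨K, hKc, hNK⟩ := (eq_top_or_exists_le_coatom _).resolve_left htop
    obtain ⟨hRK, hgK⟩ := hK K hKc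
    have hv : vermaGen L y ∉ (K.map R.mkQ).comap q := by
      rw [Submodule.mem_comap, hqg]
      rintro ⟨k, hk, hkg⟩
      rw [← sub_eq_zero, ← map_sub, Submodule.mkQ_apply, Submodule.Quotient.mk_eq_zero] at hkg
      exact hgK ((Submodule.sub_mem_iff_right K hk).1 (hRK hkg))
    obtain ⟨x, hx, hpx⟩ : irrGen L y ∈ N.map (p' ∘ₗ R.mkQ) := hN ▸ Submodule.mem_top
    obtain ⟨v, hv'⟩ := hq (R.mkQ x)
    refine irrGen_ne_zero (L := L) y ?_
    rw [← hpx, LinearMap.comp_apply, ← hv', hp', Submodule.mkQ_apply, Submodule.Quotient.mk_eq_zero]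
    refine hle hv ?_
    rw [Submodule.mem_comap, hv']
    exact ⟨x, hNK hx, rfl⟩

/-- In the order of the chain, every generator other than `n x` is forced into each maximal
submodule. If `n x` lay in one as well, the whole chain would. So the head is simple, with highest
weight that of `n x`. -/
theorem ChainData.exists_map (hij : i ≠ j) {d : ℕ} {s : Set (Fin 4)} (hX : ChainData L i j ν n d s)
    (hd : d ≠ 0) {x : Fin 4}
    (h : ∀ k ≠ x, Superfluous i j ν k ∨ k ∉ s ∧ typ i j (chainWt j ν k) ≠ 0) :
    ∃ p : X →ₗ[U L] Irr L (chainWt j ν x), Function.Surjective p ∧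
      ∀ N : Submodule (U L) X, N.map p = ⊤ → N = ⊤ := by
  have := hX.finite
  have : Module.Finite (U L) X := Module.Finite.of_restrictScalars_finite ℂ (U L) X
  have : Nontrivial X := by
    refine Module.nontrivial_of_finrank_pos (R := ℂ) ?_
    rw [hX.finrank_eq]
    exact Nat.pos_of_ne_zero hd
  have hdead {K : Submodule (U L) X} (hK : IsCoatom K) {k : Fin 4} (hk : k ≠ x)
      (hlt : ∀ l < k, n l ∈ K) : n k ∈ K := by
    rcases h k hk with h1 | ⟨h1, h2⟩
    · exact h1.mem hij hX.chain hK hlt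
    · exact hX.chain.mem_of_typical hij h2 (hX.eq_zero k h1 h2) hlt
  have hlt {K : Submodule (U L) X} (hK : IsCoatom K) : ∀ k < x, n k ∈ K := by
    intro k
    induction k using WellFoundedLT.induction with
    | ind k ih => exact fun hk => hdead hK hk.ne fun l hl => ih l hl (hl.trans hk)
  refine exists_superfluous_map (g := n x)
    (R := Submodule.span (U L) (Set.range fun m : {m // m < x} => n m))
    (hX.chain.isMax_mkQ hij fun m hm => Submodule.subset_span ⟨⟨m, hm⟩, rfl⟩)
    fun K hK => ⟨?_, fun hx => hK.1 ?_⟩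
  · rw [Submodule.span_le]
    rintro _ ⟨m, rfl⟩
    exact hlt hK m m.2
  · rw [eq_top_iff, ← hX.chain.span_eq_top, Submodule.span_le]
    rintro _ ⟨k, rfl⟩
    induction k using WellFoundedLT.induction with
    | ind k ih =>
      by_cases hk : k = x
      · exact hk ▸ hx
      · exact hdead hK hk ih

end

end

/-! ### Sums of projective covers -/

section

variable {L : MidLattice}

theorem isSumOfProjectives_singleton {V : Type} [AddCommGroup V] [Module (U L) V] {d : ℕ}
    {y : Weight} (P : FDWeightModule L) (hP : P.IsProjectiveCover (Irr L y))
    (hd : Module.finrank ℂ P.carrier = d) (e : V ≃ₗ[U L] P.carrier) :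
    IsSumOfProjectives L V [(d, y)] := by
  refine ⟨fun _ => P, fun k => ?_, ⟨e.trans (LinearEquiv.funUnique (Fin 1) (U L) P.carrier).symm⟩⟩
  obtain rfl : k = 0 := Subsingleton.elim (α := Fin 1) _ _
  exact ⟨hP, hd⟩

theorem isSumOfProjectives_cons {V W : Type} [AddCommGroup V] [Module (U L) V] [AddCommGroup W]
    [Module (U L) W] {d : ℕ} {y : Weight} {l : List (ℕ × Weight)} (P : FDWeightModule L)
    (hP : P.IsProjectiveCover (Irr L y)) (hd : Module.finrank ℂ P.carrier = d)
    (e : V ≃ₗ[U L] P.carrier × W) (hW : IsSumOfProjectives L W l) :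
    IsSumOfProjectives L V ((d, y) :: l) := by
  obtain ⟨Q, hQ, ⟨e'⟩⟩ := hW
  refine ⟨Fin.cons (α := fun _ => FDWeightModule L) P Q, fun k => ?_, ⟨?_⟩⟩
  · refine Fin.cases ?_ (fun k => ?_) k
    · exact ⟨hP, hd⟩
    · exact hQ k
  · exact (e.trans (LinearEquiv.prodCongr (LinearEquiv.refl _ _) e')).trans
      (Fin.consLinearEquiv (U L) fun k : Fin (l.length + 1) =>
        (Fin.cons (α := fun _ => FDWeightModule L) P Q k : FDWeightModule L).carrier)

theorem IsSumOfProjectives.reindex {V : Type} [AddCommGroup V] [Module (U L) V]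
    {l l' : List (ℕ × Weight)} (h : IsSumOfProjectives L V l) (σ : Fin l'.length ≃ Fin l.length)
    (hσ : ∀ k, l.get (σ k) = l'.get k) : IsSumOfProjectives L V l' := by
  obtain ⟨P, hP, ⟨e⟩⟩ := h
  refine ⟨fun k => P (σ k), fun k => ?_, ⟨e.trans
    (LinearEquiv.piCongrLeft (U L) (fun k => (P k).carrier) σ).symm⟩⟩
  rw [← hσ k]
  exact hP (σ k)

theorem isProjectiveCover_irr {i j : Fin 2} (hij : i ≠ j) {y : Weight} (hy : typ i j y ≠ 0) :
    (FDWeightModule.mk' (L := L) (Irr L y) (finite_irr y) (iSup_goodSpace_irr y)).IsProjectiveCover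
      (Irr L y) :=
  ⟨isProj_irr hij hy, LinearMap.id, Function.surjective_id, fun N hN => by
    rwa [← Submodule.map_id N]⟩

/-- A module with a chain of generators is the sum of the irreducible modules that are generated by
its typical maximal vectors, and of one further projective cover. -/
theorem ChainData.isSumOfProjectives {i j : Fin 2} (hij : i ≠ j) {ν : Weight} {x : Fin 4} {d : ℕ}
    (hd : d ≠ 0) (t : List (Fin 4)) (ht : t.Nodup) {X : Type} [AddCommGroup X] [Module ℂ X]
    [Module (U L) X] [IsScalarTower ℂ (U L) X] {n : Fin 4 → X} {s : Set (Fin 4)}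
    (hX : ChainData L i j ν n (d + 8 * t.length) s) (hts : ∀ k ∈ t, k ∈ s)
    (hs : ∀ k ∈ s, typ i j (chainWt j ν k) ≠ 0)
    (h : ∀ k ≠ x, Superfluous i j ν k ∨ (k ∈ s → k ∈ t) ∧ typ i j (chainWt j ν k) ≠ 0) :
    IsSumOfProjectives L X (t.map (fun k => (8, chainWt j ν k)) ++ [(d, chainWt j ν x)]) := by
  induction t generalizing X s with
  | nil =>
    have hcov := hX.exists_map hij hd (x := x) fun k hk => (h k hk).imp_right fun h' =>
      ⟨fun hks => List.not_mem_nil (h'.1 hks), h'.2⟩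
    exact isSumOfProjectives_singleton
      (FDWeightModule.mk' (L := L) X hX.finite hX.chain.iSup_goodSpace) ⟨hX.proj, hcov⟩
      hX.finrank_eq (LinearEquiv.refl _ _)
  | cons k t ih =>
    have hk := hts k List.mem_cons_self
    obtain ⟨N, ⟨e⟩, hN⟩ := hX.split hij (hs k hk) hk hs
    rw [List.length_cons, mul_add, mul_one, ← add_assoc, Nat.add_sub_cancel] at hN
    rw [List.nodup_cons] at ht
    refine isSumOfProjectives_cons _ (isProjectiveCover_irr hij (hs k hk))
      (finrank_irr_of_typical hij (hs k hk)) e (ih ht.2 hN (fun l hl => ?_) (fun l hl => hs l hl.1)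
        fun l hl => (h l hl).imp_right fun h' => ⟨fun hls => ?_, h'.2⟩)
    · exact ⟨hts l (List.mem_cons_of_mem _ hl), fun hlk => ht.1 (hlk ▸ hl)⟩
    · exact (List.mem_cons.1 (h'.1 hls.1)).resolve_left hls.2

end

section

variable {L : MidLattice} {i j : Fin 2}

/-! ### The four-dimensional irreducible modules -/

theorem iPow_ne_zero (z : ℂ) : iPow z ≠ 0 := Complex.exp_ne_zero _

variable (L) in
/-- The weight vectors of the irreducible modules of dimension four. -/
def irrVec (i j : Fin 2) (y : Weight) : Fin 4 → Irr L y :=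
  ![irrGen L y, U.of L (.F j) • irrGen L y, U.of L (.F i) • U.of L (.F j) • irrGen L y,
    U.of L (.F j) • U.of L (.F i) • U.of L (.F j) • irrGen L y]

variable {y : Weight}

theorem IsMax.E_F_F_F {X : Type*} [AddCommGroup X] [Module ℂ X] [Module (U L) X]
    [IsScalarTower ℂ (U L) X] (hij : i ≠ j) {z : X} (hz : IsMax L y z) :
    U.of L (.E i) • U.of L (.F j) • U.of L (.F i) • U.of L (.F j) • z = 0 := by
  rw [E_F_smul_ne hij, hz.E_F_F hij, U.commutes, F_F_smul, smul_zero]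

/-- The vector is maximal of lower weight, and a nonzero one would have to generate the irreducible
module. -/
theorem F_smul_irrGen (hij : i ≠ j) (hi : qn (y i) = 0) : U.of L (.F i) • irrGen L y = 0 := by
  by_contra h0
  have hmax := isMax_irrGen (L := L) y
  refine irrGen_ne_zero (L := L) y (hmax.eq_zero_of_mem_span_F hij ⟨F_smul_mem hmax.mem i,
    fun k => ?_⟩ (irrGen_mem_span h0))
  rcases eq_or_eq_of_ne hij k with rfl | rfl
  · rw [hmax.E_F, hi]
    exact zero_smul ℂ (irrGen L y)
  · exact hmax.E_F_ne hij.symm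

theorem irrVec_mem (hij : i ≠ j) (k : Fin 4) :
    irrVec L i j y k ∈ goodSpace L (Irr L y) (chainWt j y k) := by
  have h0 := (isMax_irrGen (L := L) y).mem
  have h1 := F_smul_mem h0 j
  have h2 := mem_goodSpace_of_eq (F_smul_mem h1 i)
    (show y - α j - α i = y - α₃ by rw [← α_add hij, sub_add_eq_sub_sub_swap])
  have h3 := mem_goodSpace_of_eq (F_smul_mem h2 j)
    (show y - α₃ - α j = y - α j - α₃ by rw [sub_right_comm])
  match k with
  | 0 => exact h0
  | 1 => exact h1
  | 2 => exact h2
  | 3 => exact h3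

/-- Words whose rightmost letter is `F i` vanish on the generator. So does the longest word, which
by the braid relation can be written with `F i` on the right. Four words remain. -/
theorem span_irrVec (hij : i ≠ j) (hi : qn (y i) = 0) :
    Submodule.span ℂ (Set.range (irrVec L i j y)) = ⊤ := by
  have hF := F_smul_irrGen (L := L) hij hi
  have hmem (k : Fin 4) := Submodule.subset_span (R := ℂ) (Set.mem_range_self (f := irrVec L i j y) k)
  rw [eq_top_iff]
  intro a _
  obtain ⟨c, rfl⟩ := ((isMax_irrGen (L := L) y).mem_span_iff hij a).1
    (by rw [span_irrGen]; exact Submodule.mem_top)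
  refine Submodule.sum_mem _ fun w _ => Submodule.smul_mem _ _ ?_
  have h7 := F_braid_smul (L := L) hij (irrGen L y)
  rw [hF, smul_zero, smul_zero, smul_zero] at h7
  match w with
  | 0 => exact (one_smul (U L) (irrGen L y)).symm ▸ hmem 0
  | 1 => exact hF.symm ▸ Submodule.zero_mem _
  | 2 => exact hmem 1
  | 3 => exact (mul_smul (U.of L (.F i)) (U.of L (.F j)) (irrGen L y)).symm ▸ hmem 2
  | 4 =>
    have h : word L i j 4 • irrGen L y = 0 := by
      simp only [word, Matrix.cons_val, mul_smul, hF, smul_zero]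
    exact h ▸ Submodule.zero_mem _
  | 5 =>
    have h : word L i j 5 • irrGen L y = 0 := by
      simp only [word, Matrix.cons_val, mul_smul, hF, smul_zero]
    exact h ▸ Submodule.zero_mem _
  | 6 =>
    have h : word L i j 6 • irrGen L y = irrVec L i j y 3 := by
      simp only [word, irrVec, Matrix.cons_val, mul_smul]
    exact h ▸ hmem 3
  | 7 =>
    have h : word L i j 7 • irrGen L y = 0 := by
      simp only [word, Matrix.cons_val, mul_smul, ← h7]
    exact h ▸ Submodule.zero_mem _

/-- The raising constants are `qn (y j)`, `qn (y i + 1)` and `-qn (y j + 1)`. The middle one is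
nonzero because its square is `1 - qn (y i) ^ 2 = 1`. -/
theorem isChain_irrVec (hij : i ≠ j) (hi : qn (y i) = 0) (hj : qn (y j) ≠ 0)
    (hj' : qn (y j + 1) ≠ 0) : IsChain L i j y (irrVec L i j y) := by
  have hF := F_smul_irrGen (L := L) hij hi
  have hmax := isMax_irrGen (L := L) y
  have hi' : qn (y i + 1) ≠ 0 := by
    intro h
    have := qn_sq_add (y i)
    rw [hi, h] at this
    norm_num at this
  have hE2 : U.of L (.E j) • irrVec L i j y 2 = 0 := by
    change U.of L (.E j) • U.of L (.F i) • U.of L (.F j) • irrGen L y = 0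
    rw [hmax.E_F_F' hij.symm, hF, smul_zero]
  have hE2' : U.of L (.E i) • irrVec L i j y 2 = qn (y i + 1) • irrVec L i j y 1 := hmax.E_F_F hij
  refine ⟨irrVec_mem hij, hmax.E_smul, hmax.E_F_ne hij, ⟨qn (y j), hj, hmax.E_F j⟩, hE2,
    ⟨qn (y i + 1), hi', hE2'⟩, ?_, ⟨-qn (y j + 1), neg_ne_zero.2 hj', ?_⟩, ?_⟩
  · exact hmax.E_F_F_F hij
  · change U.of L (.E j) • U.of L (.F j) • irrVec L i j y 2 = _
    rw [E_F_smul_self (irrVec_mem hij 2), hE2, smul_zero, zero_add]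
    have h : chainWt j y 2 j = y j - 1 := by simp [chainWt, α₃_apply hij.symm]
    rw [h, qn_sub_one]
  · rw [eq_top_iff]
    intro a _
    have ha : a ∈ Submodule.span ℂ (Set.range (irrVec L i j y)) := by
      rw [span_irrVec hij hi]
      exact Submodule.mem_top
    exact Submodule.span_le_restrictScalars ℂ (U L) _ ha

theorem irrVec_ne_zero (hij : i ≠ j) (hi : qn (y i) = 0) (hj : qn (y j) ≠ 0)
    (hj' : qn (y j + 1) ≠ 0) (k : Fin 4) : irrVec L i j y k ≠ 0 := by
  have h := isChain_irrVec (L := L) hij hi hj hj'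
  obtain ⟨c₁, hc₁, h₁⟩ := h.E_one'
  obtain ⟨c₂, hc₂, h₂⟩ := h.E_two'
  obtain ⟨c₃, hc₃, h₃⟩ := h.E_three'
  have h0 : irrVec L i j y 0 ≠ 0 := irrGen_ne_zero y
  have step {c : ℂ} (hc : c ≠ 0) {l : Fin 2} {a b : Irr L y} (hab : U.of L (.E l) • b = c • a)
      (ha : a ≠ 0) : b ≠ 0 := by
    rintro rfl
    rw [smul_zero] at hab
    exact smul_ne_zero hc ha hab.symm
  have h1 := step hc₁ h₁ h0
  have h2 := step hc₂ h₂ h1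
  match k with
  | 0 => exact h0
  | 1 => exact h1
  | 2 => exact h2
  | 3 => exact step hc₃ h₃ h2

variable (L) in
/-- A basis of weight vectors of an irreducible module of dimension four. -/
def irrBasis (hij : i ≠ j) (hi : qn (y i) = 0) (hj : qn (y j) ≠ 0) (hj' : qn (y j + 1) ≠ 0) :
    Module.Basis (Fin 4) ℂ (Irr L y) :=
  Module.Basis.mk (v := irrVec L i j y)
    ((iSupIndep_goodSpace.comp (chainWt_injective j y)).linearIndependent _ (irrVec_mem hij)
      (irrVec_ne_zero hij hi hj hj')) (span_irrVec hij hi).ge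

theorem irrBasis_apply (hij : i ≠ j) (hi : qn (y i) = 0) (hj : qn (y j) ≠ 0)
    (hj' : qn (y j + 1) ≠ 0) (k : Fin 4) : irrBasis L hij hi hj hj' k = irrVec L i j y k :=
  Module.Basis.mk_apply _ _ k

theorem finrank_irr_eq_four (hij : i ≠ j) (hi : qn (y i) = 0) (hj : qn (y j) ≠ 0)
    (hj' : qn (y j + 1) ≠ 0) : Module.finrank ℂ (Irr L y) = 4 := by
  rw [Module.finrank_eq_card_basis (irrBasis L hij hi hj hj'), Fintype.card_fin]

/-! ### The tensor product -/

theorem chainWt_add (j : Fin 2) (y y' : Weight) (k : Fin 4) :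
    chainWt j y k + y' = chainWt j (y + y') k := by
  fin_cases k <;> simp only [chainWt, Fin.reduceFinMk, Matrix.cons_val, Fin.zero_eta, Fin.isValue,
    Fin.mk_one] <;> abel

/-- Raising operators kill `irrGen`, so on `a ⊗ irrGen` they act through `a`, up to the nonzero
scalar by which `K` acts on `irrGen`. -/
theorem IsChain.tmk {X : Type*} [AddCommGroup X] [Module ℂ X] [Module (U L) X]
    [IsScalarTower ℂ (U L) X] {n : Fin 4 → X} (hn : IsChain L i j y n)
    (hspan : Submodule.span ℂ (Set.range n) = ⊤) (y' : Weight) :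
    IsChain L i j (y + y') fun k => UnrolledSl3.tmk L X (Irr L y') (n k) (irrGen L y') := by
  have hmax := isMax_irrGen (L := L) y'
  have hE (l : Fin 2) (a : X) : U.of L (.E l) • UnrolledSl3.tmk L X (Irr L y') a (irrGen L y') =
      iPow (form (L.root l) y') •
        UnrolledSl3.tmk L X (Irr L y') (U.of L (.E l) • a) (irrGen L y') := by
    rw [tmk_E, hmax.E_smul, UnrolledSl3.K_smul hmax.mem, map_zero, add_zero, map_smul]
  have hE0 {l : Fin 2} {a : X} (h : U.of L (.E l) • a = 0) :
      U.of L (.E l) • UnrolledSl3.tmk L X (Irr L y') a (irrGen L y') = 0 := by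
    rw [hE, h, map_zero, LinearMap.zero_apply, smul_zero]
  have hE1 {l : Fin 2} {a b : X} (h : ∃ c : ℂ, c ≠ 0 ∧ U.of L (.E l) • a = c • b) :
      ∃ c : ℂ, c ≠ 0 ∧ U.of L (.E l) • UnrolledSl3.tmk L X (Irr L y') a (irrGen L y') =
        c • UnrolledSl3.tmk L X (Irr L y') b (irrGen L y') := by
    obtain ⟨c, hc, h⟩ := h
    refine ⟨iPow (form (L.root l) y') * c, mul_ne_zero (iPow_ne_zero _) hc, ?_⟩
    rw [hE, h, map_smul, LinearMap.smul_apply, smul_smul (M := ℂ)]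
  refine ⟨fun k => chainWt_add j y y' k ▸ tmk_mem_goodSpace (hn.mem k) hmax.mem,
    fun l => hE0 (hn.E_zero l), hE0 hn.E_one, hE1 hn.E_one', hE0 hn.E_two, hE1 hn.E_two',
    hE0 hn.E_three, hE1 hn.E_three', ?_⟩
  rw [eq_top_iff, ← span_tmk_irrGen, Submodule.span_le]
  rintro _ ⟨a, rfl⟩
  have ha : a ∈ Submodule.span ℂ (Set.range n) := hspan ▸ Submodule.mem_top
  induction ha using Submodule.span_induction with
  | mem a ha =>
    obtain ⟨k, rfl⟩ := ha
    exact Submodule.subset_span ⟨k, rfl⟩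
  | zero =>
    simp only [map_zero, LinearMap.zero_apply]
    exact Submodule.zero_mem _
  | add a b _ _ ha hb =>
    simp only [map_add, LinearMap.add_apply]
    exact Submodule.add_mem _ ha hb
  | smul c a _ ha =>
    simp only [map_smul, LinearMap.smul_apply]
    exact Submodule.smul_of_tower_mem _ c ha

theorem finrank_tensor (V W : Type*) [AddCommGroup V] [Module ℂ V] [AddCommGroup W] [Module ℂ W] :
    Module.finrank ℂ (Tensor L V W) = Module.finrank ℂ V * Module.finrank ℂ W :=
  Module.finrank_tensorProduct (R := ℂ) (S := ℂ) (M := V) (M' := W)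

theorem finite_tensor (V W : Type*) [AddCommGroup V] [Module ℂ V] [AddCommGroup W] [Module ℂ W]
    [Module.Finite ℂ V] [Module.Finite ℂ W] : Module.Finite ℂ (Tensor L V W) :=
  inferInstanceAs (Module.Finite ℂ (V ⊗[ℂ] W))

/-- The starting point of the splitting: no summand has been removed, so every typical index
contributes. Projectivity comes from the typical factor. -/
theorem chainData_tensor (hij : i ≠ j) (hi : qn (y i) = 0) (hj : qn (y j) ≠ 0)
    (hj' : qn (y j + 1) ≠ 0) {y' : Weight} (hy' : typ i j y' ≠ 0) :
    ChainData L i j (y + y')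
      (fun k => tmk L (Irr L y) (Irr L y') (irrVec L i j y k) (irrGen L y')) 32
      {k | typ i j (chainWt j (y + y') k) ≠ 0} := by
  have hchain := (isChain_irrVec (L := L) hij hi hj hj').tmk (span_irrVec hij hi) y'
  have hrank : Module.finrank ℂ (Tensor L (Irr L y) (Irr L y')) = 32 := by
    rw [finrank_tensor, finrank_irr_eq_four hij hi hj hj', finrank_irr_of_typical hij hy']
  refine ⟨hchain, finite_tensor _ _, fun M N p f hp => ?_, hrank,
    fun k hk => hchain.eTop_fTop_ne_zero hij hrank hk, fun k hk hk' => (hk hk').elim⟩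
  exact exists_tensor_lift hij hy' (irrBasis L hij hi hj hj') (chainWt j y)
    (fun k => irrBasis_apply (L := L) hij hi hj hj' k ▸ irrVec_mem hij k) M.iSup_goodSpace p hp f

end

section

/-! ### Parity -/

theorem isEvenInt_iff_qn (z : ℂ) : IsEvenInt z ↔ qn z = 0 := (qn_eq_zero_iff z).symm

theorem isOddInt_iff_qn (z : ℂ) : IsOddInt z ↔ qn (z + 1) = 0 := (qn_succ_eq_zero_iff z).symm

theorem isInt_iff (z : ℂ) : IsInt z ↔ IsEvenInt z ∨ IsOddInt z := by
  constructor
  · rintro ⟨n, rfl⟩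
    rcases Int.even_or_odd' n with ⟨m, rfl | rfl⟩
    · exact Or.inl ⟨m, by push_cast; ring⟩
    · exact Or.inr ⟨m, by push_cast; ring⟩
  · rintro (⟨n, rfl⟩ | ⟨n, rfl⟩)
    · exact ⟨2 * n, by push_cast; ring⟩
    · exact ⟨2 * n + 1, by push_cast; ring⟩

theorem isInt_iff_qn (z : ℂ) : IsInt z ↔ qn z = 0 ∨ qn (z + 1) = 0 := by
  rw [isInt_iff, isEvenInt_iff_qn, isOddInt_iff_qn]

theorem qn_add_one_ne_zero {z : ℂ} (h : qn z = 0) : qn (z + 1) ≠ 0 := by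
  intro h'
  have := qn_sq_add z
  rw [h, h'] at this
  norm_num at this

theorem qn_add_two_mul_eq_zero_iff (z : ℂ) (m : ℤ) : qn (z + 2 * m) = 0 ↔ qn z = 0 := by
  rw [qn_eq_zero_iff, qn_eq_zero_iff]
  constructor
  · rintro ⟨n, hn⟩
    exact ⟨n - m, by push_cast; linear_combination hn⟩
  · rintro ⟨n, rfl⟩
    exact ⟨n + m, by push_cast; ring⟩

theorem typ_eq (i j : Fin 2) (y : Weight) :
    typ i j y = -(qn (y i) * qn (y j) * qn (y i + y j + 1)) := by
  rw [typ, add_assoc (y i), qn_add (y i) (y j + 1), add_assoc (y j) 1, one_add_one_eq_two,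
    qn_add_two]
  ring

variable {i j : Fin 2}

/-- The typicality of the weights of a chain. -/
theorem typ_chainWt_ne_zero (hij : i ≠ j) {ν : Weight} (hi : qn (ν i) ≠ 0) (k : Fin 4)
    (h : (![qn (ν j) ≠ 0 ∧ qn (ν i + ν j + 1) ≠ 0,
      qn (ν i + 1) ≠ 0 ∧ qn (ν j) ≠ 0 ∧ qn (ν i + ν j) ≠ 0,
      qn (ν i + 1) ≠ 0 ∧ qn (ν j + 1) ≠ 0 ∧ qn (ν i + ν j + 1) ≠ 0,
      qn (ν j + 1) ≠ 0 ∧ qn (ν i + ν j) ≠ 0] : Fin 4 → Prop) k) :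
    typ i j (chainWt j ν k) ≠ 0 := by
  rw [typ_eq, neg_ne_zero]
  match k with
  | 0 => exact mul_ne_zero (mul_ne_zero hi h.1) h.2
  | 1 =>
    have h1 : chainWt j ν 1 i = ν i + 1 := by simp [chainWt, α_ne hij]
    have h2 : chainWt j ν 1 j = ν j - 2 := by simp [chainWt, α_self]
    rw [h1, h2, show ν i + 1 + (ν j - 2) + 1 = ν i + ν j by ring, qn_sub_two]
    exact mul_ne_zero (mul_ne_zero h.1 (neg_ne_zero.2 h.2.1)) h.2.2
  | 2 =>
    have h1 : chainWt j ν 2 i = ν i - 1 := by simp [chainWt, α₃_apply hij]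
    have h2 : chainWt j ν 2 j = ν j - 1 := by simp [chainWt, α₃_apply hij.symm]
    rw [h1, h2, show ν i - 1 + (ν j - 1) + 1 = ν i + ν j - 1 by ring, qn_sub_one, qn_sub_one,
      qn_sub_one]
    exact mul_ne_zero (mul_ne_zero (neg_ne_zero.2 h.1) (neg_ne_zero.2 h.2.1)) (neg_ne_zero.2 h.2.2)
  | 3 =>
    have h1 : chainWt j ν 3 i = ν i := by simp [chainWt, α₃_apply hij, α_ne hij]
    have h2 : chainWt j ν 3 j = ν j - 2 - 1 := by simp [chainWt, α₃_apply hij.symm, α_self]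
    rw [h1, h2, show ν i + (ν j - 2 - 1) + 1 = ν i + ν j - 2 by ring, qn_sub_one, qn_sub_two,
      show ν j - 2 + 1 = ν j + 1 - 2 by ring, qn_sub_two, neg_neg]
    exact mul_ne_zero (mul_ne_zero hi h.1) (neg_ne_zero.2 h.2)

end

end UnrolledSl3
end

/-! ### The eight cases. -/

theorem mainTheorem6 (L : MidLattice) (i j : Fin 2) (hij : i ≠ j) (lam μ ν : Weight) (a b c : ℂ)
    (hlam_i : IsOddInt (idx lam (α i))) (hlam_j : ¬ IsInt (idx lam (α j)))
    (hlam_3 : ¬ IsInt (idx lam α₃)) (hμ : IsTypical μ) (hν : ν = lam + μ)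
    (ha : a = idx μ (α i)) (hb : b = idx lam (α j) + idx μ (α j))
    (hc : c = idx lam α₃ + idx μ α₃) :
    Module.finrank ℂ (Irr L lam) = 4 ∧ Module.finrank ℂ (Irr L μ) = 8 ∧
    (IsEvenInt a ∧ IsEvenInt b ∧ IsOddInt c →
      IsSumOfProjectives L (Tensor L (Irr L lam) (Irr L μ))
        [(24, ν - α₃), (8, ν - α j - α₃)]) ∧
    (IsEvenInt a ∧ IsOddInt b ∧ IsEvenInt c →
      IsSumOfProjectives L (Tensor L (Irr L lam) (Irr L μ))
        [(8, ν), (24, ν - α j - α₃)]) ∧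
    (IsEvenInt a ∧ ¬ IsInt b ∧ ¬ IsInt c →
      IsSumOfProjectives L (Tensor L (Irr L lam) (Irr L μ))
        [(8, ν), (16, ν - α₃), (8, ν - α j - α₃)]) ∧
    (¬ IsInt a ∧ IsEvenInt b ∧ ¬ IsInt c →
      IsSumOfProjectives L (Tensor L (Irr L lam) (Irr L μ))
        [(16, ν - α j), (8, ν - α₃), (8, ν - α j - α₃)]) ∧
    (¬ IsInt a ∧ IsOddInt b ∧ ¬ IsInt c →
      IsSumOfProjectives L (Tensor L (Irr L lam) (Irr L μ))
        [(8, ν), (8, ν - α j), (16, ν - α j - α₃)]) ∧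
    (¬ IsInt a ∧ ¬ IsInt b ∧ IsEvenInt c →
      IsSumOfProjectives L (Tensor L (Irr L lam) (Irr L μ))
        [(8, ν), (8, ν - α₃), (16, ν - α j - α₃)]) ∧
    (¬ IsInt a ∧ ¬ IsInt b ∧ IsOddInt c →
      IsSumOfProjectives L (Tensor L (Irr L lam) (Irr L μ))
        [(8, ν - α j), (16, ν - α₃), (8, ν - α j - α₃)]) ∧
    (¬ IsInt a ∧ ¬ IsInt b ∧ ¬ IsInt c →
      IsSumOfProjectives L (Tensor L (Irr L lam) (Irr L μ))
        [(8, ν), (8, ν - α j), (8, ν - α₃), (8, ν - α j - α₃)]) ∧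
    ((IsEvenInt a ∧ IsEvenInt b ∧ IsOddInt c) ∨
      (IsEvenInt a ∧ IsOddInt b ∧ IsEvenInt c) ∨
      (IsEvenInt a ∧ ¬ IsInt b ∧ ¬ IsInt c) ∨
      (¬ IsInt a ∧ IsEvenInt b ∧ ¬ IsInt c) ∨
      (¬ IsInt a ∧ IsOddInt b ∧ ¬ IsInt c) ∨
      (¬ IsInt a ∧ ¬ IsInt b ∧ IsEvenInt c) ∨
      (¬ IsInt a ∧ ¬ IsInt b ∧ IsOddInt c) ∨
      (¬ IsInt a ∧ ¬ IsInt b ∧ ¬ IsInt c)) := by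
  have hj0 : qn (lam j) ≠ 0 := by
    intro h
    refine hlam_j ((isInt_iff_qn _).2 (Or.inr ?_))
    rw [idx_α, add_assoc, one_add_one_eq_two, qn_add_two, h, neg_zero]
  have hj1 : qn (lam j + 1) ≠ 0 := fun h =>
    hlam_j ((isInt_iff_qn _).2 (Or.inl (by rwa [idx_α])))
  obtain ⟨m, hm⟩ := hlam_i
  rw [idx_α] at hm
  -- The index along `α i` is `lam i + 1`, so its oddness makes `lam i` the even integer `2 * m`.
  have hi0 : qn (lam i) = 0 := (qn_eq_zero_iff _).2 ⟨m, by linear_combination hm⟩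
  have hμt : typ i j μ ≠ 0 := typ_ne_zero hij (hμ.1 i) (hμ.1 j) hμ.2
  have hsum (y : Weight) : idx y α₃ = idx y (α i) + idx y (α j) := by
    rw [idx_α₃]
    rcases eq_or_eq_of_ne hij 0 with rfl | rfl
    · rcases eq_or_eq_of_ne hij 1 with h | rfl
      · exact absurd h (by decide)
      · rfl
    · rcases eq_or_eq_of_ne hij 1 with rfl | h
      · exact add_comm _ _
      · exact absurd h (by decide)
  -- Up to even integers `a`, `b`, `c` are `ν i + 1`, `ν j`, `ν i + ν j`, so all parity conditions
  -- become zeros of `qn` at `ν`.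
  have hνi : ν i + 1 = a + 2 * m := by
    rw [hν, ha, idx_α, Pi.add_apply]
    linear_combination hm
  have hb' : b = ν j + 2 := by
    rw [hν, hb, idx_α, idx_α, Pi.add_apply]
    ring
  have hc' : c = ν i + ν j + 4 := by
    rw [hν, hc, hsum, hsum, idx_α, idx_α, idx_α, idx_α, Pi.add_apply, Pi.add_apply]
    ring
  have hae : IsEvenInt a ↔ qn (ν i + 1) = 0 := by
    rw [hνi, qn_add_two_mul_eq_zero_iff, isEvenInt_iff_qn]
  have hi : qn (ν i) ≠ 0 := by
    intro h
    refine hμ.1 i ((isOddInt_iff_qn _).2 ?_)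
    rw [← ha, ← qn_add_two_mul_eq_zero_iff _ m, add_right_comm, ← hνi, add_assoc,
      one_add_one_eq_two, qn_add_two, h, neg_zero]
  have hai : IsInt a ↔ qn (ν i + 1) = 0 := by
    rw [isInt_iff, hae, or_iff_left (ha ▸ hμ.1 i)]
  have hbe : IsEvenInt b ↔ qn (ν j) = 0 := by
    rw [isEvenInt_iff_qn, hb', qn_add_two, neg_eq_zero]
  have hbo : IsOddInt b ↔ qn (ν j + 1) = 0 := by
    rw [isOddInt_iff_qn, hb', add_right_comm, qn_add_two, neg_eq_zero]
  have hce : IsEvenInt c ↔ qn (ν i + ν j) = 0 := by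
    rw [isEvenInt_iff_qn, hc', show ν i + ν j + 4 = ν i + ν j + 2 + 2 by ring, qn_add_two,
      qn_add_two, neg_neg]
  have hco : IsOddInt c ↔ qn (ν i + ν j + 1) = 0 := by
    rw [isOddInt_iff_qn, hc', show ν i + ν j + 4 + 1 = ν i + ν j + 1 + 2 + 2 by ring, qn_add_two,
      qn_add_two, neg_neg]
  have hdata := hν ▸ chainData_tensor (L := L) hij hi0 hj0 hj1 hμt
  have htyp := typ_chainWt_ne_zero hij hi
  -- Here `t` lists the generators whose irreducible summands are split off, and `x` is the one
  -- whose projective cover, of dimension `d`, remains. All others must be superfluous.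
  have main (d : ℕ) (hd : d ≠ 0) (x : Fin 4) (t : List (Fin 4)) (ht : t.Nodup)
      (hdt : d + 8 * t.length = 32) (hts : ∀ k ∈ t, typ i j (chainWt j ν k) ≠ 0)
      (h : ∀ k ≠ x, k ∉ t → Superfluous i j ν k) :
      IsSumOfProjectives L (Tensor L (Irr L lam) (Irr L μ))
        (t.map (fun k => (8, chainWt j ν k)) ++ [(d, chainWt j ν x)]) := by
    refine ChainData.isSumOfProjectives hij hd t ht (hdt ▸ hdata) hts (fun k hk => hk)
      fun k hk => ?_
    by_cases hkt : k ∈ t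
    · exact Or.inr ⟨fun _ => hkt, hts k hkt⟩
    · exact Or.inl (h k hk hkt)
  rw [isInt_iff b, isInt_iff c, hai, hae, hbe, hbo, hce, hco]
  refine ⟨finrank_irr_eq_four hij hi0 hj0 hj1, finrank_irr_of_typical hij hμt, ?_, ?_, ?_, ?_, ?_,
    ?_, ?_, ?_, ?_⟩
  · rintro ⟨hA, hB, hC⟩
    -- `main` puts the remaining cover last; the permutation restores the order of the statement,
    -- here and below.
    refine (main 24 (by decide) 2 [3] (by decide) rfl ?_ ?_).reindex (Equiv.swap 0 1)
      fun k => by fin_cases k <;> rfl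
    · simpa using htyp 3 ⟨qn_add_one_ne_zero hB, fun h => qn_add_one_ne_zero h hC⟩
    · intro k hk hkt
      match k with
      | 0 => exact Or.inl hB
      | 1 => exact Or.inl hA
      | 2 => exact absurd rfl hk
      | 3 => exact absurd (by decide) hkt
  · rintro ⟨hA, hB, hC⟩
    refine main 24 (by decide) 3 [0] (by decide) rfl ?_ ?_
    · simpa using htyp 0 ⟨fun h => qn_add_one_ne_zero h hB, qn_add_one_ne_zero hC⟩
    · intro k hk hkt
      match k with
      | 0 => exact absurd (by decide) hkt
      | 1 => exact Or.inl hA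
      | 2 => exact hB
      | 3 => exact absurd rfl hk
  · rintro ⟨hA, hB, hC⟩
    rw [not_or] at hB hC
    refine (main 16 (by decide) 2 [0, 3] (by decide) rfl ?_ ?_).reindex (Equiv.swap 1 2)
      fun k => by fin_cases k <;> rfl
    · simpa using And.intro (htyp 0 ⟨hB.1, hC.2⟩) (htyp 3 ⟨hB.2, hC.1⟩)
    · intro k hk hkt
      match k with
      | 0 => exact absurd (by decide) hkt
      | 1 => exact Or.inl hA
      | 2 => exact absurd rfl hk
      | 3 => exact absurd (by decide) hkt
  · rintro ⟨hA, hB, hC⟩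
    rw [not_or] at hC
    have hB' := qn_add_one_ne_zero hB
    refine (main 16 (by decide) 1 [2, 3] (by decide) rfl ?_ ?_).reindex (finRotate 3).symm
      fun k => by fin_cases k <;> rfl
    · simpa using And.intro (htyp 2 ⟨hA, hB', hC.2⟩) (htyp 3 ⟨hB', hC.1⟩)
    · intro k hk hkt
      match k with
      | 0 => exact Or.inl hB
      | 1 => exact absurd rfl hk
      | 2 => exact absurd (by decide) hkt
      | 3 => exact absurd (by decide) hkt
  · rintro ⟨hA, hB, hC⟩
    rw [not_or] at hC
    have hB' : qn (ν j) ≠ 0 := fun h => qn_add_one_ne_zero h hB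
    refine main 16 (by decide) 3 [0, 1] (by decide) rfl ?_ ?_
    · simpa using And.intro (htyp 0 ⟨hB', hC.2⟩) (htyp 1 ⟨hA, hB', hC.1⟩)
    · intro k hk hkt
      match k with
      | 0 => exact absurd (by decide) hkt
      | 1 => exact absurd (by decide) hkt
      | 2 => exact hB
      | 3 => exact absurd rfl hk
  · rintro ⟨hA, hB, hC⟩
    rw [not_or] at hB
    have hC' := qn_add_one_ne_zero hC
    refine main 16 (by decide) 3 [0, 2] (by decide) rfl ?_ ?_
    · simpa using And.intro (htyp 0 ⟨hB.1, hC'⟩) (htyp 2 ⟨hA, hB.2, hC'⟩)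
    · intro k hk hkt
      match k with
      | 0 => exact absurd (by decide) hkt
      | 1 => exact Or.inr ⟨hC, hB.1⟩
      | 2 => exact absurd (by decide) hkt
      | 3 => exact absurd rfl hk
  · rintro ⟨hA, hB, hC⟩
    rw [not_or] at hB
    have hC' : qn (ν i + ν j) ≠ 0 := fun h => qn_add_one_ne_zero h hC
    refine (main 16 (by decide) 2 [1, 3] (by decide) rfl ?_ ?_).reindex (Equiv.swap 1 2)
      fun k => by fin_cases k <;> rfl
    · simpa using And.intro (htyp 1 ⟨hA, hB.1, hC'⟩) (htyp 3 ⟨hB.2, hC'⟩)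
    · intro k hk hkt
      match k with
      | 0 => exact Or.inr ⟨hC, hi⟩
      | 1 => exact absurd (by decide) hkt
      | 2 => exact absurd rfl hk
      | 3 => exact absurd (by decide) hkt
  · rintro ⟨hA, hB, hC⟩
    rw [not_or] at hB hC
    -- Splitting off three eight-dimensional summands leaves the last generator with dimension
    -- eight, so its typicality need not be checked.
    refine main 8 (by decide) 3 [0, 1, 2] (by decide) rfl ?_ ?_
    · simpa using And.intro (htyp 0 ⟨hB.1, hC.2⟩)
        (And.intro (htyp 1 ⟨hA, hB.1, hC.1⟩) (htyp 2 ⟨hA, hB.2, hC.2⟩))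
    · intro k hk hkt
      match k with
      | 0 => exact absurd (by decide) hkt
      | 1 => exact absurd (by decide) hkt
      | 2 => exact absurd (by decide) hkt
      | 3 => exact absurd rfl hk
  -- By the addition formulas, an even `a` makes `c` even exactly when `b` is odd, and odd exactly
  -- when `b` is even. For `a` not an integer, `b` and `c` cannot both be integers.
  · have h1 : qn (ν i + ν j + 1) =
        qn (ν i) * qn (ν j + 1 + 1) + qn (ν i + 1) * qn (ν j + 1) := by rw [add_assoc, qn_add]
    have h2 : qn (ν i + ν j) = qn (ν i) * qn (ν j + 1) + qn (ν i + 1) * qn (ν j) := qn_add _ _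
    rw [add_assoc (ν j), one_add_one_eq_two, qn_add_two] at h1
    by_cases hA : qn (ν i + 1) = 0
    · rw [hA, zero_mul, add_zero] at h1 h2
      have h3 : qn (ν i + ν j + 1) = 0 ↔ qn (ν j) = 0 := by
        rw [h1, mul_eq_zero, or_iff_right hi, neg_eq_zero]
      have h4 : qn (ν i + ν j) = 0 ↔ qn (ν j + 1) = 0 := by
        rw [h2, mul_eq_zero, or_iff_right hi]
      by_cases hB : qn (ν j) = 0
      · exact Or.inl ⟨hA, hB, h3.2 hB⟩
      by_cases hB' : qn (ν j + 1) = 0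
      · exact Or.inr (Or.inl ⟨hA, hB', h4.2 hB'⟩)
      exact Or.inr (Or.inr (Or.inl ⟨hA, not_or.2 ⟨hB, hB'⟩,
        not_or.2 ⟨fun h => hB' (h4.1 h), fun h => hB (h3.1 h)⟩⟩))
    · have h3 (h : qn (ν j) = 0) : ¬(qn (ν i + ν j) = 0 ∨ qn (ν i + ν j + 1) = 0) := by
        have hB := qn_add_one_ne_zero h
        rw [h1, h2, h]
        simp [hA, hB, hi]
      have h4 (h : qn (ν j + 1) = 0) : ¬(qn (ν i + ν j) = 0 ∨ qn (ν i + ν j + 1) = 0) := by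
        have hB : qn (ν j) ≠ 0 := fun h' => qn_add_one_ne_zero h' h
        rw [h1, h2, h]
        simp [hA, hB, hi]
      iterate 3 refine Or.inr ?_
      by_cases hB : qn (ν j) = 0
      · exact Or.inl ⟨hA, hB, h3 hB⟩
      refine Or.inr ?_
      by_cases hB' : qn (ν j + 1) = 0
      · exact Or.inl ⟨hA, hB', h4 hB'⟩
      refine Or.inr ?_
      by_cases hC : qn (ν i + ν j) = 0
      · exact Or.inl ⟨hA, not_or.2 ⟨hB, hB'⟩, hC⟩
      refine Or.inr ?_
      by_cases hC' : qn (ν i + ν j + 1) = 0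
      · exact Or.inl ⟨hA, not_or.2 ⟨hB, hB'⟩, hC'⟩
      exact Or.inr ⟨hA, not_or.2 ⟨hB, hB'⟩, not_or.2 ⟨hC, hC'⟩⟩
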